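/- Theorem (Harmonic Riccati equation). Let $T>0$, $\omega=2\pi/T$, and let $n,m$ be natural numbers. For a $T$-periodic matrix function $F$ that is integrable over a period, with Fourier coefficients $F_k=\frac1T\int_{t-T}^{t}F(\tau)e^{-j\omega k\tau}\,d\tau$ ($k\in\mathbb Z$, independent of $t$), let $\mathcal T_T(F)$ be the infinite block Toeplitz matrix whose block in position $(k,l)\in\mathbb Z\times\mathbb Z$ is $F_{k-l}$, and let $\mathcal N=\mathrm{diag}(j\omega k\,\mathrm{Id}_n,\ k\in\mathbb Z)$. Let $A\in L^2([0,T],\mathbb R^{n\times n})$ and $B\in L^\infty([0,T],\mathbb R^{n\times m})$ be $T$-periodic, and let $R\in L^\infty([0,T],\mathbb R^{m\times m})$, $Q\in L^\infty([0,T],\mathbb R^{n\times n})$ be $T$-periodic with symmetric positive definite values almost everywhere. Assume that for some $\eta>0$ the set $\{t:|\det R(t)|<\eta\}$ has measure zero. Put $\mathcal A=\mathcal T_T(A)$, $\mathcal B=\mathcal T_T(B)$, $\mathcal R=\mathcal T_T(R)$, $\mathcal Q=\mathcal T_T(Q)$. Then $\mathcal Q$ is Hermitian positive definite, $\mathcal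 R$ is a bounded operator on $\ell^2(\mathbb C^m)$ with bounded inverse, and for every $T$-periodic $P\in L^2([0,T],\mathbb R^{n\times n})$, functions that agree almost everywhere being identified, the following are equivalent: (1) $P$ is the unique $T$-periodic solution with symmetric positive definite values of the periodic Riccati differential equation $$\dot P(t)+A'(t)P(t)+P(t)A(t)-P(t)B(t)R^{-1}(t)B'(t)P(t)+Q(t)=0$$ (in the sense of Carathéodory: locally absolutely continuous, the equation holding almost everywhere); (2) $\mathcal P=\mathcal T_T(P)$ is the unique Hermitian positive definite solution of the harmonic algebraic Riccati equation $$\mathcal P(\mathcal A-\mathcal N)+(\mathcal A-\mathcal N)^*\mathcal P-\mathcal P\mathcal B\mathcal R^{-1}\mathcal B^*\mathcal P+\mathcal Q=0 .$$ Moreover, in this case $\mathcal P$ is a bounded operator on $\ell^2(\mathbb C^n)$. In (2) the unknown ranges over all infinite matrices of complex $n\times n$ blocks, indexed by $\mathbb Z\times\mathbb Z$, whose columns are bounded in $\ell^2$; these include all bounded operators on $\ell^2(\mathbb C^n)$ and all block Toeplitz matrices with symbol in $L^2$. The equation is an identity between infinite matrices. A matrix $\mathcal X$ is Hermitian positive definite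 if $\mathcal X^*=\mathcal X$ and $\mathrm{Re}\,(V^*\mathcal XV)>0$ for all $V\neq0$ in $\ell^2(\mathbb C^n)$ with $\mathcal XV\in\ell^2(\mathbb C^n)$ (the rows of a Hermitian matrix of this class are in $\ell^2$, so that $\mathcal XV$ is defined; for bounded Hermitian $\mathcal X$ the number $V^*\mathcal XV$ is real). -/

import Mathlib

noncomputable section

namespace HarmonicRiccati

open MeasureTheory

/-- The Hilbert space `ℓ²(ℂⁿ)` of square summable sequences `k ∈ ℤ ↦ X_k ∈ ℂⁿ`; the pair `(k, a)`
indexes the `a`-th component of `X_k`. -/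
abbrev SeqSpace (n : ℕ) : Type := lp (fun _ : ℤ × Fin n => ℂ) 2

/-- Infinite matrices made of `n × m` complex blocks indexed by `ℤ × ℤ`. -/
abbrev BlockMatrix (n m : ℕ) : Type := Matrix (ℤ × Fin n) (ℤ × Fin m) ℂ

/-- A matrix function on `ℝ` whose restriction to `[0, T]` has all its entries in `L^p`. -/
def MemLpPeriod {n m : ℕ} (T : ℝ) (p : ENNReal) (A : ℝ → Matrix (Fin n) (Fin m) ℝ) : Prop :=
  ∀ a b, MemLp (fun τ => A τ a b) p (volume.restrict (Set.Icc 0 T))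

/-! ### The periodic Riccati differential equation -/

/-- `P` is a `T`-periodic symmetric positive definite Carathéodory solution of
`P' + AᵀP + PA - P B R⁻¹ Bᵀ P + Q = 0`: it is locally absolutely continuous and satisfies the
equation almost everywhere. -/
structure IsPeriodicSolution {n m : ℕ} (T : ℝ) (A : ℝ → Matrix (Fin n) (Fin n) ℝ)
    (B : ℝ → Matrix (Fin n) (Fin m) ℝ) (R : ℝ → Matrix (Fin m) (Fin m) ℝ)
    (Q P : ℝ → Matrix (Fin n) (Fin n) ℝ) : Prop where
  periodic : Function.Periodic P T
  posDef : ∀ t, (P t).PosDef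
  absCont : ∀ a b, ∀ s t : ℝ, AbsolutelyContinuousOnInterval (fun τ => P τ a b) s t
  equation : ∀ᵐ t : ℝ, ∀ a b, HasDerivAt (fun τ => P τ a b)
    ((-((A t).transpose * P t + P t * A t
        - P t * B t * (R t)⁻¹ * (B t).transpose * P t + Q t)) a b) t

/-- `P` is the only `T`-periodic symmetric positive definite solution. -/
def IsUniquePeriodicSolution {n m : ℕ} (T : ℝ) (A : ℝ → Matrix (Fin n) (Fin n) ℝ)
    (B : ℝ → Matrix (Fin n) (Fin m) ℝ) (R : ℝ → Matrix (Fin m) (Fin m) ℝ)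
    (Q P : ℝ → Matrix (Fin n) (Fin n) ℝ) : Prop :=
  IsPeriodicSolution T A B R Q P ∧ ∀ S, IsPeriodicSolution T A B R Q S → S = P

/-! ### Block Toeplitz matrices and the harmonic Riccati equation -/

/-- The `k`-th phasor `(1/T) ∫_{t-T}^t x(τ) e^{-jωkτ} dτ`, `ω = 2π/T`, of a real signal. -/
def phasor (T : ℝ) (x : ℝ → ℝ) (t : ℝ) (k : ℤ) : ℂ :=
  (1 / (T : ℂ)) * ∫ τ in (t - T)..t,
    (x τ : ℂ) * Complex.exp (-(Complex.I * ((2 * Real.pi / T : ℝ) : ℂ) * (k : ℂ) * (τ : ℂ)))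

/-- The block Toeplitz transform `𝒯_T(A)(t)`: its block in position `(k, l)` is the phasor
`A_{k-l}(t)`. -/
def toeplitz {n m : ℕ} (T : ℝ) (A : ℝ → Matrix (Fin n) (Fin m) ℝ) (t : ℝ) : BlockMatrix n m :=
  fun i j => phasor T (fun τ => A τ i.2 j.2) t (i.1 - j.1)

/-- `𝒩 = diag(jωk Id_n, k ∈ ℤ)`, `ω = 2π/T`. -/
def harmonicN (n : ℕ) (T : ℝ) : BlockMatrix n n :=
  Matrix.diagonal fun i => Complex.I * ((2 * Real.pi / T : ℝ) : ℂ) * (i.1 : ℂ)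

/-- Product of infinite matrices. -/
def mmul {n m p : ℕ} (X : BlockMatrix n m) (Y : BlockMatrix m p) : BlockMatrix n p :=
  fun i j => ∑' k, X i k * Y k j

/-- Product of an infinite matrix and a sequence. -/
def mulSeq {n m : ℕ} (X : BlockMatrix n m) (v : ℤ × Fin m → ℂ) : ℤ × Fin n → ℂ :=
  fun i => ∑' j, X i j * v j

/-- The matrix of a bounded operator in the canonical bases. -/
def opMatrix {n m : ℕ} (L : SeqSpace m →L[ℂ] SeqSpace n) : BlockMatrix n m :=
  fun i j => L (lp.single 2 j (1 : ℂ)) i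

/-- The infinite matrix `X` is (the matrix of) a bounded operator on `ℓ²`. -/
def IsBoundedMatrix {n m : ℕ} (X : BlockMatrix n m) : Prop :=
  ∃ L : SeqSpace m →L[ℂ] SeqSpace n, opMatrix L = X

/-- The columns of `X` are bounded in `ℓ²`. All bounded operators on `ℓ²` have this property, and
so do the possibly unbounded `𝒯_T(P)` with `P` square integrable over a period. -/
def HasBoundedColumns {n m : ℕ} (X : BlockMatrix n m) : Prop :=
  ∃ C : ℝ, ∀ j, Summable (fun i => ‖X i j‖ ^ 2) ∧ ∑' i, ‖X i j‖ ^ 2 ≤ C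

/-- `X` is Hermitian positive definite: `X* = X` and `v* X v > 0` for each nonzero `v ∈ ℓ²` in the
domain `{v ∈ ℓ² : X v ∈ ℓ²}` of the operator defined by `X` (all of `ℓ²` if `X` is bounded). -/
def IsHermitianPosDef {n : ℕ} (X : BlockMatrix n n) : Prop :=
  X.IsHermitian ∧ ∀ v : SeqSpace n, v ≠ 0 → (∀ i, Summable fun j => X i j * v j) →
    Memℓp (mulSeq X v) 2 → 0 < (∑' i, star (v i) * mulSeq X v i).re

/-- `X` is a Hermitian positive definite solution of
`X(𝒜 - 𝒩) + (𝒜 - 𝒩)*X - X ℬ ℛ⁻¹ ℬ* X + 𝒬 = 0`, an identity between infinite matrices.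
The argument `Rinv` stands for `ℛ⁻¹`. -/
structure IsHarmonicSolution {n m : ℕ} (T : ℝ) (A : BlockMatrix n n) (B : BlockMatrix n m)
    (Rinv : BlockMatrix m m) (Q X : BlockMatrix n n) : Prop where
  columns : HasBoundedColumns X
  posDef : IsHermitianPosDef X
  equation : mmul X (A - harmonicN n T) + mmul (A - harmonicN n T).conjTranspose X
    - mmul X (mmul B (mmul Rinv (mmul B.conjTranspose X))) + Q = 0

/-- `X` is the only Hermitian positive definite solution of the harmonic Riccati equation. -/
def IsUniqueHarmonicSolution {n m : ℕ} (T : ℝ) (A : BlockMatrix n n) (B : BlockMatrix n m)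
    (Rinv : BlockMatrix m m) (Q X : BlockMatrix n n) : Prop :=
  IsHarmonicSolution T A B Rinv Q X ∧ ∀ Y, IsHarmonicSolution T A B Rinv Q Y → Y = X

end HarmonicRiccati

end

noncomputable section

set_option linter.unusedSectionVars false

namespace HarmonicRiccati

open MeasureTheory Set Filter Topology

/-! ### Primitives of locally integrable functions -/

section Primitive

/-! Passing to Fourier coefficients turns multiplication by a periodic matrix function into its
block Toeplitz matrix and differentiation into $\mathcal N$. Tested on the exponentials $e^{j\omega
k\tau}\varepsilon_a$, the harmonic equation is therefore the weak form of the differential equation,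
with $G=BR^{-1}B'$. A periodic solution $S$ yields a harmonic solution $\mathcal T_T(S)$ by
integration by parts (`IsRiccatiPrimitive.form`). Conversely, if $\mathcal T_T(P)$ is a harmonic
solution, its column $0$ says that the Fourier coefficients of $P$ are those of a primitive of an
$L^1$ function. So $P$ agrees almost everywhere with an absolutely continuous solution
(`exists_isRiccatiPrimitive`), which is positive semidefinite because its form is, and then definite
because its value strictly decreases along the closed loop.

The substance is uniqueness: any harmonic solution $Y$, possibly unbounded and not Toeplitz, must
equal $\mathcal T_T(S)$ as soon as a positive definite periodic solution $S$ exists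
(`IsHarmonicForm.eq_toeplitz`). The tool is a Lyapunov argument (`re_inner_act_nonpos_of_flow`). Let
$\Phi$ be the fundamental matrix of $x'=Fx$, with $\Phi(T)^j\to0$, and let
$u_\tau(t)=\Phi(t)f(t-\tau)$, where $f$ is twisted so that $u_\tau$ is periodic. Then $\partial_\tau
u_\tau=(F-d/dt)u_\tau$. If $\mathrm{Re}\langle Ku,(F-d/dt)u\rangle\ge0$, the form $\langle
u_\tau,Ku_\tau\rangle$ increases with $\tau$ and tends to $0$ along multiples of $T$, hence is
nonpositive at $\tau=0$. Such $u_0$ are dense (`exists_dense_nonpos`). An unbounded $K$ is harmless: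
on periodic functions with square integrable derivative the Fourier series is absolutely summable,
and bounded columns suffice to apply $K$.

Upper bound: with $F=A-GS$, which is stable since $S$ decreases along its flow, $K=Y-\mathcal
T_T(S)$ satisfies the inequality because the two Riccati equations differ by the nonnegative term
$(Y-S)G(Y-S)$. Hence $0\le Y\le S$ on a dense subspace, and $Y$ is represented by a bounded operator
$L$ (`IsHarmonicForm.exists_operator`).

Lower bound: the set of $\theta\in[0,1]$ with $\theta S\le L$ is closed and contains $0$, and each
of its points $\theta<1$ can be increased (`IsHarmonicForm.exists_gt`). For this the Lyapunov
argument is applied to $K=\zeta+\theta S-L$ and $F=A-\theta GS-c$. A large $c$ absorbs the quadratic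
term in $L-\theta S\ge0$, while the surplus $(1-\theta)Q$ leaves room for a positive periodic scalar
$\zeta$. At $\theta=1$ both bounds meet and $L=S$. Uniqueness is thus automatic on the harmonic
side, and on the time side it follows because a Toeplitz matrix determines its symbol almost
everywhere. -/

theorem locallyIntegrable_of_intervalIntegrable {E : Type*} [NormedAddCommGroup E] {f : ℝ → E}
    (h : ∀ s t, IntervalIntegrable f volume s t) : LocallyIntegrable f volume := fun x =>
  ⟨Ioc (x - 1) (x + 1), Ioc_mem_nhds (by linarith) (by linarith), (h (x - 1) (x + 1)).1⟩

variable {E F : Type*} [NormedAddCommGroup E] [NormedSpace ℝ E] [NormedAddCommGroup F]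
  [NormedSpace ℝ F]

/-- `u` is a primitive of the locally integrable function `du`. -/
structure IsPrimitive (u du : ℝ → E) : Prop where
  intervalIntegrable : ∀ s t, IntervalIntegrable du volume s t
  eq_add_integral : ∀ s t, u t = u s + ∫ τ in s..t, du τ

/-- Over every finite family of intervals the total increment of `f` is at most `C` times that of
`g`. Applied with `g` the primitive of a norm, and with `f` a Lipschitz function of `g`. -/
theorem absolutelyContinuousOnInterval_of_dist_le {X Y : Type*} [PseudoMetricSpace X]
    [PseudoMetricSpace Y] {f : ℝ → X} {g : ℝ → Y} {a b C : ℝ}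
    (hg : AbsolutelyContinuousOnInterval g a b)
    (h : ∀ s ∈ uIcc a b, ∀ t ∈ uIcc a b, dist (f s) (f t) ≤ C * dist (g s) (g t)) :
    AbsolutelyContinuousOnInterval f a b := by
  unfold AbsolutelyContinuousOnInterval at hg ⊢
  refine squeeze_zero' ?_ ?_ (by simpa using hg.const_mul C)
  · exact Eventually.of_forall fun _ => Finset.sum_nonneg fun i hi => dist_nonneg
  rw [eventually_inf_principal]
  filter_upwards with (n, I) hnI
  simp only [Finset.mul_sum]
  gcongr with i hi
  simp only [AbsolutelyContinuousOnInterval.disjWithin, mem_ofPred_eq] at hnI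
  exact h _ (hnI.left i hi).left _ (hnI.left i hi).right

namespace IsPrimitive

variable {u du v dv : ℝ → E}

theorem sub_eq (h : IsPrimitive u du) (s t : ℝ) : u t - u s = ∫ τ in s..t, du τ := by
  rw [h.eq_add_integral s t]; abel

theorem continuous (h : IsPrimitive u du) : Continuous u := by
  have : u = fun t => u 0 + ∫ τ in (0 : ℝ)..t, du τ := funext fun t => h.eq_add_integral 0 t
  rw [this]
  exact continuous_const.add (intervalIntegral.continuous_primitive h.intervalIntegrable 0)

theorem hasDerivAt_ae [CompleteSpace E] (h : IsPrimitive u du) :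
    ∀ᵐ t, HasDerivAt u (du t) t := by
  have : u = fun t => u 0 + ∫ τ in (0 : ℝ)..t, du τ := funext fun t => h.eq_add_integral 0 t
  filter_upwards [LocallyIntegrable.ae_hasDerivAt_integral
    (locallyIntegrable_of_intervalIntegrable h.intervalIntegrable)] with t ht
  rw [this]
  exact (ht 0).const_add _

theorem absolutelyContinuous (h : IsPrimitive u du) (a b : ℝ) :
    AbsolutelyContinuousOnInterval u a b := by
  have h1 : IntervalIntegrable (fun t => ‖du t‖) volume a b := (h.intervalIntegrable a b).norm
  refine absolutelyContinuousOnInterval_of_dist_le (C := 1)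
    (h1.absolutelyContinuousOnInterval_intervalIntegral left_mem_uIcc) fun s _ t _ => ?_
  rw [one_mul, dist_comm, dist_eq_norm, h.sub_eq s t, dist_comm, Real.dist_eq,
    intervalIntegral.integral_interval_sub_left (h.intervalIntegrable _ _).norm
      (h.intervalIntegrable _ _).norm]
  exact intervalIntegral.norm_integral_le_abs_integral_norm

/-- The difference with the indefinite integral of `du` is absolutely continuous with zero
derivative almost everywhere, hence constant. -/
theorem of_absolutelyContinuous [CompleteSpace E]
    (hu : ∀ s t, AbsolutelyContinuousOnInterval u s t)
    (hdu : ∀ s t, IntervalIntegrable du volume s t) (hd : ∀ᵐ t, HasDerivAt u (du t) t) :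
    IsPrimitive u du := by
  refine ⟨hdu, fun s t => ?_⟩
  have hv : IsPrimitive (fun t => ∫ τ in s..t, du τ) du :=
    ⟨hdu, fun a b => (intervalIntegral.integral_add_adjacent_intervals (hdu _ _) (hdu _ _)).symm⟩
  have hac : AbsolutelyContinuousOnInterval (u - fun t => ∫ τ in s..t, du τ) s t :=
    (hu s t).sub (hv.absolutelyContinuous s t)
  obtain ⟨C, hC⟩ := hac.const_of_ae_hasDerivAt_zero (by
    filter_upwards [hd, hv.hasDerivAt_ae] with x hx hx' _
    simpa using hx.sub hx')
  have h1 := hC s left_mem_uIcc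
  have h2 := hC t right_mem_uIcc
  simp only [Pi.sub_apply, intervalIntegral.integral_same, sub_zero] at h1 h2
  rw [h1, ← h2]; abel

/-- For real functions the integrability of the derivative is itself a consequence of absolute
continuity. -/
theorem of_absolutelyContinuous_real {u du : ℝ → ℝ}
    (hu : ∀ s t, AbsolutelyContinuousOnInterval u s t) (hd : ∀ᵐ t, HasDerivAt u (du t) t) :
    IsPrimitive u du := by
  refine of_absolutelyContinuous hu (fun s t => ?_) hd
  refine ((hu s t).intervalIntegrable_deriv).congr_ae (ae_restrict_of_ae ?_)
  filter_upwards [hd] with x hx using hx.deriv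

theorem congr_ae (h : IsPrimitive u du) (hd : ∀ᵐ t, du t = dv t) : IsPrimitive u dv := by
  refine ⟨fun s t => (h.intervalIntegrable s t).congr_ae (ae_restrict_of_ae hd), fun s t => ?_⟩
  rw [h.eq_add_integral s t]
  congr 1
  exact intervalIntegral.integral_congr_ae (hd.mono fun x hx _ => hx)

theorem const (c : E) : IsPrimitive (fun _ => c) (fun _ => (0 : E)) :=
  ⟨fun _ _ => intervalIntegrable_const, fun s t => by simp⟩

theorem add (hu : IsPrimitive u du) (hv : IsPrimitive v dv) :
    IsPrimitive (fun t => u t + v t) (fun t => du t + dv t) := by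
  refine ⟨fun s t => (hu.intervalIntegrable s t).add (hv.intervalIntegrable s t), fun s t => ?_⟩
  rw [hu.eq_add_integral s t, hv.eq_add_integral s t,
    intervalIntegral.integral_add (hu.intervalIntegrable s t) (hv.intervalIntegrable s t)]
  abel

theorem clm [CompleteSpace E] [CompleteSpace F] (L : E →L[ℝ] F) (hu : IsPrimitive u du) :
    IsPrimitive (fun t => L (u t)) (fun t => L (du t)) := by
  refine ⟨fun s t => ⟨L.integrable_comp (hu.intervalIntegrable s t).1,
    L.integrable_comp (hu.intervalIntegrable s t).2⟩, fun s t => ?_⟩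
  rw [hu.eq_add_integral s t, map_add, L.intervalIntegral_comp_comm (hu.intervalIntegrable s t)]

theorem sum {ι : Type*} (s : Finset ι) {u du : ι → ℝ → E} (h : ∀ i, IsPrimitive (u i) (du i)) :
    IsPrimitive (fun t => ∑ i ∈ s, u i t) (fun t => ∑ i ∈ s, du i t) := by
  classical
  induction s using Finset.induction_on with
  | empty => simpa using const (0 : E)
  | insert a s ha ih =>
    simp only [Finset.sum_insert ha]
    exact (h a).add ih

theorem neg (hu : IsPrimitive u du) : IsPrimitive (fun t => -u t) (fun t => -du t) := by
  refine ⟨fun s t => (hu.intervalIntegrable s t).neg, fun s t => ?_⟩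
  rw [hu.eq_add_integral s t, intervalIntegral.integral_neg]; abel

theorem sub (hu : IsPrimitive u du) (hv : IsPrimitive v dv) :
    IsPrimitive (fun t => u t - v t) (fun t => du t - dv t) := by
  simpa only [sub_eq_add_neg] using hu.add hv.neg

theorem mul {A : Type*} [NormedDivisionRing A] [NormedAlgebra ℝ A] [CompleteSpace A]
    {u du v dv : ℝ → A} (hu : IsPrimitive u du) (hv : IsPrimitive v dv) :
    IsPrimitive (fun t => u t * v t) (fun t => du t * v t + u t * dv t) := by
  refine of_absolutelyContinuous (fun s t => ?_) (fun s t => ?_) ?_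
  · exact (hu.absolutelyContinuous s t).smul (hv.absolutelyContinuous s t)
  · exact ((hu.intervalIntegrable s t).mul_continuousOn hv.continuous.continuousOn).add
      ((hv.intervalIntegrable s t).continuousOn_mul hu.continuous.continuousOn)
  · filter_upwards [hu.hasDerivAt_ae, hv.hasDerivAt_ae] with t h1 h2
    exact h1.mul h2

theorem rexp {u du : ℝ → ℝ} (hu : IsPrimitive u du) :
    IsPrimitive (fun t => Real.exp (u t)) (fun t => Real.exp (u t) * du t) := by
  refine of_absolutelyContinuous_real (fun s t => ?_) ?_
  -- On the bounded range of `u` the exponential is Lipschitz with constant `exp C`.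
  · obtain ⟨C, hC⟩ := (hu.absolutelyContinuous s t).exists_bound
    refine absolutelyContinuousOnInterval_of_dist_le (C := Real.exp C)
      (hu.absolutelyContinuous s t) fun x hx y hy => ?_
    rw [dist_eq_norm, dist_eq_norm]
    refine (convex_Iic C).norm_image_sub_le_of_norm_deriv_le (f := Real.exp)
      (fun z _ => Real.differentiableAt_exp) (fun z hz => ?_) ?_ ?_
    · simpa using hz
    · exact (le_abs_self _).trans (hC y hy)
    · exact (le_abs_self _).trans (hC x hx)
  · filter_upwards [hu.hasDerivAt_ae] with t ht using ht.exp

theorem of_hasDerivAt [CompleteSpace E] (h : ∀ t, HasDerivAt u (du t) t) (hc : Continuous du) :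
    IsPrimitive u du := by
  refine ⟨fun s t => hc.intervalIntegrable s t, fun s t => ?_⟩
  rw [intervalIntegral.integral_eq_sub_of_hasDerivAt (fun x _ => h x)
    (hc.intervalIntegrable s t)]
  abel

theorem eq_of_ae_eq_zero (hu : IsPrimitive u du) (h : ∀ᵐ t, du t = 0) (s t : ℝ) : u s = u t := by
  rw [(hu.congr_ae h).eq_add_integral t s]; simp

theorem comp_add_const (hu : IsPrimitive u du) (c : ℝ) :
    IsPrimitive (fun t => u (t + c)) (fun t => du (t + c)) := by
  refine ⟨fun s t => ?_, fun s t => ?_⟩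
  · have := (hu.intervalIntegrable (s + c) (t + c)).comp_add_right c
    simpa using this
  · rw [intervalIntegral.integral_comp_add_right]; exact hu.eq_add_integral _ _

theorem integral_of_intervalIntegrable (h : ∀ s t, IntervalIntegrable du volume s t) (c : E) :
    IsPrimitive (fun t => c + ∫ τ in (0 : ℝ)..t, du τ) du :=
  ⟨h, fun s t => by
    rw [add_assoc, intervalIntegral.integral_add_adjacent_intervals (h _ _) (h _ _)]⟩

end IsPrimitive

end Primitive

/-! ### Linear differential equations with integrable coefficients -/

section LinearODE

variable {E : Type*} [NormedAddCommGroup E] [NormedSpace ℝ E] [CompleteSpace E]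

/-- Up to sign the integrand is the derivative of $e^{2|\int_0^s l|}/2$. The resulting factor $1/2$
is the contraction constant in `exists_isPrimitive_linear`. -/
theorem abs_integral_mul_exp_le {l : ℝ → ℝ} (hl : ∀ s t, IntervalIntegrable l volume s t)
    (hl0 : ∀ t, 0 ≤ l t) (t : ℝ) :
    |∫ s in (0 : ℝ)..t, l s * Real.exp (2 * |∫ r in (0 : ℝ)..s, l r|)|
      ≤ Real.exp (2 * |∫ r in (0 : ℝ)..t, l r|) / 2 := by
  have ha : IsPrimitive (fun t => ∫ r in (0 : ℝ)..t, l r) l := by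
    simpa using IsPrimitive.integral_of_intervalIntegrable hl 0
  rcases le_total 0 t with ht | ht
  · have h2 := (((IsPrimitive.const (2 : ℝ)).mul ha).rexp).sub_eq 0 t
    have hpos : ∀ s ∈ uIcc 0 t, |∫ r in (0 : ℝ)..s, l r| = ∫ r in (0 : ℝ)..s, l r := by
      intro s hs
      rw [uIcc_of_le ht] at hs
      exact abs_of_nonneg (intervalIntegral.integral_nonneg hs.1 fun r _ => hl0 r)
    have h3 : ∫ s in (0 : ℝ)..t, l s * Real.exp (2 * |∫ r in (0 : ℝ)..s, l r|)
        = (Real.exp (2 * ∫ r in (0 : ℝ)..t, l r) - 1) / 2 := by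
      have : ∫ s in (0 : ℝ)..t, l s * Real.exp (2 * |∫ r in (0 : ℝ)..s, l r|)
          = ∫ s in (0 : ℝ)..t, (1 / 2 : ℝ) * (Real.exp (2 * ∫ r in (0 : ℝ)..s, l r)
            * (0 * (∫ r in (0 : ℝ)..s, l r) + 2 * l s)) := by
        refine intervalIntegral.integral_congr fun s hs => ?_
        rw [hpos s hs]; ring
      rw [this, intervalIntegral.integral_const_mul, ← h2]
      simp; ring
    rw [h3, hpos t right_mem_uIcc, abs_of_nonneg]
    · linarith
    · have : 0 ≤ ∫ r in (0 : ℝ)..t, l r := intervalIntegral.integral_nonneg ht fun r _ => hl0 r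
      have := Real.add_one_le_exp (2 * ∫ r in (0 : ℝ)..t, l r)
      linarith
  -- To the left of $0$ the integral of `l` is nonpositive, so its absolute value reverses the sign
  -- in the exponent.
  · have h2 := (((IsPrimitive.const (-2 : ℝ)).mul ha).rexp).sub_eq 0 t
    have hpos : ∀ s ∈ uIcc 0 t, |∫ r in (0 : ℝ)..s, l r| = -∫ r in (0 : ℝ)..s, l r := by
      intro s hs
      rw [uIcc_of_ge ht] at hs
      refine abs_of_nonpos ?_
      rw [intervalIntegral.integral_symm, neg_nonpos]
      exact intervalIntegral.integral_nonneg hs.2 fun r _ => hl0 r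
    have h3 : ∫ s in (0 : ℝ)..t, l s * Real.exp (2 * |∫ r in (0 : ℝ)..s, l r|)
        = (1 - Real.exp (-2 * ∫ r in (0 : ℝ)..t, l r)) / 2 := by
      have : ∫ s in (0 : ℝ)..t, l s * Real.exp (2 * |∫ r in (0 : ℝ)..s, l r|)
          = ∫ s in (0 : ℝ)..t, (-1 / 2 : ℝ) * (Real.exp (-2 * ∫ r in (0 : ℝ)..s, l r)
            * (0 * (∫ r in (0 : ℝ)..s, l r) + -2 * l s)) := by
        refine intervalIntegral.integral_congr fun s hs => ?_
        rw [hpos s hs, show 2 * -(∫ r in (0 : ℝ)..s, l r) = -2 * ∫ r in (0 : ℝ)..s, l r by ring]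
        ring
      rw [this, intervalIntegral.integral_const_mul, ← h2]
      simp; ring
    have h4 : 0 ≤ -2 * ∫ r in (0 : ℝ)..t, l r := by
      have := hpos t right_mem_uIcc
      have h5 := abs_nonneg (∫ r in (0 : ℝ)..t, l r)
      linarith
    rw [h3, hpos t right_mem_uIcc, abs_of_nonpos,
      show 2 * -(∫ r in (0 : ℝ)..t, l r) = -2 * ∫ r in (0 : ℝ)..t, l r by ring]
    · linarith
    · have := Real.add_one_le_exp (-2 * ∫ r in (0 : ℝ)..t, l r)
      linarith

theorem intervalIntegrable_clm_apply {L : ℝ → E →L[ℝ] E}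
    (hL : ∀ s t, IntervalIntegrable L volume s t) {x : ℝ → E} (hx : Continuous x) (s t : ℝ) :
    IntervalIntegrable (fun τ => L τ (x τ)) volume s t := by
  obtain ⟨C, hC⟩ := (isCompact_uIcc (a := s) (b := t)).exists_bound_of_continuousOn hx.continuousOn
  refine ((hL s t).norm.mul_const C).mono_fun ?_ ?_
  · exact (ContinuousLinearMap.apply ℝ E).flip.aestronglyMeasurable_comp₂
      (hL s t).aestronglyMeasurable_restrict_uIoc hx.aestronglyMeasurable
  · refine (ae_restrict_mem measurableSet_uIoc).mono fun τ hτ => ?_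
    beta_reduce
    rw [Real.norm_eq_abs]
    refine ((L τ).le_opNorm _).trans (le_trans ?_ (le_abs_self _))
    gcongr
    exact hC τ (uIoc_subset_uIcc hτ)

/-- Picard iteration on the whole line at once: with $x=e^{2k}y$ and $k(t)=|\int_0^t\|L\||$, the
integral equation becomes a contraction in the space of bounded continuous `y`. No gluing of local
solutions is needed. -/
theorem exists_isPrimitive_linear {L : ℝ → E →L[ℝ] E}
    (hL : ∀ s t, IntervalIntegrable L volume s t) (x₀ : E) :
    ∃ x : ℝ → E, x 0 = x₀ ∧ IsPrimitive x (fun t => L t (x t)) := by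
  set k : ℝ → ℝ := fun t => |∫ r in (0 : ℝ)..t, ‖L r‖| with hk
  have hkc : Continuous k :=
    (intervalIntegral.continuous_primitive (fun s t => (hL s t).norm) 0).abs
  have hbound : ∀ t, |∫ s in (0 : ℝ)..t, ‖L s‖ * Real.exp (2 * k s)| ≤ Real.exp (2 * k t) / 2 :=
    fun t => abs_integral_mul_exp_le (fun s t => (hL s t).norm) (fun t => norm_nonneg _) t
  have hxc : ∀ y : BoundedContinuousFunction ℝ E,
      Continuous fun s => Real.exp (2 * k s) • y s := fun y =>
    (Real.continuous_exp.comp (hkc.const_mul 2)).smul y.continuous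
  have hint : ∀ (y : BoundedContinuousFunction ℝ E) s t,
      IntervalIntegrable (fun s => L s (Real.exp (2 * k s) • y s)) volume s t := fun y s t =>
    intervalIntegrable_clm_apply hL (hxc y) s t
  -- One estimate serves twice: it keeps the image bounded and, applied to a difference, gives the
  -- Lipschitz constant $1/2$.
  have hest : ∀ (z : ℝ → E) (C : ℝ), (∀ s, ‖z s‖ ≤ C) → ∀ t,
      ‖Real.exp (-(2 * k t)) • ∫ s in (0 : ℝ)..t, L s (Real.exp (2 * k s) • z s)‖ ≤ C / 2 := by
    intro z C hC t
    have hC0 : 0 ≤ C := (norm_nonneg _).trans (hC 0)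
    have h1 : ‖∫ s in (0 : ℝ)..t, L s (Real.exp (2 * k s) • z s)‖
        ≤ |∫ s in (0 : ℝ)..t, C * (‖L s‖ * Real.exp (2 * k s))| := by
      refine intervalIntegral.norm_integral_le_abs_of_norm_le ?_ ?_
      · refine Eventually.of_forall fun s => ?_
        refine ((L s).le_opNorm _).trans ?_
        rw [norm_smul, Real.norm_eq_abs, Real.abs_exp]
        calc ‖L s‖ * (Real.exp (2 * k s) * ‖z s‖) ≤ ‖L s‖ * (Real.exp (2 * k s) * C) := by
              gcongr; exact hC s
          _ = _ := by ring
      · exact (((hL 0 t).norm).mul_continuousOn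
          (Real.continuous_exp.comp (hkc.const_mul 2)).continuousOn).const_mul C
    rw [intervalIntegral.integral_const_mul, abs_mul, abs_of_nonneg hC0] at h1
    rw [norm_smul, Real.norm_eq_abs, Real.abs_exp]
    calc _ ≤ Real.exp (-(2 * k t)) * (C * (Real.exp (2 * k t) / 2)) := by
          gcongr; exact h1.trans (by gcongr; exact hbound t)
      _ = (Real.exp (-(2 * k t)) * Real.exp (2 * k t)) * (C / 2) := by ring
      _ = C / 2 := by rw [← Real.exp_add]; simp
  let Kf : BoundedContinuousFunction ℝ E → ℝ → E := fun y t =>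
    Real.exp (-(2 * k t)) • (x₀ + ∫ s in (0 : ℝ)..t, L s (Real.exp (2 * k s) • y s))
  have hKc : ∀ y, Continuous (Kf y) := fun y =>
    (Real.continuous_exp.comp (hkc.const_mul 2).neg).smul
      (continuous_const.add (intervalIntegral.continuous_primitive (hint y) 0))
  have hKb : ∀ y t, ‖Kf y t‖ ≤ ‖x₀‖ + ‖y‖ / 2 := by
    intro y t
    simp only [Kf, smul_add]
    refine (norm_add_le _ _).trans (add_le_add ?_ (hest y ‖y‖ y.norm_coe_le_norm t))
    rw [norm_smul, Real.norm_eq_abs, Real.abs_exp]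
    refine mul_le_of_le_one_left (norm_nonneg _) (Real.exp_le_one_iff.mpr ?_)
    have : 0 ≤ k t := abs_nonneg _
    linarith
  let K : BoundedContinuousFunction ℝ E → BoundedContinuousFunction ℝ E := fun y =>
    BoundedContinuousFunction.ofNormedAddCommGroup (Kf y) (hKc y) _ (hKb y)
  have hK : ContractingWith (1 / 2) K := by
    refine ⟨by norm_num, LipschitzWith.of_dist_le_mul fun y z => ?_⟩
    rw [BoundedContinuousFunction.dist_le (by positivity)]
    intro t
    rw [dist_eq_norm]
    have : K y t - K z t = Real.exp (-(2 * k t)) •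
        ∫ s in (0 : ℝ)..t, L s (Real.exp (2 * k s) • (y s - z s)) := by
      change Kf y t - Kf z t = _
      simp only [Kf, ← smul_sub, add_sub_add_left_eq_sub]
      rw [← intervalIntegral.integral_sub (hint y 0 t) (hint z 0 t)]
      simp only [smul_sub, map_sub]
    rw [this]
    refine (hest (fun s => y s - z s) (dist y z) (fun s => ?_) t).trans (by
      push_cast; linarith)
    rw [← dist_eq_norm]; exact BoundedContinuousFunction.dist_coe_le_dist s
  obtain ⟨y, hy, -⟩ := hK.exists_fixedPoint (0 : BoundedContinuousFunction ℝ E) (edist_ne_top _ _)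
  have hy' : ∀ t, Real.exp (2 * k t) • y t
      = x₀ + ∫ s in (0 : ℝ)..t, L s (Real.exp (2 * k s) • y s) := by
    intro t
    have : y t = Kf y t := by
      conv_lhs => rw [← hy]
      rfl
    rw [this]
    simp only [Kf]
    rw [smul_smul, ← Real.exp_add]; simp
  refine ⟨fun t => Real.exp (2 * k t) • y t, by simpa using hy' 0, ?_⟩
  have := IsPrimitive.integral_of_intervalIntegrable (hint y) x₀
  simp only [← hy'] at this
  exact this

end LinearODE

/-! ### Matrix-valued primitives and fundamental matrices -/

section MatrixPrimitive

variable {k l m n : ℕ} {𝕜 : Type*} [NormedField 𝕜] [NormedAlgebra ℝ 𝕜] [CompleteSpace 𝕜]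

/-- `X` is entrywise a primitive of `dX`. -/
def IsMatrixPrimitive (X dX : ℝ → Matrix (Fin n) (Fin m) 𝕜) : Prop :=
  ∀ a b, IsPrimitive (fun t => X t a b) (fun t => dX t a b)

theorem IsMatrixPrimitive.mul {X dX : ℝ → Matrix (Fin n) (Fin m) 𝕜}
    {Y dY : ℝ → Matrix (Fin m) (Fin l) 𝕜} (hX : IsMatrixPrimitive X dX)
    (hY : IsMatrixPrimitive Y dY) :
    IsMatrixPrimitive (fun t => X t * Y t) (fun t => dX t * Y t + X t * dY t) := by
  intro a b
  simp only [Matrix.mul_apply, Matrix.add_apply, ← Finset.sum_add_distrib]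
  exact IsPrimitive.sum _ fun c => (hX a c).mul (hY c b)

theorem IsMatrixPrimitive.transpose {X dX : ℝ → Matrix (Fin n) (Fin m) 𝕜}
    (hX : IsMatrixPrimitive X dX) :
    IsMatrixPrimitive (fun t => (X t).transpose) (fun t => (dX t).transpose) := fun a b => hX b a

theorem IsMatrixPrimitive.congr_ae {X dX dX' : ℝ → Matrix (Fin n) (Fin m) 𝕜}
    (hX : IsMatrixPrimitive X dX) (h : ∀ᵐ t, dX t = dX' t) : IsMatrixPrimitive X dX' :=
  fun a b => (hX a b).congr_ae (h.mono fun t ht => by rw [ht])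

theorem IsMatrixPrimitive.continuous {X dX : ℝ → Matrix (Fin n) (Fin m) 𝕜}
    (hX : IsMatrixPrimitive X dX) : Continuous X :=
  continuous_matrix fun a b => (hX a b).continuous

theorem IsMatrixPrimitive.eq_of_ae_eq_zero {X dX : ℝ → Matrix (Fin n) (Fin m) 𝕜}
    (hX : IsMatrixPrimitive X dX) (h : ∀ᵐ t, dX t = 0) (s t : ℝ) : X s = X t := by
  ext a b
  exact (hX a b).eq_of_ae_eq_zero (h.mono fun t ht => by simp [ht]) s t

theorem IsMatrixPrimitive.comp_add_const {X dX : ℝ → Matrix (Fin n) (Fin m) 𝕜}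
    (hX : IsMatrixPrimitive X dX) (c : ℝ) :
    IsMatrixPrimitive (fun t => X (t + c)) (fun t => dX (t + c)) :=
  fun a b => (hX a b).comp_add_const c

/-- The entries of `F` are integrable on bounded intervals. -/
def EntrywiseIntegrable (F : ℝ → Matrix (Fin n) (Fin m) ℝ) : Prop :=
  ∀ a b s t, IntervalIntegrable (fun τ => F τ a b) volume s t

/-- Expanding a matrix coefficient along elementary operators reduces the integrability of the
operator-valued function to that of its entries. -/
theorem EntrywiseIntegrable.sum_smul {V : Type*} [NormedAddCommGroup V] [NormedSpace ℝ V]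
    {F : ℝ → Matrix (Fin n) (Fin m) ℝ} (hF : EntrywiseIntegrable F) (e : Fin n → Fin m → V)
    (s t : ℝ) : IntervalIntegrable (fun τ => ∑ a, ∑ b, F τ a b • e a b) volume s t :=
  ⟨integrable_finsetSum _ fun a _ => integrable_finsetSum _ fun b _ =>
    Integrable.smul_const (hF a b s t).1 (e a b),
  integrable_finsetSum _ fun a _ => integrable_finsetSum _ fun b _ =>
    Integrable.smul_const (hF a b s t).2 (e a b)⟩

theorem exists_linear_solution {F : ℝ → Matrix (Fin n) (Fin n) ℝ} (hF : EntrywiseIntegrable F) :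
    ∃ Φ : ℝ → Matrix (Fin n) (Fin n) ℝ, Φ 0 = 1 ∧ IsMatrixPrimitive Φ fun t => F t * Φ t := by
  obtain ⟨e, he⟩ : ∃ e : Fin n → Fin n → (Fin n → ℝ) →L[ℝ] (Fin n → ℝ),
      ∀ a b x, e a b x = x b • (Pi.single a 1 : Fin n → ℝ) :=
    ⟨fun a b => (ContinuousLinearMap.proj (R := ℝ) (φ := fun _ : Fin n => ℝ) b).smulRight
      (Pi.single a 1 : Fin n → ℝ), fun a b x => rfl⟩
  let L : ℝ → (Fin n → ℝ) →L[ℝ] (Fin n → ℝ) := fun t => ∑ a, ∑ b, F t a b • e a b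
  have hLa : ∀ t x, L t x = (F t).mulVec x := by
    intro t x
    ext a
    simp [L, he, Finset.sum_apply, Pi.single_apply, Matrix.mulVec, dotProduct]
  have hL : ∀ s t, IntervalIntegrable L volume s t := hF.sum_smul e
  choose x hx0 hx using fun j : Fin n => exists_isPrimitive_linear hL (Pi.single j 1)
  refine ⟨fun t => Matrix.of fun a b => x b t a, ?_, fun a b => ?_⟩
  · ext a b
    simp only [Matrix.of_apply, hx0, Matrix.one_apply, Pi.single_apply]
  · have := (hx b).clm (ContinuousLinearMap.proj (R := ℝ) (φ := fun _ : Fin n => ℝ) a)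
    simpa only [hLa, ContinuousLinearMap.proj_apply, Matrix.mulVec, dotProduct, Matrix.of_apply,
      Matrix.mul_apply] using this

/-- A fundamental matrix `Φ` of `x' = F x` together with its inverse `Ψ`. -/
structure IsFundamental (F Φ Ψ : ℝ → Matrix (Fin n) (Fin n) ℝ) : Prop where
  zero : Φ 0 = 1
  prim : IsMatrixPrimitive Φ fun t => F t * Φ t
  prim_inv : IsMatrixPrimitive Ψ fun t => -(Ψ t * F t)
  inv_mul : ∀ t, Ψ t * Φ t = 1
  mul_inv : ∀ t, Φ t * Ψ t = 1

/-- The inverse is built as the transpose of a solution of the adjoint system $X'=-F^{\mathsf T}X$: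
the product with `Φ` has zero derivative and equals the identity at $0$. -/
theorem exists_isFundamental {F : ℝ → Matrix (Fin n) (Fin n) ℝ} (hF : EntrywiseIntegrable F) :
    ∃ Φ Ψ, IsFundamental F Φ Ψ := by
  obtain ⟨Φ, h0, hΦ⟩ := exists_linear_solution hF
  obtain ⟨X, hX0, hX⟩ := exists_linear_solution (F := fun t => -(F t).transpose)
    (fun a b s t => (hF b a s t).neg)
  have hΨ : IsMatrixPrimitive (fun t => (X t).transpose) fun t => -((X t).transpose * F t) := by
    refine hX.transpose.congr_ae (Eventually.of_forall fun t => ?_)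
    simp [Matrix.transpose_mul]
  have h1 : ∀ t, (X t).transpose * Φ t = 1 := by
    intro t
    rw [(hΨ.mul hΦ).eq_of_ae_eq_zero (Eventually.of_forall fun t => by
      simp [Matrix.mul_assoc]) t 0]
    simp [h0, hX0]
  exact ⟨Φ, _, h0, hΦ, hΨ, h1, fun t => mul_eq_one_comm.mp (h1 t)⟩

namespace IsFundamental

variable {F Φ Ψ : ℝ → Matrix (Fin n) (Fin n) ℝ}

/-- Since `F` is periodic, $\Psi(t)\Phi(t+T)$ has zero derivative, so it keeps its value at $0$, the
monodromy matrix. -/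
theorem add_period (h : IsFundamental F Φ Ψ) {T : ℝ} (hF : Function.Periodic F T) (t : ℝ) :
    Φ (t + T) = Φ t * Φ T := by
  have h1 : Ψ t * Φ (t + T) = Φ T := by
    have := (h.prim_inv.mul (h.prim.comp_add_const T)).eq_of_ae_eq_zero
      (Eventually.of_forall fun t => by simp [Matrix.mul_assoc, hF t]) t 0
    rw [this, zero_add]
    have h2 := h.inv_mul 0
    rw [h.zero, mul_one] at h2
    rw [h2, one_mul]
  rw [← h1, ← mul_assoc, h.mul_inv, one_mul]

/-- Subtracting a scalar damps the flow exponentially, which later makes the monodromy matrix as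
small as desired. -/
theorem sub_smul_one (h : IsFundamental F Φ Ψ) (c : ℝ) :
    IsFundamental (fun t => F t - c • (1 : Matrix (Fin n) (Fin n) ℝ))
      (fun t => Real.exp (-(c * t)) • Φ t) (fun t => Real.exp (c * t) • Ψ t) := by
  have he : ∀ c : ℝ, IsPrimitive (fun t => Real.exp (c * t)) (fun t => Real.exp (c * t) * c) := by
    intro c
    refine IsPrimitive.of_hasDerivAt (fun t => ?_) (by fun_prop)
    simpa using ((hasDerivAt_id t).const_mul c).exp
  refine ⟨by simp [h.zero], fun a b => ?_, fun a b => ?_, fun t => ?_, fun t => ?_⟩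
  · have := (he (-c)).mul (h.prim a b)
    simp only [neg_mul] at this
    refine this.congr_ae (Eventually.of_forall fun t => ?_)
    simp only [Matrix.sub_mul, Matrix.smul_mul, Matrix.mul_smul, one_mul, Matrix.sub_apply,
      Matrix.smul_apply, smul_eq_mul]
    ring
  · have := (he c).mul (h.prim_inv a b)
    refine this.congr_ae (Eventually.of_forall fun t => ?_)
    simp only [Matrix.mul_sub, Matrix.smul_mul, Matrix.mul_smul, mul_one, Matrix.sub_apply,
      Matrix.smul_apply, smul_eq_mul, Matrix.neg_apply]
    ring
  · rw [Matrix.smul_mul, Matrix.mul_smul, h.inv_mul, smul_smul, ← Real.exp_add]; simp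
  · rw [Matrix.smul_mul, Matrix.mul_smul, h.mul_inv, smul_smul, ← Real.exp_add]; simp

end IsFundamental

end MatrixPrimitive

end HarmonicRiccati

end

noncomputable section

set_option linter.unusedSectionVars false

namespace HarmonicRiccati

open MeasureTheory Set Filter Topology

open scoped ComplexConjugate InnerProductSpace

/-! ### Fourier coefficients over a period -/

section Coef

variable {T : ℝ}

/-- The `k`-th Fourier coefficient of `u` over `(0, T]`. -/
def coef (T : ℝ) (u : ℝ → ℂ) (k : ℤ) : ℂ :=
  (1 / (T : ℂ)) * ∫ τ in (0 : ℝ)..T,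
    u τ * Complex.exp (-(Complex.I * ((2 * Real.pi / T : ℝ) : ℂ) * (k : ℂ) * (τ : ℂ)))

/-- The character `e^{jωkτ}`. -/
def char (T : ℝ) (k : ℤ) (τ : ℝ) : ℂ :=
  Complex.exp (Complex.I * ((2 * Real.pi / T : ℝ) : ℂ) * (k : ℂ) * (τ : ℂ))

theorem char_eq_fourier (k : ℤ) (τ : ℝ) : char T k τ = fourier k (τ : AddCircle T) := by
  rw [fourier_coe_apply, char]
  congr 1
  push_cast
  ring

theorem conj_char (k : ℤ) (τ : ℝ) : conj (char T k τ) = char T (-k) τ := by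
  rw [char_eq_fourier, char_eq_fourier, fourier_neg]

theorem char_add (k l : ℤ) (τ : ℝ) : char T (k + l) τ = char T k τ * char T l τ := by
  rw [char_eq_fourier, char_eq_fourier, char_eq_fourier, fourier_add]

theorem norm_char (k : ℤ) (τ : ℝ) : ‖char T k τ‖ = 1 := by
  rw [char_eq_fourier, fourier_apply, Circle.norm_coe]

theorem continuous_char (k : ℤ) : Continuous (char T k) := by unfold char; fun_prop

theorem char_periodic (k : ℤ) : Function.Periodic (char T k) T := by
  intro τ
  rw [char_eq_fourier, char_eq_fourier]
  simp

theorem hasDerivAt_char (k : ℤ) (τ : ℝ) :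
    HasDerivAt (char T k)
      (Complex.I * ((2 * Real.pi / T : ℝ) : ℂ) * (k : ℂ) * char T k τ) τ := by
  have h1 : HasDerivAt (fun τ : ℝ => (τ : ℂ)) 1 τ := Complex.ofRealCLM.hasDerivAt
  have := (h1.const_mul (Complex.I * ((2 * Real.pi / T : ℝ) : ℂ) * (k : ℂ))).cexp
  rw [mul_one] at this
  exact this.congr_deriv (mul_comm _ _)

theorem coef_eq (u : ℝ → ℂ) (k : ℤ) :
    coef T u k = (1 / (T : ℂ)) * ∫ τ in (0 : ℝ)..T, u τ * char T (-k) τ := by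
  rw [coef]
  congr 2
  ext τ
  rw [char]
  congr 2
  push_cast; ring

theorem coef_eq_fourierCoeff [hT : Fact (0 < T)] (u : ℝ → ℂ) (k : ℤ) :
    coef T u k = fourierCoeff (AddCircle.liftIoc T 0 u) k := by
  rw [fourierCoeff_eq_intervalIntegral _ _ 0, coef_eq]
  simp only [zero_add, Complex.real_smul]
  push_cast
  congr 1
  rw [intervalIntegral.integral_of_le hT.out.le, intervalIntegral.integral_of_le hT.out.le]
  refine setIntegral_congr_fun measurableSet_Ioc fun τ hτ => ?_
  rw [char_eq_fourier, smul_eq_mul, mul_comm, AddCircle.liftIoc_zero_coe_apply hτ]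

/-- Square integrability over `(0, T]`. -/
abbrev SqInt (T : ℝ) (u : ℝ → ℂ) : Prop := MemLp u 2 (volume.restrict (Ioc 0 T))

/-- The element of `L²` of the circle defined by `u`. -/
def circ [hT : Fact (0 < T)] {u : ℝ → ℂ} (hu : SqInt T u) :
    Lp ℂ 2 (AddCircle.haarAddCircle (T := T)) :=
  (MemLp.memLp_liftIoc (t := 0) (by simpa using hu)).haarAddCircle.toLp (AddCircle.liftIoc T 0 u)

theorem repr_circ [hT : Fact (0 < T)] {u : ℝ → ℂ} (hu : SqInt T u) (k : ℤ) :
    fourierBasis.repr (circ hu) k = coef T u k := by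
  rw [fourierBasis_repr, coef_eq_fourierCoeff]
  exact congrFun (fourierCoeff_congr_ae (MemLp.coeFn_toLp _)) k

theorem inner_circ [hT : Fact (0 < T)] {u v : ℝ → ℂ} (hu : SqInt T u) (hv : SqInt T v) :
    ⟪circ hu, circ hv⟫_ℂ = (1 / (T : ℂ)) * ∫ τ in (0 : ℝ)..T, conj (u τ) * v τ := by
  rw [L2.inner_def]
  have h1 : ∫ a, ⟪circ hu a, circ hv a⟫_ℂ ∂(AddCircle.haarAddCircle (T := T))
      = ∫ a, AddCircle.liftIoc T 0 (fun τ => conj (u τ) * v τ) a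
        ∂(AddCircle.haarAddCircle (T := T)) := by
    refine integral_congr_ae ?_
    filter_upwards [MemLp.coeFn_toLp
      (MemLp.memLp_liftIoc (T := T) (t := 0) (by simpa using hu)).haarAddCircle,
      MemLp.coeFn_toLp
      (MemLp.memLp_liftIoc (T := T) (t := 0) (by simpa using hv)).haarAddCircle] with a ha hb
    rw [circ, circ, ha, hb, RCLike.inner_apply']
    rfl
  rw [h1, AddCircle.integral_haarAddCircle, AddCircle.integral_liftIoc_eq_intervalIntegral]
  simp

/-- Parseval's identity in polarized form, the source of all passages between sums of coefficients
and integrals. -/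
theorem hasSum_coef_mul (hT : 0 < T) {u v : ℝ → ℂ} (hu : SqInt T u) (hv : SqInt T v) :
    HasSum (fun k => conj (coef T u k) * coef T v k)
      ((1 / (T : ℂ)) * ∫ τ in (0 : ℝ)..T, conj (u τ) * v τ) := by
  have : Fact (0 < T) := ⟨hT⟩
  rw [← inner_circ hu hv, ← fourierBasis.repr.inner_map_map (circ hu) (circ hv)]
  have := lp.hasSum_inner (𝕜 := ℂ) (fourierBasis.repr (circ hu)) (fourierBasis.repr (circ hv))
  simpa only [RCLike.inner_apply', repr_circ] using this

theorem summable_norm_coef_sq (hT : 0 < T) {u : ℝ → ℂ} (hu : SqInt T u) :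
    Summable fun k => ‖coef T u k‖ ^ 2 := by
  have := (hasSum_coef_mul hT hu hu).summable.norm
  refine this.congr fun k => ?_
  rw [norm_mul, RCLike.norm_conj, sq]

/-- The Riesz–Fischer theorem: a preimage in $L^2$ of the circle is pulled back to the line. -/
theorem exists_coef_eq (hT : 0 < T) (f : lp (fun _ : ℤ => ℂ) 2) :
    ∃ u : ℝ → ℂ, SqInt T u ∧ ∀ k, coef T u k = f k := by
  have : Fact (0 < T) := ⟨hT⟩
  set U := (fourierBasis (T := T)).repr.symm f with hU
  have hU2 : MemLp (U : AddCircle T → ℂ) 2 volume := (Lp.memLp U).of_haarAddCircle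
  have hm := AddCircle.measurePreserving_mk T 0
  rw [zero_add] at hm
  refine ⟨fun τ => U (τ : AddCircle T), hU2.comp_measurePreserving hm, fun k => ?_⟩
  have h1 : fourierBasis.repr U k = f k := by rw [hU]; simp
  rw [← h1, fourierBasis_repr, fourierCoeff_eq_intervalIntegral _ _ 0, coef_eq]
  simp only [zero_add, Complex.real_smul]
  push_cast
  congr 2
  ext τ
  rw [char_eq_fourier, smul_eq_mul, mul_comm]

/-- By Parseval the integral of $|u|^2$ vanishes. -/
theorem ae_eq_zero_of_coef (hT : 0 < T) {u : ℝ → ℂ} (hu : SqInt T u) (h : ∀ k, coef T u k = 0) :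
    u =ᵐ[volume.restrict (Ioc 0 T)] 0 := by
  have h1 := (hasSum_coef_mul hT hu hu).unique (by simp only [h, mul_zero]; exact hasSum_zero)
  have h2 : ∫ τ in Ioc 0 T, ‖u τ‖ ^ 2 = 0 := by
    rw [intervalIntegral.integral_of_le hT.le] at h1
    have h3 : ∫ τ in Ioc 0 T, conj (u τ) * u τ = ((∫ τ in Ioc 0 T, ‖u τ‖ ^ 2 : ℝ) : ℂ) := by
      rw [← integral_complex_ofReal]
      congr 1
      ext τ
      rw [RCLike.conj_mul]; push_cast; rfl
    rw [h3] at h1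
    have hT' : (1 / (T : ℂ)) ≠ 0 := by
      simpa using hT.ne'
    exact Complex.ofReal_eq_zero.mp ((mul_eq_zero.mp h1).resolve_left hT')
  rw [integral_eq_zero_iff_of_nonneg (fun τ => by positivity)
    ((memLp_two_iff_integrable_sq_norm hu.1).mp hu)] at h2
  filter_upwards [h2] with τ hτ
  simpa using hτ

theorem coef_congr_ae (hT : 0 < T) {u v : ℝ → ℂ} (h : u =ᵐ[volume.restrict (Ioc 0 T)] v) (k : ℤ) :
    coef T u k = coef T v k := by
  rw [coef_eq, coef_eq]
  congr 1
  refine intervalIntegral.integral_congr_ae_restrict ?_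
  rw [uIoc_of_le hT.le]
  filter_upwards [h] with τ hτ
  rw [hτ]

theorem intervalIntegrable_mul_char (hT : 0 < T) {u : ℝ → ℂ}
    (hu : IntegrableOn u (Ioc 0 T)) (k : ℤ) :
    IntervalIntegrable (fun τ => u τ * char T k τ) volume 0 T :=
  ((intervalIntegrable_iff_integrableOn_Ioc_of_le hT.le).mpr hu).mul_continuousOn
    (continuous_char k).continuousOn

theorem coef_add (hT : 0 < T) {u v : ℝ → ℂ} (hu : IntegrableOn u (Ioc 0 T))
    (hv : IntegrableOn v (Ioc 0 T)) (k : ℤ) :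
    coef T (fun τ => u τ + v τ) k = coef T u k + coef T v k := by
  simp only [coef_eq, add_mul]
  rw [intervalIntegral.integral_add (intervalIntegrable_mul_char hT hu _)
    (intervalIntegrable_mul_char hT hv _), mul_add]

theorem coef_const_mul (c : ℂ) (u : ℝ → ℂ) (k : ℤ) :
    coef T (fun τ => c * u τ) k = c * coef T u k := by
  simp only [coef_eq, mul_assoc]
  rw [intervalIntegral.integral_const_mul]
  ring

theorem coef_sum (hT : 0 < T) {ι : Type*} (s : Finset ι) {u : ι → ℝ → ℂ}
    (hu : ∀ i ∈ s, IntegrableOn (u i) (Ioc 0 T)) (k : ℤ) :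
    coef T (fun τ => ∑ i ∈ s, u i τ) k = ∑ i ∈ s, coef T (u i) k := by
  simp only [coef_eq, Finset.sum_mul]
  rw [intervalIntegral.integral_finsetSum fun i hi => intervalIntegrable_mul_char hT (hu i hi) _,
    Finset.mul_sum]

theorem coef_mul_char (u : ℝ → ℂ) (k l : ℤ) :
    coef T (fun τ => u τ * char T l τ) k = coef T u (k - l) := by
  simp only [coef_eq, mul_assoc, ← char_add]
  rw [show l + -k = -(k - l) by ring]

theorem coef_char (hT : 0 < T) (k l : ℤ) : coef T (char T l) k = if k = l then 1 else 0 := by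
  have : Fact (0 < T) := ⟨hT⟩
  have h := congrFun (fourierCoeff_fourier (T := T) l) k
  rw [fourierCoeff_eq_intervalIntegral _ _ 0] at h
  rw [coef_eq]
  simp only [zero_add, Complex.real_smul] at h
  push_cast at h
  rw [Pi.single_apply] at h
  rw [← h]
  congr 2
  ext τ
  rw [char_eq_fourier, char_eq_fourier, smul_eq_mul, mul_comm]

/-- Integration by parts, whose boundary terms cancel by periodicity. This is the statement that
$\mathcal N$ represents differentiation; only integrability of `du` is involved. -/
theorem coef_deriv {u du : ℝ → ℂ} (hu : IsPrimitive u du) (h0 : u T = u 0) (k : ℤ) :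
    coef T du k = Complex.I * ((2 * Real.pi / T : ℝ) : ℂ) * (k : ℂ) * coef T u k := by
  have hc : IsPrimitive (char T (-k)) (fun τ => Complex.I * ((2 * Real.pi / T : ℝ) : ℂ)
      * ((-k : ℤ) : ℂ) * char T (-k) τ) :=
    IsPrimitive.of_hasDerivAt (hasDerivAt_char (-k)) (continuous_const.mul (continuous_char _))
  have h1 := (hu.mul hc).sub_eq 0 T
  have hcT : char T (-k) T = char T (-k) 0 := by
    have := char_periodic (T := T) (-k) 0
    rwa [zero_add] at this
  rw [hcT, h0, sub_self, intervalIntegral.integral_add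
    ((hu.intervalIntegrable 0 T).mul_continuousOn (continuous_char _).continuousOn)
    ((hc.intervalIntegrable 0 T).continuousOn_mul hu.continuous.continuousOn)] at h1
  rw [coef_eq, coef_eq]
  have h2 : ∫ τ in (0 : ℝ)..T, u τ * (Complex.I * ((2 * Real.pi / T : ℝ) : ℂ)
      * ((-k : ℤ) : ℂ) * char T (-k) τ) = -(Complex.I * ((2 * Real.pi / T : ℝ) : ℂ) * (k : ℂ)) *
        ∫ τ in (0 : ℝ)..T, u τ * char T (-k) τ := by
    rw [← intervalIntegral.integral_const_mul]
    congr 1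
    ext τ
    push_cast; ring
  rw [h2] at h1
  linear_combination (-(1 / (T : ℂ))) * h1

theorem phasor_eq_coef {x : ℝ → ℝ} (hx : Function.Periodic x T) (t : ℝ) (k : ℤ) :
    phasor T x t k = coef T (fun τ => (x τ : ℂ)) k := by
  rw [phasor, coef]
  congr 1
  have hp : Function.Periodic (fun τ : ℝ => (x τ : ℂ) *
      Complex.exp (-(Complex.I * ((2 * Real.pi / T : ℝ) : ℂ) * (k : ℂ) * (τ : ℂ)))) T := by
    intro τ
    have h1 : ∀ s : ℝ, Complex.exp (-(Complex.I * ((2 * Real.pi / T : ℝ) : ℂ) * (k : ℂ) * (s : ℂ)))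
        = char T (-k) s := by
      intro s
      rw [char]; congr 1; push_cast; ring
    simp only [h1, hx τ]
    rw [char_periodic (-k) τ]
  have := hp.intervalIntegral_add_eq (t - T) 0
  simpa using this

end Coef

end HarmonicRiccati

end

noncomputable section

set_option linter.unusedSectionVars false

namespace HarmonicRiccati

open MeasureTheory Set Filter Topology

open scoped ComplexConjugate InnerProductSpace

/-! ### Square integrable vector functions as sequences -/

section ToSeq

variable {T : ℝ} {n m : ℕ}

/-- All components of `u` are square integrable over `(0, T]`. -/
def VecSqInt (T : ℝ) (u : ℝ → Fin n → ℂ) : Prop := ∀ a, SqInt T fun τ => u τ a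

open Classical in
/-- A square summable family as an element of `ℓ²`. -/
def seqOf (f : ℤ × Fin n → ℂ) : SeqSpace n := if h : Memℓp f 2 then ⟨f, h⟩ else 0

theorem seqOf_apply {f : ℤ × Fin n → ℂ} (hf : Memℓp f 2) (i : ℤ × Fin n) : seqOf f i = f i := by
  rw [seqOf, dif_pos hf]

/-- The sequence of Fourier coefficients of a vector function. -/
def toSeq (T : ℝ) (u : ℝ → Fin n → ℂ) : SeqSpace n :=
  seqOf fun i : ℤ × Fin n => coef T (fun τ => u τ i.2) i.1

theorem memℓp_two_iff {n : ℕ} {f : ℤ × Fin n → ℂ} : Memℓp f 2 ↔ Summable fun i => ‖f i‖ ^ 2 := by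
  rw [memℓp_gen_iff (by norm_num)]
  norm_num

theorem summable_prod_fin {f : ℤ × Fin n → ℝ} (h0 : ∀ i, 0 ≤ f i)
    (h : ∀ a, Summable fun k => f (k, a)) : Summable f := by
  rw [← (Equiv.prodComm (Fin n) ℤ).summable_iff]
  refine (summable_prod_of_nonneg fun i => h0 _).mpr ⟨fun a => h a, Summable.of_finite⟩

theorem memℓp_coef (hT : 0 < T) {u : ℝ → Fin n → ℂ} (hu : VecSqInt T u) :
    Memℓp (fun i : ℤ × Fin n => coef T (fun τ => u τ i.2) i.1) 2 := by
  rw [memℓp_two_iff]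
  refine summable_prod_fin (f := fun i => ‖coef T (fun τ => u τ i.2) i.1‖ ^ 2)
    (fun i => sq_nonneg _) fun a => ?_
  exact summable_norm_coef_sq (u := fun τ => u τ a) hT (hu a)

theorem toSeq_apply (hT : 0 < T) {u : ℝ → Fin n → ℂ} (hu : VecSqInt T u) (i : ℤ × Fin n) :
    toSeq T u i = coef T (fun τ => u τ i.2) i.1 := by
  rw [toSeq, seqOf_apply (memℓp_coef hT hu)]

theorem integrable_conj_mul {u v : ℝ → ℂ} (hu : SqInt T u) (hv : SqInt T v) :
    IntegrableOn (fun τ => conj (u τ) * v τ) (Ioc 0 T) := by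
  have : SqInt T fun τ => conj (u τ) :=
    (memLp_congr_norm hu.1 (Complex.continuous_conj.comp_aestronglyMeasurable hu.1)
      (by simp)).mp hu
  exact MemLp.integrable_mul (p := 2) (q := 2) this hv

/-- Parseval in each of the finitely many components, summed after regrouping the index set by
component. -/
theorem inner_toSeq (hT : 0 < T) {u v : ℝ → Fin n → ℂ} (hu : VecSqInt T u) (hv : VecSqInt T v) :
    ⟪toSeq T u, toSeq T v⟫_ℂ = (1 / (T : ℂ)) * ∫ τ in (0 : ℝ)..T, star (u τ) ⬝ᵥ v τ := by
  have h1 := lp.hasSum_inner (𝕜 := ℂ) (toSeq T u) (toSeq T v)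
  simp only [RCLike.inner_apply', toSeq_apply hT hu, toSeq_apply hT hv] at h1
  have h2 : HasSum (fun i : Fin n × ℤ => conj (coef T (fun τ => u τ i.1) i.2) *
      coef T (fun τ => v τ i.1) i.2) ⟪toSeq T u, toSeq T v⟫_ℂ :=
    (Equiv.prodComm (Fin n) ℤ).hasSum_iff (f := fun i : ℤ × Fin n =>
      conj (coef T (fun τ => u τ i.2) i.1) * coef T (fun τ => v τ i.2) i.1) |>.mpr h1
  have h3 := h2.prod_fiberwise fun a =>
    hasSum_coef_mul (u := fun τ => u τ a) (v := fun τ => v τ a) hT (hu a) (hv a)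
  rw [h3.unique (hasSum_fintype _), ← Finset.mul_sum, ← intervalIntegral.integral_finsetSum]
  · rfl
  · intro a _
    exact (intervalIntegrable_iff_integrableOn_Ioc_of_le hT.le).mpr
      (integrable_conj_mul (hu a) (hv a))

theorem toSeq_congr_ae (hT : 0 < T) {u v : ℝ → Fin n → ℂ}
    (h : u =ᵐ[volume.restrict (Ioc 0 T)] v) : toSeq T u = toSeq T v := by
  unfold toSeq
  congr 1
  ext i
  exact coef_congr_ae hT (h.mono fun τ hτ => by rw [hτ]) _

theorem VecSqInt.integrableOn {u : ℝ → Fin n → ℂ} (hu : VecSqInt T u) (a : Fin n) :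
    IntegrableOn (fun τ => u τ a) (Ioc 0 T) :=
  (hu a).integrable (by norm_num)

theorem VecSqInt.add {u v : ℝ → Fin n → ℂ} (hu : VecSqInt T u) (hv : VecSqInt T v) :
    VecSqInt T fun τ => u τ + v τ := fun a => (hu a).add (hv a)

theorem VecSqInt.smul {u : ℝ → Fin n → ℂ} (c : ℂ) (hu : VecSqInt T u) :
    VecSqInt T fun τ => c • u τ := fun a => (hu a).const_mul c

theorem VecSqInt.sub {u v : ℝ → Fin n → ℂ} (hu : VecSqInt T u) (hv : VecSqInt T v) :
    VecSqInt T fun τ => u τ - v τ := fun a => (hu a).sub (hv a)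

theorem VecSqInt.neg {u : ℝ → Fin n → ℂ} (hu : VecSqInt T u) :
    VecSqInt T fun τ => -u τ := fun a => (hu a).neg

theorem toSeq_add (hT : 0 < T) {u v : ℝ → Fin n → ℂ} (hu : VecSqInt T u) (hv : VecSqInt T v) :
    toSeq T (fun τ => u τ + v τ) = toSeq T u + toSeq T v := by
  ext i
  rw [lp.coeFn_add, Pi.add_apply, toSeq_apply hT hu, toSeq_apply hT hv,
    toSeq_apply hT (hu.add hv)]
  exact coef_add hT (hu.integrableOn _) (hv.integrableOn _) _

theorem toSeq_smul (hT : 0 < T) {u : ℝ → Fin n → ℂ} (c : ℂ) (hu : VecSqInt T u) :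
    toSeq T (fun τ => c • u τ) = c • toSeq T u := by
  ext i
  rw [lp.coeFn_smul, Pi.smul_apply, toSeq_apply hT hu, toSeq_apply hT (hu.smul c)]
  exact coef_const_mul c _ _

theorem toSeq_neg (hT : 0 < T) {u : ℝ → Fin n → ℂ} (hu : VecSqInt T u) :
    toSeq T (fun τ => -u τ) = -toSeq T u := by
  have := toSeq_smul hT (-1) hu
  simpa using this

theorem toSeq_sub (hT : 0 < T) {u v : ℝ → Fin n → ℂ} (hu : VecSqInt T u) (hv : VecSqInt T v) :
    toSeq T (fun τ => u τ - v τ) = toSeq T u - toSeq T v := by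
  have := toSeq_add hT hu hv.neg
  simpa only [← sub_eq_add_neg, toSeq_neg hT hv] using this

theorem exists_toSeq_eq (hT : 0 < T) (f : SeqSpace n) :
    ∃ u : ℝ → Fin n → ℂ, VecSqInt T u ∧ toSeq T u = f := by
  have hf : ∀ a, Memℓp (fun k : ℤ => f (k, a)) 2 := by
    intro a
    have := lp.memℓp f
    rw [memℓp_gen_iff (by norm_num)] at this ⊢
    exact this.comp_injective (i := fun k : ℤ => (k, a)) fun x y h => by simpa using h
  choose u hu huf using fun a => exists_coef_eq hT (⟨_, hf a⟩ : lp (fun _ : ℤ => ℂ) 2)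
  have hu' : VecSqInt T (fun τ a => u a τ) := hu
  refine ⟨fun τ a => u a τ, hu', ?_⟩
  ext i
  rw [toSeq_apply hT hu']
  exact huf i.2 i.1

theorem ae_eq_of_toSeq_eq (hT : 0 < T) {u v : ℝ → Fin n → ℂ} (hu : VecSqInt T u)
    (hv : VecSqInt T v) (h : toSeq T u = toSeq T v) : u =ᵐ[volume.restrict (Ioc 0 T)] v := by
  have h1 : toSeq T (fun τ => u τ - v τ) = 0 := by rw [toSeq_sub hT hu hv, h, sub_self]
  have h2 : ∀ a, (fun τ => (u τ - v τ) a) =ᵐ[volume.restrict (Ioc 0 T)] 0 := fun a => by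
    refine ae_eq_zero_of_coef hT ((hu.sub hv) a) fun k => ?_
    have := congrFun (congrArg (fun f : SeqSpace n => (f : ℤ × Fin n → ℂ)) h1) (k, a)
    rw [toSeq_apply hT (hu.sub hv)] at this
    simpa using this
  filter_upwards [ae_all_iff.mpr h2] with τ hτ
  ext a
  simpa [sub_eq_zero] using hτ a

theorem re_inner_toSeq_self (hT : 0 < T) {u : ℝ → Fin n → ℂ} (hu : VecSqInt T u) :
    ‖toSeq T u‖ ^ 2 = (1 / T) * ∫ τ in (0 : ℝ)..T, ∑ a, ‖u τ a‖ ^ 2 := by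
  have h := inner_toSeq hT hu hu
  rw [inner_self_eq_norm_sq_to_K] at h
  have h2 : ∫ τ in (0 : ℝ)..T, star (u τ) ⬝ᵥ u τ
      = ((∫ τ in (0 : ℝ)..T, ∑ a, ‖u τ a‖ ^ 2 : ℝ) : ℂ) := by
    rw [← intervalIntegral.integral_ofReal]
    congr 1
    ext τ
    simp only [dotProduct, Pi.star_apply, RCLike.star_def, RCLike.conj_mul]
    push_cast; rfl
  rw [h2] at h
  exact Complex.ofReal_injective (by push_cast at h ⊢; exact h)

/-- The bound is linear in `ε` with a factor depending only on the dominating function `φ`. It is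
thus uniform over the columns of a Toeplitz matrix and over small perturbations of a smooth factor.
-/
theorem norm_toSeq_le (hT : 0 < T) {u : ℝ → Fin n → ℂ} (hu : VecSqInt T u) {φ : ℝ → ℝ} {ε : ℝ}
    (hε : 0 ≤ ε) (hφ : MemLp φ 2 (volume.restrict (Ioc 0 T)))
    (h : ∀ τ ∈ Ioc 0 T, ∀ a, ‖u τ a‖ ≤ ε * φ τ) :
    ‖toSeq T u‖ ≤ ε * Real.sqrt ((1 / T) * (n * ∫ τ in (0 : ℝ)..T, φ τ ^ 2)) := by
  refine le_of_sq_le_sq ?_ (by positivity)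
  have hI : 0 ≤ ∫ τ in (0 : ℝ)..T, φ τ ^ 2 :=
    intervalIntegral.integral_nonneg hT.le fun τ _ => by positivity
  rw [mul_pow, Real.sq_sqrt (by positivity), re_inner_toSeq_self hT hu]
  have hint : ∀ a, IntervalIntegrable (fun τ => ‖u τ a‖ ^ 2) volume 0 T := fun a => by
    rw [intervalIntegrable_iff_integrableOn_Ioc_of_le hT.le]
    exact (memLp_two_iff_integrable_sq_norm (hu a).1).mp (hu a)
  have hφi : IntervalIntegrable (fun τ => φ τ ^ 2) volume 0 T := by
    rw [intervalIntegrable_iff_integrableOn_Ioc_of_le hT.le]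
    exact hφ.integrable_sq
  have : ∫ τ in (0 : ℝ)..T, ∑ a, ‖u τ a‖ ^ 2 ≤ ∫ τ in (0 : ℝ)..T, ε ^ 2 * (n * φ τ ^ 2) := by
    rw [intervalIntegral.integral_of_le hT.le, intervalIntegral.integral_of_le hT.le]
    refine setIntegral_mono_on (integrable_finsetSum _ fun a _ => (hint a).1)
      ((hφi.const_mul _).const_mul _).1 measurableSet_Ioc fun τ hτ => ?_
    calc ∑ a, ‖u τ a‖ ^ 2 ≤ ∑ _a : Fin n, (ε * φ τ) ^ 2 :=
          Finset.sum_le_sum fun a _ => pow_le_pow_left₀ (norm_nonneg _) (h τ hτ a) 2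
      _ = _ := by simp; ring
  rw [intervalIntegral.integral_const_mul, intervalIntegral.integral_const_mul] at this
  calc _ ≤ (1 / T) * (ε ^ 2 * (n * ∫ τ in (0 : ℝ)..T, φ τ ^ 2)) := by gcongr
    _ = _ := by ring

end ToSeq

end HarmonicRiccati

end

noncomputable section

set_option linter.unusedSectionVars false

namespace HarmonicRiccati

open MeasureTheory Set Filter Topology

open scoped ComplexConjugate InnerProductSpace

/-! ### Real matrices acting on complex vectors -/

section Complexify

variable {n m l : ℕ}

/-- A real matrix regarded as a complex matrix. -/
def cx (M : Matrix (Fin n) (Fin m) ℝ) : Matrix (Fin n) (Fin m) ℂ := M.map Complex.ofReal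

theorem cx_apply (M : Matrix (Fin n) (Fin m) ℝ) (a : Fin n) (b : Fin m) :
    cx M a b = (M a b : ℂ) := rfl

theorem cx_mul (M : Matrix (Fin n) (Fin m) ℝ) (N : Matrix (Fin m) (Fin l) ℝ) :
    cx (M * N) = cx M * cx N := Matrix.map_mul (f := Complex.ofRealHom)

theorem cx_add (M N : Matrix (Fin n) (Fin m) ℝ) : cx (M + N) = cx M + cx N := by
  ext a b; simp [cx_apply]

theorem cx_sub (M N : Matrix (Fin n) (Fin m) ℝ) : cx (M - N) = cx M - cx N := by
  ext a b; simp [cx_apply]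

theorem cx_smul (c : ℝ) (M : Matrix (Fin n) (Fin m) ℝ) : cx (c • M) = (c : ℂ) • cx M := by
  ext a b; simp [cx_apply]

theorem cx_one : cx (1 : Matrix (Fin n) (Fin n) ℝ) = 1 := by
  rw [cx, Matrix.map_one _ Complex.ofReal_zero Complex.ofReal_one]

theorem cx_mul_mulVec (M : Matrix (Fin n) (Fin m) ℝ) (N : Matrix (Fin m) (Fin l) ℝ)
    (x : Fin l → ℂ) : (cx (M * N)).mulVec x = (cx M).mulVec ((cx N).mulVec x) := by
  rw [cx_mul, Matrix.mulVec_mulVec]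

theorem star_cx_mulVec_dotProduct (M : Matrix (Fin n) (Fin m) ℝ) (x : Fin m → ℂ)
    (y : Fin n → ℂ) :
    star ((cx M).mulVec x) ⬝ᵥ y = star x ⬝ᵥ (cx M.transpose).mulVec y := by
  rw [Matrix.star_mulVec, Matrix.dotProduct_mulVec]
  congr 2
  ext a b
  simp [cx_apply, Matrix.conjTranspose_apply]

/-- The real part of $\bar z_az_b$ is
$\mathrm{Re}\,z_a\,\mathrm{Re}\,z_b+\mathrm{Im}\,z_a\,\mathrm{Im}\,z_b$, so no symmetry of `M` is
needed and positivity passes from real to complex vectors. -/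
theorem re_star_dotProduct_cx_mulVec (M : Matrix (Fin n) (Fin n) ℝ) (z : Fin n → ℂ) :
    (star z ⬝ᵥ (cx M).mulVec z).re = (fun a => (z a).re) ⬝ᵥ M.mulVec (fun a => (z a).re)
      + (fun a => (z a).im) ⬝ᵥ M.mulVec (fun a => (z a).im) := by
  simp only [dotProduct, Matrix.mulVec, Complex.re_sum, Pi.star_apply, cx_apply, Complex.mul_re,
    Complex.star_def, Complex.conj_re, Complex.conj_im, Complex.mul_im,
    Complex.ofReal_re, Complex.ofReal_im, zero_mul, sub_zero, add_zero, Finset.mul_sum,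
    ← Finset.sum_add_distrib]
  refine Finset.sum_congr rfl fun a _ => Finset.sum_congr rfl fun b _ => ?_
  ring

theorem re_star_dotProduct_cx_nonneg {M : Matrix (Fin n) (Fin n) ℝ} (hM : M.PosSemidef)
    (z : Fin n → ℂ) : 0 ≤ (star z ⬝ᵥ (cx M).mulVec z).re := by
  rw [re_star_dotProduct_cx_mulVec]
  have h1 := hM.dotProduct_mulVec_nonneg (fun a => (z a).re)
  have h2 := hM.dotProduct_mulVec_nonneg (fun a => (z a).im)
  simp only [star_trivial] at h1 h2
  exact add_nonneg h1 h2

theorem re_star_dotProduct_cx_pos {M : Matrix (Fin n) (Fin n) ℝ} (hM : M.PosDef)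
    {z : Fin n → ℂ} (hz : z ≠ 0) : 0 < (star z ⬝ᵥ (cx M).mulVec z).re := by
  rw [re_star_dotProduct_cx_mulVec]
  have h1 := hM.posSemidef.dotProduct_mulVec_nonneg (fun a => (z a).re)
  have h2 := hM.posSemidef.dotProduct_mulVec_nonneg (fun a => (z a).im)
  simp only [star_trivial] at h1 h2
  by_cases hr : (fun a => (z a).re) = 0
  · have hi : (fun a => (z a).im) ≠ 0 := by
      intro hi
      apply hz
      ext a
      exact Complex.ext (congrFun hr a) (congrFun hi a)
    have := hM.dotProduct_mulVec_pos hi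
    simp only [star_trivial] at this
    linarith
  · have := hM.dotProduct_mulVec_pos hr
    simp only [star_trivial] at this
    linarith

theorem norm_cx_mulVec_le {M : Matrix (Fin n) (Fin m) ℝ} {C : ℝ} (hM : ∀ a b, |M a b| ≤ C)
    (z : Fin m → ℂ) (a : Fin n) : ‖(cx M).mulVec z a‖ ≤ C * ∑ b, ‖z b‖ := by
  rw [Matrix.mulVec, dotProduct, Finset.mul_sum]
  refine (norm_sum_le _ _).trans (Finset.sum_le_sum fun b _ => ?_)
  rw [norm_mul, cx_apply, Complex.norm_real]
  exact mul_le_mul_of_nonneg_right (hM a b) (norm_nonneg _)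

end Complexify

/-! ### Integrability over a period -/

section Integrability

variable {T : ℝ} {n m l : ℕ} {p q r : ENNReal}

theorem MemLpPeriod.entry {A : ℝ → Matrix (Fin n) (Fin m) ℝ} (hA : MemLpPeriod T p A)
    (a : Fin n) (b : Fin m) : MemLp (fun τ => A τ a b) p (volume.restrict (Ioc 0 T)) :=
  (hA a b).mono_measure (Measure.restrict_mono Ioc_subset_Icc_self le_rfl)

theorem memLpPeriod_iff {A : ℝ → Matrix (Fin n) (Fin m) ℝ} :
    MemLpPeriod T p A ↔ ∀ a b, MemLp (fun τ => A τ a b) p (volume.restrict (Ioc 0 T)) := by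
  rw [MemLpPeriod, restrict_Ioc_eq_restrict_Icc]

theorem MemLpPeriod.mul [ENNReal.HolderTriple p q r] {A : ℝ → Matrix (Fin n) (Fin m) ℝ}
    {B : ℝ → Matrix (Fin m) (Fin l) ℝ} (hA : MemLpPeriod T p A) (hB : MemLpPeriod T q B) :
    MemLpPeriod T r fun τ => A τ * B τ := by
  intro a b
  simp only [Matrix.mul_apply]
  exact memLp_finsetSum _ fun c _ => (hB c b).mul (hA a c)

theorem MemLpPeriod.add {A B : ℝ → Matrix (Fin n) (Fin m) ℝ} (hA : MemLpPeriod T p A)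
    (hB : MemLpPeriod T p B) : MemLpPeriod T p fun τ => A τ + B τ :=
  fun a b => (hA a b).add (hB a b)

theorem MemLpPeriod.sub {A B : ℝ → Matrix (Fin n) (Fin m) ℝ} (hA : MemLpPeriod T p A)
    (hB : MemLpPeriod T p B) : MemLpPeriod T p fun τ => A τ - B τ :=
  fun a b => (hA a b).sub (hB a b)

theorem MemLpPeriod.neg {A : ℝ → Matrix (Fin n) (Fin m) ℝ} (hA : MemLpPeriod T p A) :
    MemLpPeriod T p fun τ => -A τ :=
  fun a b => (hA a b).neg

theorem MemLpPeriod.smul {A : ℝ → Matrix (Fin n) (Fin m) ℝ} (c : ℝ) (hA : MemLpPeriod T p A) :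
    MemLpPeriod T p fun τ => c • A τ :=
  fun a b => (hA a b).const_mul c

theorem MemLpPeriod.transpose {A : ℝ → Matrix (Fin n) (Fin m) ℝ} (hA : MemLpPeriod T p A) :
    MemLpPeriod T p fun τ => (A τ).transpose := fun a b => hA b a

theorem MemLpPeriod.mono {A : ℝ → Matrix (Fin n) (Fin m) ℝ} (hA : MemLpPeriod T p A)
    (h : q ≤ p) : MemLpPeriod T q A := fun a b => (hA a b).mono_exponent h

theorem memLpPeriod_of_continuous {A : ℝ → Matrix (Fin n) (Fin m) ℝ} (hA : Continuous A) :
    MemLpPeriod T p A := by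
  intro a b
  have h1 : Continuous fun τ => A τ a b := hA.matrix_elem a b
  obtain ⟨C, hC⟩ := (isCompact_Icc (a := 0) (b := T)).exists_bound_of_continuousOn h1.continuousOn
  exact MemLp.of_bound h1.aestronglyMeasurable C
    ((ae_restrict_mem measurableSet_Icc).mono fun τ hτ => hC τ hτ)

theorem MemLpPeriod.exists_bound {A : ℝ → Matrix (Fin n) (Fin m) ℝ} (hA : MemLpPeriod T ⊤ A) :
    ∃ C, 0 ≤ C ∧ ∀ᵐ τ ∂(volume.restrict (Ioc 0 T)), ∀ a b, |A τ a b| ≤ C := by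
  have h1 : ∀ a b, ∃ C, ∀ᵐ τ ∂(volume.restrict (Ioc 0 T)), |A τ a b| ≤ C := fun a b =>
    ⟨(eLpNormEssSup (fun τ => A τ a b) (volume.restrict (Ioc 0 T))).toReal, by
      have h2 := (hA.entry a b).2
      rw [eLpNorm_exponent_top] at h2
      filter_upwards [enorm_ae_le_eLpNormEssSup (fun τ => A τ a b)
        (volume.restrict (Ioc 0 T))] with τ hτ
      have := ENNReal.toReal_mono h2.ne hτ
      rwa [toReal_enorm, Real.norm_eq_abs] at this⟩
  choose C hC using h1
  refine ⟨∑ a, ∑ b, |C a b|, by positivity, ?_⟩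
  rw [ae_all_iff]; intro a
  rw [ae_all_iff]; intro b
  filter_upwards [hC a b] with τ hτ
  refine hτ.trans ((le_abs_self _).trans ?_)
  refine le_trans ?_ (Finset.single_le_sum (f := fun a => ∑ b, |C a b|)
    (fun a _ => by positivity) (Finset.mem_univ a))
  exact Finset.single_le_sum (f := fun b => |C a b|) (fun b _ => abs_nonneg _) (Finset.mem_univ b)

/-- Almost all values of `M` lie in a closed ball of a finite-dimensional space, and `f` is bounded
on that compact set. -/
theorem memLp_top_comp {M : ℝ → Matrix (Fin n) (Fin m) ℝ} (hM : MemLpPeriod T ⊤ M)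
    {f : (Fin n → Fin m → ℝ) → ℝ} (hf : Continuous f) :
    MemLp (fun τ => f (M τ)) ⊤ (volume.restrict (Ioc 0 T)) := by
  obtain ⟨C, hC0, hC⟩ := hM.exists_bound
  have hK : IsCompact (Metric.closedBall (0 : Fin n → Fin m → ℝ) C) := isCompact_closedBall _ _
  obtain ⟨D, hD⟩ := hK.exists_bound_of_continuousOn hf.continuousOn
  have hm : AEMeasurable (fun τ => (fun a b => M τ a b : Fin n → Fin m → ℝ))
      (volume.restrict (Ioc 0 T)) :=
    aemeasurable_pi_lambda _ fun a => aemeasurable_pi_lambda _ fun b =>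
      (hM.entry a b).1.aemeasurable
  refine MemLp.of_bound (hf.measurable.comp_aemeasurable hm).aestronglyMeasurable D ?_
  filter_upwards [hC] with τ hτ
  refine hD (fun a b => M τ a b) ?_
  rw [mem_closedBall_zero_iff, pi_norm_le_iff_of_nonneg hC0]
  intro a
  rw [pi_norm_le_iff_of_nonneg hC0]
  exact hτ a

/-- By Cramer's formula the inverse is the adjugate, polynomial in bounded entries, divided by a
determinant bounded away from zero. -/
theorem memLpPeriod_inv {R : ℝ → Matrix (Fin m) (Fin m) ℝ} (hR : MemLpPeriod T ⊤ R) {η : ℝ}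
    (hη : 0 < η) (hdet : ∀ᵐ τ : ℝ, η ≤ |(R τ).det|) : MemLpPeriod T ⊤ fun τ => (R τ)⁻¹ := by
  rw [memLpPeriod_iff]
  intro a b
  have hd : MemLp (fun τ => ((R τ).det)⁻¹) ⊤ (volume.restrict (Ioc 0 T)) := by
    have h1 := memLp_top_comp hR (f := fun M => Matrix.det (Matrix.of M))
      (by simp only [Matrix.det_apply]; fun_prop)
    refine MemLp.of_bound (h1.1.aemeasurable.inv).aestronglyMeasurable η⁻¹ ?_
    filter_upwards [ae_restrict_of_ae hdet] with τ hτ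
    rw [norm_inv, Real.norm_eq_abs]
    exact inv_anti₀ hη hτ
  have ha : MemLp (fun τ => (R τ).adjugate a b) ⊤ (volume.restrict (Ioc 0 T)) := by
    refine memLp_top_comp hR (f := fun M => Matrix.adjugate (Matrix.of M) a b) ?_
    have h1 : Continuous fun M : Fin m → Fin m → ℝ => (Matrix.of M).adjugate :=
      Continuous.matrix_adjugate continuous_id
    exact h1.matrix_elem a b
  have := ha.mul (r := ⊤) hd
  refine this.ae_eq (Eventually.of_forall fun τ => ?_)
  simp [Matrix.inv_def, Ring.inverse_eq_inv']

theorem MemLpPeriod.entrywiseIntegrable (hT : 0 < T) {A : ℝ → Matrix (Fin n) (Fin m) ℝ}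
    (hA : MemLpPeriod T p A) (hp : 1 ≤ p) (hper : Function.Periodic A T) :
    EntrywiseIntegrable A := by
  intro a b s t
  have h1 : Function.Periodic (fun τ => A τ a b) T := fun τ => by simp only [hper τ]
  refine h1.intervalIntegrable hT.ne' (t := 0) ?_ s t
  rw [zero_add, intervalIntegrable_iff_integrableOn_Ioc_of_le hT.le]
  exact (hA.entry a b).integrable hp

/-- All components of `u` are in `L^p` over `(0, T]`. -/
def VecMemLp (T : ℝ) (p : ENNReal) (u : ℝ → Fin n → ℂ) : Prop :=
  ∀ a, MemLp (fun τ => u τ a) p (volume.restrict (Ioc 0 T))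

theorem vecMemLp_of_continuous {u : ℝ → Fin n → ℂ} (hu : Continuous u) : VecMemLp T p u := by
  intro a
  have h1 : Continuous fun τ => u τ a := (continuous_apply a).comp hu
  obtain ⟨C, hC⟩ := (isCompact_Icc (a := 0) (b := T)).exists_bound_of_continuousOn h1.continuousOn
  exact MemLp.of_bound h1.aestronglyMeasurable C
    ((ae_restrict_mem measurableSet_Ioc).mono fun τ hτ => hC τ (Ioc_subset_Icc_self hτ))

theorem MemLp.complex_ofReal {x : ℝ → ℝ} (hx : MemLp x p (volume.restrict (Ioc 0 T))) :
    MemLp (fun τ => (x τ : ℂ)) p (volume.restrict (Ioc 0 T)) := hx.ofReal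

theorem VecMemLp.mulVec [ENNReal.HolderTriple p q r] {A : ℝ → Matrix (Fin n) (Fin m) ℝ}
    (hA : MemLpPeriod T p A) {u : ℝ → Fin m → ℂ} (hu : VecMemLp T q u) :
    VecMemLp T r fun τ => (cx (A τ)).mulVec (u τ) := by
  intro a
  simp only [Matrix.mulVec, dotProduct]
  exact memLp_finsetSum _ fun b _ => (hu b).mul (MemLp.complex_ofReal (hA.entry a b))

theorem VecMemLp.mulVec_sqInt {A : ℝ → Matrix (Fin n) (Fin m) ℝ} (hA : MemLpPeriod T ⊤ A)
    {u : ℝ → Fin m → ℂ} (hu : VecSqInt T u) : VecSqInt T fun τ => (cx (A τ)).mulVec (u τ) :=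
  VecMemLp.mulVec (r := 2) hA hu

theorem VecMemLp.mulVec_continuous_sqInt {A : ℝ → Matrix (Fin n) (Fin m) ℝ}
    (hA : MemLpPeriod T 2 A) {u : ℝ → Fin m → ℂ} (hu : Continuous u) :
    VecSqInt T fun τ => (cx (A τ)).mulVec (u τ) :=
  VecMemLp.mulVec (q := ⊤) (r := 2) hA (vecMemLp_of_continuous hu)

end Integrability

end HarmonicRiccati

end

noncomputable section

set_option linter.unusedSectionVars false

namespace HarmonicRiccati

open MeasureTheory Set Filter Topology

open scoped ComplexConjugate InnerProductSpace

/-! ### Multiplication operators and block Toeplitz matrices -/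

section Toeplitz

variable {T : ℝ} {n m l : ℕ}

/-- The vector function `e^{jωkτ} ε_a` with `j = (k, a)`. -/
def expv (T : ℝ) (j : ℤ × Fin n) (τ : ℝ) : Fin n → ℂ := Pi.single j.2 (char T j.1 τ)

theorem continuous_expv (j : ℤ × Fin n) : Continuous (expv T j) :=
  (continuous_single j.2).comp (continuous_char j.1)

theorem vecSqInt_of_continuous {u : ℝ → Fin n → ℂ} (hu : Continuous u) : VecSqInt T u :=
  vecMemLp_of_continuous hu

/-- The canonical basis of `ℓ²`. -/
abbrev bas (j : ℤ × Fin n) : SeqSpace n := lp.single 2 j (1 : ℂ)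

theorem toSeq_expv (hT : 0 < T) (j : ℤ × Fin n) : toSeq T (expv T j) = bas j := by
  ext i
  rw [toSeq_apply hT (vecSqInt_of_continuous (continuous_expv j)), lp.single_apply]
  by_cases h2 : i.2 = j.2
  · have h3 : (fun τ => expv T j τ i.2) = char T j.1 := by
      ext τ; rw [expv, h2, Pi.single_eq_same]
    rw [h3, coef_char hT, Pi.single_apply]
    by_cases h1 : i.1 = j.1
    · rw [if_pos h1, if_pos (Prod.ext h1 h2)]
    · rw [if_neg h1, if_neg fun h => h1 (by rw [h])]
  · have h3 : (fun τ => expv T j τ i.2) = fun _ => (0 : ℂ) := by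
      ext τ; rw [expv, Pi.single_eq_of_ne h2]
    rw [h3, Pi.single_apply, if_neg fun h => h2 (by rw [h])]
    simp [coef]

theorem inner_bas_left (i : ℤ × Fin n) (v : SeqSpace n) : ⟪bas i, v⟫_ℂ = v i := by
  rw [lp.inner_single_left]; simp

theorem inner_bas_right (i : ℤ × Fin n) (v : SeqSpace n) : ⟪v, bas i⟫_ℂ = conj (v i) := by
  rw [lp.inner_single_right]; simp

theorem hasSum_bas (v : SeqSpace n) : HasSum (fun j => v j • (bas j : SeqSpace n)) v := by
  have := lp.hasSum_single (p := 2) (by norm_num) v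
  refine this.congr_fun fun j => ?_
  rw [← lp.single_smul, smul_eq_mul, mul_one]

theorem norm_toSeq_mulVec_le (hT : 0 < T) {M : ℝ → Matrix (Fin n) (Fin m) ℝ}
    (hM : MemLpPeriod T ⊤ M) : ∃ C, 0 ≤ C ∧ ∀ u : ℝ → Fin m → ℂ, VecSqInt T u →
      ‖toSeq T (fun τ => (cx (M τ)).mulVec (u τ))‖ ≤ C * ‖toSeq T u‖ := by
  obtain ⟨C, hC0, hC⟩ := hM.exists_bound
  refine ⟨Real.sqrt (n * (C ^ 2 * m)), Real.sqrt_nonneg _, fun u hu => ?_⟩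
  refine le_of_sq_le_sq ?_ (by positivity)
  rw [mul_pow, Real.sq_sqrt (by positivity), re_inner_toSeq_self hT hu,
    re_inner_toSeq_self hT (VecMemLp.mulVec_sqInt hM hu)]
  have hint : ∀ {k : ℕ} {w : ℝ → Fin k → ℂ}, VecSqInt T w →
      IntegrableOn (fun τ => ∑ a, ‖w τ a‖ ^ 2) (Ioc 0 T) := fun hw =>
    integrable_finsetSum _ fun a _ => (memLp_two_iff_integrable_sq_norm (hw a).1).mp (hw a)
  have : ∫ τ in (0 : ℝ)..T, ∑ a, ‖(cx (M τ)).mulVec (u τ) a‖ ^ 2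
      ≤ ∫ τ in (0 : ℝ)..T, (n * (C ^ 2 * m)) * ∑ a, ‖u τ a‖ ^ 2 := by
    rw [intervalIntegral.integral_of_le hT.le, intervalIntegral.integral_of_le hT.le]
    refine integral_mono_ae (hint (VecMemLp.mulVec_sqInt hM hu)) ((hint hu).const_mul _) ?_
    filter_upwards [hC] with τ hτ
    have h1 : ∀ a, ‖(cx (M τ)).mulVec (u τ) a‖ ^ 2 ≤ C ^ 2 * m * ∑ b, ‖u τ b‖ ^ 2 := by
      intro a
      have h2 := norm_cx_mulVec_le hτ (u τ) a
      have h3 : (∑ b, ‖u τ b‖) ^ 2 ≤ m * ∑ b, ‖u τ b‖ ^ 2 := by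
        simpa using sq_sum_le_card_mul_sum_sq (s := Finset.univ) (f := fun b => ‖u τ b‖)
      calc _ ≤ (C * ∑ b, ‖u τ b‖) ^ 2 := pow_le_pow_left₀ (norm_nonneg _) h2 2
        _ = C ^ 2 * (∑ b, ‖u τ b‖) ^ 2 := by ring
        _ ≤ C ^ 2 * (m * ∑ b, ‖u τ b‖ ^ 2) := by gcongr
        _ = _ := by ring
    calc ∑ a, ‖(cx (M τ)).mulVec (u τ) a‖ ^ 2 ≤ ∑ _a : Fin n, C ^ 2 * m * ∑ b, ‖u τ b‖ ^ 2 :=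
          Finset.sum_le_sum fun a _ => h1 a
      _ = _ := by simp; ring
  rw [intervalIntegral.integral_const_mul] at this
  calc _ ≤ (1 / T) * ((n * (C ^ 2 * m)) * ∫ τ in (0 : ℝ)..T, ∑ a, ‖u τ a‖ ^ 2) := by gcongr
    _ = _ := by ring

/-- The operator multiplies any square integrable representative of a sequence by `M`; boundedness
comes from the essential bound on the entries. -/
theorem exists_mulOp (hT : 0 < T) {M : ℝ → Matrix (Fin n) (Fin m) ℝ} (hM : MemLpPeriod T ⊤ M) :
    ∃ L : SeqSpace m →L[ℂ] SeqSpace n, ∀ u : ℝ → Fin m → ℂ, VecSqInt T u →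
      L (toSeq T u) = toSeq T fun τ => (cx (M τ)).mulVec (u τ) := by
  choose s hs hs' using exists_toSeq_eq (n := m) hT
  obtain ⟨C, hC0, hC⟩ := norm_toSeq_mulVec_le hT hM
  -- Independence of the chosen representative, which also yields linearity: two functions with the
  -- same coefficients agree almost everywhere on a period.
  have key : ∀ u : ℝ → Fin m → ℂ, VecSqInt T u → ∀ v, toSeq T u = v →
      toSeq T (fun τ => (cx (M τ)).mulVec (s v τ)) = toSeq T fun τ => (cx (M τ)).mulVec (u τ) := by
    intro u hu v huv
    refine toSeq_congr_ae hT ?_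
    filter_upwards [ae_eq_of_toSeq_eq hT (hs v) hu (by rw [hs', huv])] with τ hτ
    rw [hτ]
  let L : SeqSpace m →ₗ[ℂ] SeqSpace n :=
    { toFun := fun v => toSeq T fun τ => (cx (M τ)).mulVec (s v τ)
      map_add' := by
        intro v w
        rw [key (fun τ => s v τ + s w τ) ((hs v).add (hs w)) (v + w)
          (by rw [toSeq_add hT (hs v) (hs w), hs', hs'])]
        simp only [Matrix.mulVec_add]
        exact toSeq_add hT (VecMemLp.mulVec_sqInt hM (hs v)) (VecMemLp.mulVec_sqInt hM (hs w))
      map_smul' := by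
        intro c v
        rw [key (fun τ => c • s v τ) ((hs v).smul c) (c • v)
          (by rw [toSeq_smul hT c (hs v), hs'])]
        simp only [Matrix.mulVec_smul]
        exact toSeq_smul hT c (VecMemLp.mulVec_sqInt hM (hs v)) }
  refine ⟨L.mkContinuous C fun v => ?_, fun u hu => ?_⟩
  · have := hC (s v) (hs v)
    rw [hs'] at this
    exact this
  · exact key u hu _ rfl

open Classical in
/-- Multiplication by the bounded matrix function `M`, as an operator on Fourier coefficients. -/
def mulOp (T : ℝ) (M : ℝ → Matrix (Fin n) (Fin m) ℝ) : SeqSpace m →L[ℂ] SeqSpace n :=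
  if h : ∃ L : SeqSpace m →L[ℂ] SeqSpace n, ∀ u : ℝ → Fin m → ℂ, VecSqInt T u →
    L (toSeq T u) = toSeq T fun τ => (cx (M τ)).mulVec (u τ) then h.choose else 0

theorem mulOp_toSeq (hT : 0 < T) {M : ℝ → Matrix (Fin n) (Fin m) ℝ} (hM : MemLpPeriod T ⊤ M)
    {u : ℝ → Fin m → ℂ} (hu : VecSqInt T u) :
    mulOp T M (toSeq T u) = toSeq T fun τ => (cx (M τ)).mulVec (u τ) := by
  rw [mulOp, dif_pos (exists_mulOp hT hM)]
  exact (exists_mulOp hT hM).choose_spec u hu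

theorem mulOp_mulOp (hT : 0 < T) {M : ℝ → Matrix (Fin n) (Fin m) ℝ} (hM : MemLpPeriod T ⊤ M)
    {N : ℝ → Matrix (Fin m) (Fin l) ℝ} (hN : MemLpPeriod T ⊤ N) (v : SeqSpace l) :
    mulOp T M (mulOp T N v) = mulOp T (fun τ => M τ * N τ) v := by
  obtain ⟨u, hu, rfl⟩ := exists_toSeq_eq hT v
  rw [mulOp_toSeq hT hN hu, mulOp_toSeq hT hM (VecMemLp.mulVec_sqInt hN hu),
    mulOp_toSeq hT (hM.mul hN) hu]
  simp only [cx_mul_mulVec]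

theorem mulOp_eq_self (hT : 0 < T) {M : ℝ → Matrix (Fin n) (Fin n) ℝ} (hM : MemLpPeriod T ⊤ M)
    (h : ∀ᵐ τ, M τ = 1) (v : SeqSpace n) : mulOp T M v = v := by
  obtain ⟨u, hu, rfl⟩ := exists_toSeq_eq hT v
  rw [mulOp_toSeq hT hM hu]
  refine toSeq_congr_ae hT ?_
  filter_upwards [ae_restrict_of_ae h] with τ hτ
  rw [hτ, cx_one, Matrix.one_mulVec]

theorem inner_mulOp (hT : 0 < T) {M : ℝ → Matrix (Fin n) (Fin m) ℝ} (hM : MemLpPeriod T ⊤ M)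
    {u : ℝ → Fin n → ℂ} (hu : VecSqInt T u) {v : ℝ → Fin m → ℂ} (hv : VecSqInt T v) :
    ⟪toSeq T u, mulOp T M (toSeq T v)⟫_ℂ
      = (1 / (T : ℂ)) * ∫ τ in (0 : ℝ)..T, star (u τ) ⬝ᵥ (cx (M τ)).mulVec (v τ) := by
  rw [mulOp_toSeq hT hM hv, inner_toSeq hT hu (VecMemLp.mulVec_sqInt hM hv)]

theorem conj_coef_ofReal (x : ℝ → ℝ) (k : ℤ) :
    conj (coef T (fun τ => (x τ : ℂ)) k) = coef T (fun τ => (x τ : ℂ)) (-k) := by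
  rw [coef_eq, coef_eq, map_mul]
  simp only [intervalIntegral, map_sub, ← integral_conj]
  simp only [map_mul, Complex.conj_ofReal, conj_char, map_div₀, map_one, neg_neg]

theorem toeplitz_apply {M : ℝ → Matrix (Fin n) (Fin m) ℝ} (hM : Function.Periodic M T)
    (t : ℝ) (i : ℤ × Fin n) (j : ℤ × Fin m) :
    toeplitz T M t i j = coef T (fun τ => (M τ i.2 j.2 : ℂ)) (i.1 - j.1) := by
  rw [toeplitz, phasor_eq_coef]
  intro τ
  simp only [hM τ]

theorem toeplitz_conjTranspose {M : ℝ → Matrix (Fin n) (Fin m) ℝ} (hM : Function.Periodic M T)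
    (t : ℝ) : (toeplitz T M t).conjTranspose = toeplitz T (fun τ => (M τ).transpose) t := by
  ext i j
  rw [Matrix.conjTranspose_apply, toeplitz_apply hM,
    toeplitz_apply (fun τ => by simp only [hM τ]), Complex.star_def, conj_coef_ofReal]
  congr 1
  ring

theorem cx_mulVec_expv (M : Matrix (Fin n) (Fin m) ℝ) (j : ℤ × Fin m) (τ : ℝ) (a : Fin n) :
    (cx M).mulVec (expv T j τ) a = (M a j.2 : ℂ) * char T j.1 τ := by
  rw [expv, Matrix.mulVec_single]
  simp [cx_apply]

/-- Multiplication by $e^{j\omega l\tau}$ shifts coefficients. The columns of a Toeplitz matrix are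
thus available for symbols that are merely $L^2$, even when multiplication by them is unbounded. -/
theorem toSeq_mulVec_expv (hT : 0 < T) {M : ℝ → Matrix (Fin n) (Fin m) ℝ}
    (hM : Function.Periodic M T) (hM2 : MemLpPeriod T 2 M) (t : ℝ) (i : ℤ × Fin n)
    (j : ℤ × Fin m) :
    toSeq T (fun τ => (cx (M τ)).mulVec (expv T j τ)) i = toeplitz T M t i j := by
  rw [toSeq_apply hT (VecMemLp.mulVec_continuous_sqInt hM2 (continuous_expv j)),
    toeplitz_apply hM]
  simp only [cx_mulVec_expv]
  exact coef_mul_char _ _ _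

theorem opMatrix_apply (L : SeqSpace m →L[ℂ] SeqSpace n) (i : ℤ × Fin n) (j : ℤ × Fin m) :
    opMatrix L i j = (L (bas j) : SeqSpace n) i := rfl

theorem opMatrix_mulOp (hT : 0 < T) {M : ℝ → Matrix (Fin n) (Fin m) ℝ}
    (hM : Function.Periodic M T) (hM2 : MemLpPeriod T ⊤ M) (t : ℝ) :
    opMatrix (mulOp T M) = toeplitz T M t := by
  ext i j
  rw [opMatrix_apply, ← toSeq_expv hT j,
    mulOp_toSeq hT hM2 (vecSqInt_of_continuous (continuous_expv j)),
    toSeq_mulVec_expv hT hM (hM2.mono (by simp)) t]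

end Toeplitz

end HarmonicRiccati

end

noncomputable section

set_option linter.unusedSectionVars false

namespace HarmonicRiccati

open MeasureTheory Set Filter Topology

open scoped ComplexConjugate InnerProductSpace

/-! ### Matrices with bounded columns -/

section Columns

variable {T : ℝ} {n m l : ℕ}

/-- The `j`-th column of an infinite matrix with square summable columns. -/
def colS (X : BlockMatrix n m) (j : ℤ × Fin m) : SeqSpace n := seqOf fun i => X i j

/-- The columns of `X` are square summable. -/
def ColMem (X : BlockMatrix n m) : Prop := ∀ j, Memℓp (fun i => X i j) 2

theorem HasBoundedColumns.colMem {X : BlockMatrix n m} (hX : HasBoundedColumns X) : ColMem X := by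
  obtain ⟨C, hC⟩ := hX
  exact fun j => memℓp_two_iff.mpr (hC j).1

theorem colS_apply {X : BlockMatrix n m} (hX : ColMem X) (i : ℤ × Fin n) (j : ℤ × Fin m) :
    colS X j i = X i j := seqOf_apply (hX j) i

theorem norm_seq_sq (v : SeqSpace n) : ‖v‖ ^ 2 = ∑' i, ‖v i‖ ^ 2 := by
  have := lp.norm_rpow_eq_tsum (p := 2) (by norm_num) v
  simpa using this

theorem summable_seq_sq (v : SeqSpace n) : Summable fun i => ‖v i‖ ^ 2 :=
  memℓp_two_iff.mp (lp.memℓp v)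

theorem HasBoundedColumns.exists_norm_le {X : BlockMatrix n m} (hX : HasBoundedColumns X) :
    ∃ C, 0 ≤ C ∧ ∀ j, ‖colS X j‖ ≤ C := by
  have hm := hX.colMem
  obtain ⟨C, hC⟩ := hX
  refine ⟨Real.sqrt |C|, Real.sqrt_nonneg _, fun j => ?_⟩
  refine Real.le_sqrt_of_sq_le ?_
  rw [norm_seq_sq]
  simp only [colS_apply hm]
  exact (hC j).2.trans (le_abs_self _)

theorem hasBoundedColumns_of_norm_le {X : BlockMatrix n m} (hX : ColMem X) {C : ℝ}
    (hC : ∀ j, ‖colS X j‖ ≤ C) : HasBoundedColumns X := by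
  refine ⟨C ^ 2, fun j => ⟨memℓp_two_iff.mp (hX j), ?_⟩⟩
  have := norm_seq_sq (colS X j)
  simp only [colS_apply hX] at this
  rw [← this]
  exact pow_le_pow_left₀ (norm_nonneg _) (hC j) 2

theorem colMem_of_colS_eq {X : BlockMatrix n m} {f : ℤ × Fin m → SeqSpace n}
    (h : ∀ i j, f j i = X i j) : ColMem X ∧ ∀ j, colS X j = f j := by
  have h1 : ColMem X := fun j => by
    have := lp.memℓp (f j)
    have h2 : (fun i => X i j) = (f j : ℤ × Fin n → ℂ) := funext fun i => (h i j).symm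
    rw [h2]; exact this
  refine ⟨h1, fun j => ?_⟩
  ext i
  rw [colS_apply h1, h]

theorem HasBoundedColumns.sub {X Y : BlockMatrix n m} (hX : HasBoundedColumns X)
    (hY : HasBoundedColumns Y) : HasBoundedColumns (X - Y) ∧
      ∀ j, colS (X - Y) j = colS X j - colS Y j := by
  have h := colMem_of_colS_eq (X := X - Y) (f := fun j => colS X j - colS Y j) (fun i j => by
    rw [lp.coeFn_sub, Pi.sub_apply, colS_apply hX.colMem, colS_apply hY.colMem]
    rfl)
  obtain ⟨C, hC0, hC⟩ := hX.exists_norm_le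
  obtain ⟨D, hD0, hD⟩ := hY.exists_norm_le
  refine ⟨hasBoundedColumns_of_norm_le h.1 (C := C + D) fun j => ?_, h.2⟩
  rw [h.2]
  exact (norm_sub_le _ _).trans (add_le_add (hC j) (hD j))

/-- Exponentials have modulus one, so one $L^2$ norm of the symbol bounds all columns at once. -/
theorem colS_toeplitz (hT : 0 < T) {M : ℝ → Matrix (Fin n) (Fin m) ℝ}
    (hM : Function.Periodic M T) (hM2 : MemLpPeriod T 2 M) (t : ℝ) :
    HasBoundedColumns (toeplitz T M t) ∧
      ∀ j, colS (toeplitz T M t) j = toSeq T fun τ => (cx (M τ)).mulVec (expv T j τ) := by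
  have h := colMem_of_colS_eq (X := toeplitz T M t)
    (f := fun j => toSeq T fun τ => (cx (M τ)).mulVec (expv T j τ))
    (fun i j => toSeq_mulVec_expv hT hM hM2 t i j)
  refine ⟨hasBoundedColumns_of_norm_le h.1 (C := 1 * Real.sqrt ((1 / T) *
    (n * ∫ τ in (0 : ℝ)..T, (∑ a, ∑ b, |M τ a b|) ^ 2))) fun j => ?_, h.2⟩
  rw [h.2]
  refine norm_toSeq_le hT (VecMemLp.mulVec_continuous_sqInt hM2 (continuous_expv j))
    zero_le_one ?_ fun τ _ a => ?_
  · exact memLp_finsetSum _ fun a _ => memLp_finsetSum _ fun b _ => (hM2.entry a b).abs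
  · rw [cx_mulVec_expv, norm_mul, norm_char, mul_one, one_mul, Complex.norm_real]
    refine le_trans ?_ (Finset.single_le_sum (f := fun a => ∑ b, |M τ a b|)
      (fun a _ => by positivity) (Finset.mem_univ a))
    exact Finset.single_le_sum (f := fun b => |M τ a b|) (fun b _ => abs_nonneg _)
      (Finset.mem_univ j.2)

/-- The action of a matrix with bounded columns on absolutely summable sequences. -/
def act (X : BlockMatrix n m) (x : SeqSpace m) : SeqSpace n := ∑' j, x j • colS X j

theorem hasSum_act {X : BlockMatrix n m} (hX : HasBoundedColumns X) {x : SeqSpace m}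
    (hx : Summable fun j => ‖x j‖) : HasSum (fun j => x j • colS X j) (act X x) := by
  obtain ⟨C, hC0, hC⟩ := hX.exists_norm_le
  refine Summable.hasSum (Summable.of_norm_bounded (hx.mul_right C) fun j => ?_)
  rw [norm_smul]
  gcongr
  exact hC j

theorem norm_act_le {X : BlockMatrix n m} {C : ℝ} (hC : ∀ j, ‖colS X j‖ ≤ C) {x : SeqSpace m}
    (hx : Summable fun j => ‖x j‖) : ‖act X x‖ ≤ (∑' j, ‖x j‖) * C := by
  have h1 : ∀ j, ‖x j • colS X j‖ ≤ ‖x j‖ * C := fun j => by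
    rw [norm_smul]; gcongr; exact hC j
  rw [← tsum_mul_right]
  exact tsum_of_norm_bounded (hx.mul_right C).hasSum h1

theorem act_sub {X : BlockMatrix n m} (hX : HasBoundedColumns X) {x y : SeqSpace m}
    (hx : Summable fun j => ‖x j‖) (hy : Summable fun j => ‖y j‖) :
    act X (x - y) = act X x - act X y := by
  have h := (hasSum_act hX hx).sub (hasSum_act hX hy)
  refine (h.unique ?_).symm
  have h2 : Summable fun j => ‖(x - y) j‖ := by
    refine Summable.of_nonneg_of_le (fun j => norm_nonneg _) (fun j => ?_) (hx.add hy)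
    rw [lp.coeFn_sub]
    exact norm_sub_le _ _
  refine (hasSum_act hX h2).congr_fun fun j => ?_
  rw [lp.coeFn_sub, Pi.sub_apply, sub_smul]

theorem act_sub_matrix {X Y : BlockMatrix n m} (hX : HasBoundedColumns X)
    (hY : HasBoundedColumns Y) {x : SeqSpace m} (hx : Summable fun j => ‖x j‖) :
    act (X - Y) x = act X x - act Y x := by
  have h := (hasSum_act hX hx).sub (hasSum_act hY hx)
  refine (h.unique ?_).symm
  refine (hasSum_act (hX.sub hY).1 hx).congr_fun fun j => ?_
  rw [(hX.sub hY).2, smul_sub]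

theorem summable_norm_bas (j : ℤ × Fin n) : Summable fun i => ‖(bas j : SeqSpace n) i‖ := by
  refine summable_of_ne_finset_zero (s := {j}) fun i hi => ?_
  rw [lp.single_apply, Pi.single_eq_of_ne (by simpa using hi), norm_zero]

theorem act_bas {X : BlockMatrix n m} (hX : HasBoundedColumns X) (j : ℤ × Fin m) :
    act X (bas j) = colS X j := by
  refine (hasSum_act hX (summable_norm_bas j)).unique ?_
  have := hasSum_single (f := fun i => (bas j : SeqSpace m) i • colS X i) j (fun i hi => by
    rw [lp.single_apply, Pi.single_eq_of_ne hi, zero_smul])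
  simpa using this

theorem hasSum_apply_seq {f : ℤ × Fin m → SeqSpace n} {v : SeqSpace n} (h : HasSum f v)
    (i : ℤ × Fin n) : HasSum (fun j => f j i) (v i) := by
  have := (innerSL ℂ (bas i : SeqSpace n)).hasSum h
  simpa only [innerSL_apply_apply, inner_bas_left] using this

theorem act_apply {X : BlockMatrix n m} (hX : HasBoundedColumns X) {x : SeqSpace m}
    (hx : Summable fun j => ‖x j‖) (i : ℤ × Fin n) :
    HasSum (fun j => X i j * x j) (act X x i) := by
  refine (hasSum_apply_seq (hasSum_act hX hx) i).congr_fun fun j => ?_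
  rw [lp.coeFn_smul, Pi.smul_apply, colS_apply hX.colMem, smul_eq_mul, mul_comm]

theorem inner_seq_tsum (v w : SeqSpace n) : ⟪v, w⟫_ℂ = ∑' i, conj (v i) * w i := by
  rw [lp.inner_eq_tsum]
  simp only [RCLike.inner_apply']

/-- An absolutely summable sequence lies in the domain of `X`, because a matrix with bounded columns
sends it into $\ell^2$. -/
theorem IsHermitianPosDef.re_inner_act_nonneg {X : BlockMatrix n n} (hX : HasBoundedColumns X)
    (hp : IsHermitianPosDef X) {x : SeqSpace n} (hx : Summable fun j => ‖x j‖) :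
    0 ≤ (⟪x, act X x⟫_ℂ).re := by
  by_cases h0 : x = 0
  · simp [h0]
  have h1 : mulSeq X x = act X x := funext fun i => (act_apply hX hx i).tsum_eq
  have := hp.2 x h0 (fun i => (act_apply hX hx i).summable) (by rw [h1]; exact lp.memℓp _)
  rw [h1] at this
  rw [inner_seq_tsum]
  exact this.le

/-- The rows of a Hermitian matrix are the conjugates of its columns, so the product is defined
entrywise by inner products in $\ell^2$, without any boundedness. -/
theorem mmul_eq_inner {X : BlockMatrix n n} (hX : X.IsHermitian) (hXc : ColMem X)
    {Y : BlockMatrix n m} (hY : ColMem Y) (i : ℤ × Fin n) (j : ℤ × Fin m) :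
    mmul X Y i j = ⟪colS X i, colS Y j⟫_ℂ := by
  rw [mmul, inner_seq_tsum]
  refine tsum_congr fun k => ?_
  rw [colS_apply hXc, colS_apply hY, ← hX.apply]
  rfl

theorem mmul_conjTranspose_eq_inner {X : BlockMatrix n m} (hX : ColMem X) {Y : BlockMatrix n l}
    (hY : ColMem Y) (i : ℤ × Fin m) (j : ℤ × Fin l) :
    mmul X.conjTranspose Y i j = ⟪colS X i, colS Y j⟫_ℂ := by
  rw [mmul, inner_seq_tsum]
  refine tsum_congr fun k => ?_
  rw [colS_apply hX, colS_apply hY]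
  rfl

/-- A bounded operator may be applied termwise to the expansion of a column in the canonical basis.
-/
theorem colS_mmul_opMatrix (L : SeqSpace m →L[ℂ] SeqSpace n) {X : BlockMatrix m l}
    (hX : ColMem X) : ColMem (mmul (opMatrix L) X) ∧
      ∀ j, colS (mmul (opMatrix L) X) j = L (colS X j) := by
  refine colMem_of_colS_eq fun i j => ?_
  have h1 := hasSum_apply_seq (L.hasSum (hasSum_bas (colS X j))) i
  rw [← h1.tsum_eq, mmul]
  refine tsum_congr fun k => ?_
  rw [map_smul, lp.coeFn_smul, Pi.smul_apply, colS_apply hX, opMatrix_apply, smul_eq_mul, mul_comm]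

/-- The eigenvalue `jωk` of `𝒩`. -/
def freq (T : ℝ) (i : ℤ × Fin n) : ℂ := Complex.I * ((2 * Real.pi / T : ℝ) : ℂ) * (i.1 : ℂ)

theorem colS_sub_harmonicN {X : BlockMatrix n n} (hX : ColMem X) :
    ColMem (X - harmonicN n T) ∧
      ∀ j, colS (X - harmonicN n T) j = colS X j - freq T j • bas j := by
  refine colMem_of_colS_eq fun i j => ?_
  rw [lp.coeFn_sub, Pi.sub_apply, colS_apply hX, lp.coeFn_smul, Pi.smul_apply, lp.single_apply]
  change _ = X i j - harmonicN n T i j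
  rw [harmonicN, Matrix.diagonal_apply, Pi.single_apply]
  by_cases h : i = j
  · subst h; simp [freq]
  · simp [h]

/-- The harmonic Riccati equation in terms of columns. -/
theorem harmonic_equation_iff {X : BlockMatrix n n} (hX : X.IsHermitian) (hXc : ColMem X)
    {A : BlockMatrix n n} (hA : ColMem A) (LB : SeqSpace m →L[ℂ] SeqSpace n)
    (LR : SeqSpace m →L[ℂ] SeqSpace m) (LBt : SeqSpace n →L[ℂ] SeqSpace m)
    (LQ : SeqSpace n →L[ℂ] SeqSpace n) {B : BlockMatrix n m} (hB : B = opMatrix LB)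
    (hBt : B.conjTranspose = opMatrix LBt) :
    mmul X (A - harmonicN n T) + mmul (A - harmonicN n T).conjTranspose X
      - mmul X (mmul B (mmul (opMatrix LR) (mmul B.conjTranspose X))) + opMatrix LQ = 0 ↔
    ∀ i j, ⟪colS X i, colS A j - freq T j • bas j⟫_ℂ + ⟪colS A i - freq T i • bas i, colS X j⟫_ℂ
      - ⟪colS X i, LB (LR (LBt (colS X j)))⟫_ℂ + ⟪bas i, LQ (bas j)⟫_ℂ = 0 := by
  have hN := colS_sub_harmonicN (T := T) hA
  have h1 := colS_mmul_opMatrix LBt hXc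
  have h2 := colS_mmul_opMatrix LR h1.1
  have h3 := colS_mmul_opMatrix LB h2.1
  have key : ∀ i j, (mmul X (A - harmonicN n T) + mmul (A - harmonicN n T).conjTranspose X
      - mmul X (mmul B (mmul (opMatrix LR) (mmul B.conjTranspose X))) + opMatrix LQ) i j
      = ⟪colS X i, colS A j - freq T j • bas j⟫_ℂ + ⟪colS A i - freq T i • bas i, colS X j⟫_ℂ
      - ⟪colS X i, LB (LR (LBt (colS X j)))⟫_ℂ + ⟪bas i, LQ (bas j)⟫_ℂ := by
    intro i j
    rw [hBt, hB, Matrix.add_apply, Matrix.sub_apply, Matrix.add_apply,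
      mmul_eq_inner hX hXc hN.1, mmul_conjTranspose_eq_inner hN.1 hXc, mmul_eq_inner hX hXc h3.1,
      hN.2, hN.2, h3.2, h2.2, h1.2, opMatrix_apply, inner_bas_left]
  constructor
  · intro h i j
    rw [← key, h]; rfl
  · intro h
    ext i j
    rw [key, h]; rfl

/-- A sesquilinear identity between families extends to sums. -/
theorem sesquilinear_extend {ι H : Type*} [NormedAddCommGroup H] [InnerProductSpace ℂ H]
    {p q g e r : ι → H} (h : ∀ i j, ⟪p i, q j⟫_ℂ + ⟪q i, p j⟫_ℂ - ⟪p i, g j⟫_ℂ + ⟪e i, r j⟫_ℂ = 0)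
    {x y : ι → ℂ} {px qx ex py qy gy ry : H} (hpx : HasSum (fun i => x i • p i) px)
    (hqx : HasSum (fun i => x i • q i) qx) (hex : HasSum (fun i => x i • e i) ex)
    (hpy : HasSum (fun i => y i • p i) py) (hqy : HasSum (fun i => y i • q i) qy)
    (hgy : HasSum (fun i => y i • g i) gy) (hry : HasSum (fun i => y i • r i) ry) :
    ⟪px, qy⟫_ℂ + ⟪qx, py⟫_ℂ - ⟪px, gy⟫_ℂ + ⟪ex, ry⟫_ℂ = 0 := by
  have hl : ∀ {f : ι → H} {s : H}, HasSum (fun i => x i • f i) s → ∀ w,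
      HasSum (fun i => conj (x i) * ⟪f i, w⟫_ℂ) ⟪s, w⟫_ℂ := by
    intro f s hs w
    have h1 := ((innerSL ℂ w).hasSum hs).star
    simpa only [innerSL_apply_apply, inner_smul_right, star_mul', RCLike.star_def,
      inner_conj_symm] using h1
  have hr : ∀ {f : ι → H} {s : H}, HasSum (fun i => y i • f i) s → ∀ w,
      HasSum (fun i => y i * ⟪w, f i⟫_ℂ) ⟪w, s⟫_ℂ := by
    intro f s hs w
    have h1 := (innerSL ℂ w).hasSum hs
    simpa only [innerSL_apply_apply, inner_smul_right] using h1
  have h1 : ∀ j, ⟪px, q j⟫_ℂ + ⟪qx, p j⟫_ℂ - ⟪px, g j⟫_ℂ + ⟪ex, r j⟫_ℂ = 0 := by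
    intro j
    refine ((((hl hpx (q j)).add (hl hqx (p j))).sub (hl hpx (g j))).add (hl hex (r j))).unique ?_
    convert hasSum_zero using 2 with i
    rw [← mul_add, ← mul_sub, ← mul_add, h, mul_zero]
  refine ((((hr hqy px).add (hr hpy qx)).sub (hr hgy px)).add (hr hry ex)).unique ?_
  convert hasSum_zero using 2 with j
  rw [← mul_add, ← mul_sub, ← mul_add, h1, mul_zero]

theorem inner_act_comm {X : BlockMatrix n n} (hX : HasBoundedColumns X) (hH : X.IsHermitian)
    {x y : SeqSpace n} (hx : Summable fun j => ‖x j‖) (hy : Summable fun j => ‖y j‖) :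
    ⟪act X x, y⟫_ℂ = ⟪x, act X y⟫_ℂ := by
  -- With `q = 0` the four-term identity reduces to the symmetry of the entries of `X`.
  have h := sesquilinear_extend (p := fun i => colS X i) (q := fun _ => 0)
    (g := fun i => (bas i : SeqSpace n)) (e := fun i => (bas i : SeqSpace n))
    (r := fun i => colS X i) (x := x) (y := y) (qx := 0) (qy := 0) (fun i j => by
      rw [inner_bas_left, inner_bas_right, colS_apply hX.colMem, colS_apply hX.colMem]
      have := hH.apply i j
      rw [← this]
      simp) (hasSum_act hX hx) (by simp only [smul_zero]; exact hasSum_zero) (hasSum_bas x) (hasSum_act hX hy)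
      (by simp only [smul_zero]; exact hasSum_zero) (hasSum_bas y) (hasSum_act hX hy)
  simp only [inner_zero_right, inner_zero_left, zero_add, zero_sub] at h
  linear_combination -h

end Columns

end HarmonicRiccati

end

noncomputable section

set_option linter.unusedSectionVars false

namespace HarmonicRiccati

open MeasureTheory Set Filter Topology

open scoped ComplexConjugate InnerProductSpace

/-! ### Periodic functions with square integrable derivative -/

section Sobolev

variable {T : ℝ} {n m l : ℕ}

/-- `u` is `T`-periodic and a primitive of the locally square integrable function `du`. -/
structure IsH1 (T : ℝ) (u du : ℝ → Fin n → ℂ) : Prop where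
  prim : ∀ a, IsPrimitive (fun t => u t a) (fun t => du t a)
  periodic : Function.Periodic u T
  deriv_sqInt : VecSqInt T du

namespace IsH1

variable {u du v dv : ℝ → Fin n → ℂ}

theorem continuous (h : IsH1 T u du) : Continuous u :=
  continuous_pi fun a => (h.prim a).continuous

theorem sqInt (h : IsH1 T u du) : VecSqInt T u := vecSqInt_of_continuous h.continuous

theorem toSeq_deriv (hT : 0 < T) (hu : IsH1 T u du) (i : ℤ × Fin n) :
    toSeq T du i = freq T i * toSeq T u i := by
  rw [toSeq_apply hT hu.deriv_sqInt, toSeq_apply hT hu.sqInt]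
  refine coef_deriv (hu.prim i.2) ?_ i.1
  have := hu.periodic 0
  rw [zero_add] at this
  simp only [this]

end IsH1

theorem isH1_expv (j : ℤ × Fin n) : IsH1 T (expv T j) (fun t => freq T j • expv T j t) := by
  refine ⟨fun a => ?_, fun t => ?_, ?_⟩
  · by_cases h : a = j.2
    · subst h
      simp only [expv, Pi.smul_apply, Pi.single_eq_same, smul_eq_mul]
      exact IsPrimitive.of_hasDerivAt (hasDerivAt_char j.1)
        (continuous_const.mul (continuous_char _))
    · simp only [expv, Pi.smul_apply, Pi.single_eq_of_ne h, smul_zero]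
      exact IsPrimitive.const 0
  · simp only [expv, char_periodic j.1 t]
  · exact (vecSqInt_of_continuous (continuous_expv j)).smul _

/-- Cauchy–Schwarz against a square summable weight. This is what allows a matrix with bounded
columns, possibly unbounded on $\ell^2$, to act on the coefficients of a periodic function with
square integrable derivative. -/
theorem exists_l1_bound (hT : 0 < T) (n : ℕ) : ∃ C, 0 ≤ C ∧ ∀ u du : ℝ → Fin n → ℂ, IsH1 T u du →
    (Summable fun i => ‖toSeq T u i‖) ∧
      ∑' i, ‖toSeq T u i‖ ≤ C * (‖toSeq T u‖ + ‖toSeq T du‖) := by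
  -- The weight is the inverse of the modulus of the frequency, replaced by $1$ at frequency zero,
  -- where the derivative carries no information.
  set w : ℤ × Fin n → ℝ := fun i => if i.1 = 0 then 1 else (2 * Real.pi / T * |(i.1 : ℝ)|)⁻¹ with hw
  have hω : 0 < 2 * Real.pi / T := by positivity
  have hw0 : ∀ i, 0 ≤ w i := fun i => by
    simp only [hw]; split_ifs <;> positivity
  have hws : Summable fun i => w i ^ (2 : ℝ) := by
    refine summable_prod_fin (fun i => Real.rpow_nonneg (hw0 i) _) fun a => ?_
    have h1 : Summable fun k : ℤ => ((2 * Real.pi / T) ^ 2)⁻¹ * (1 / (k : ℝ) ^ 2) :=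
      (Real.summable_one_div_int_pow.mpr one_lt_two).mul_left _
    have h2 : Summable fun k : ℤ => if k = 0 then (1 : ℝ) else 0 :=
      summable_of_ne_finset_zero (s := {0}) fun k hk => by simpa using hk
    refine Summable.of_nonneg_of_le (fun k => Real.rpow_nonneg (hw0 _) _) (fun k => ?_)
      (h1.add h2)
    simp only [hw]
    by_cases hk : k = 0
    · simp [hk]
    · rw [if_neg hk, if_neg hk]
      rw [Real.rpow_two, inv_pow, mul_pow, sq_abs, mul_inv]
      simp
  set W : ℝ := (∑' i, w i ^ (2 : ℝ)) ^ (1 / (2 : ℝ)) with hW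
  have key : ∀ v : SeqSpace n, (Summable fun i => w i * ‖v i‖) ∧
      ∑' i, w i * ‖v i‖ ≤ W * ‖v‖ := by
    intro v
    have h1 := Real.summable_and_inner_le_Lp_mul_Lq_tsum_of_nonneg
      (Real.HolderConjugate.two_two) (f := w) (g := fun i => ‖v i‖) hw0
      (fun i => norm_nonneg _) hws (by simpa using summable_seq_sq v)
    refine ⟨h1.1, h1.2.trans_eq ?_⟩
    rw [lp.norm_eq_tsum_rpow (p := 2) (by norm_num) v]
    norm_num [hW]
  refine ⟨W, Real.rpow_nonneg (tsum_nonneg fun i => Real.rpow_nonneg (hw0 i) _) _,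
    fun u du hu => ?_⟩
  have hle : ∀ i, ‖toSeq T u i‖ ≤ w i * ‖toSeq T u i‖ + w i * ‖toSeq T du i‖ := by
    intro i
    by_cases hi : i.1 = 0
    · have : w i = 1 := by simp [hw, hi]
      rw [this, one_mul, one_mul]
      linarith [norm_nonneg (toSeq T du i)]
    · have h1 : w i = (2 * Real.pi / T * |(i.1 : ℝ)|)⁻¹ := by simp [hw, hi]
      have h2 : ‖freq T i‖ = 2 * Real.pi / T * |(i.1 : ℝ)| := by
        rw [freq, norm_mul, norm_mul, Complex.norm_I, one_mul, Complex.norm_real, Real.norm_eq_abs,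
          abs_of_pos hω, Complex.norm_intCast]
      have h3 : 0 < |(i.1 : ℝ)| := abs_pos.mpr (by exact_mod_cast hi)
      rw [hu.toSeq_deriv hT, norm_mul, h2]
      have h4 : w i * (2 * Real.pi / T * |(i.1 : ℝ)| * ‖toSeq T u i‖) = ‖toSeq T u i‖ := by
        rw [h1, ← mul_assoc, inv_mul_cancel₀ (by positivity), one_mul]
      rw [h4]
      linarith [mul_nonneg (hw0 i) (norm_nonneg (toSeq T u i))]
  have k1 := key (toSeq T u)
  have k2 := key (toSeq T du)
  have hs := Summable.of_nonneg_of_le (fun i => norm_nonneg _) hle (k1.1.add k2.1)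
  refine ⟨hs, ?_⟩
  calc _ ≤ ∑' i, (w i * ‖toSeq T u i‖ + w i * ‖toSeq T du i‖) := hs.tsum_le_tsum hle (k1.1.add k2.1)
    _ = (∑' i, w i * ‖toSeq T u i‖) + ∑' i, w i * ‖toSeq T du i‖ := k1.1.tsum_add k2.1
    _ ≤ W * ‖toSeq T u‖ + W * ‖toSeq T du‖ := add_le_add k1.2 k2.2
    _ = _ := by ring

theorem IsH1.summable (hT : 0 < T) {u du : ℝ → Fin n → ℂ} (hu : IsH1 T u du) :
    Summable fun i => ‖toSeq T u i‖ := by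
  obtain ⟨C, -, hC⟩ := exists_l1_bound hT n
  exact (hC u du hu).1

theorem HasBoundedColumns.exists_act_le (hT : 0 < T) {X : BlockMatrix n m}
    (hX : HasBoundedColumns X) : ∃ C, 0 ≤ C ∧ ∀ u du : ℝ → Fin m → ℂ, IsH1 T u du →
      ‖act X (toSeq T u)‖ ≤ C * (‖toSeq T u‖ + ‖toSeq T du‖) := by
  obtain ⟨C, hC0, hC⟩ := exists_l1_bound hT m
  obtain ⟨D, hD0, hD⟩ := hX.exists_norm_le
  refine ⟨C * D, by positivity, fun u du hu => ?_⟩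
  refine (norm_act_le hD (hC u du hu).1).trans ?_
  calc _ ≤ (C * (‖toSeq T u‖ + ‖toSeq T du‖)) * D := by gcongr; exact (hC u du hu).2
    _ = _ := by ring

/-- Parseval applied to `u` and `x` times the exponential of index `k`; since `x` is real,
conjugation reflects its coefficients and the sum becomes a convolution. -/
theorem hasSum_coef_ofReal_mul (hT : 0 < T) {x : ℝ → ℝ} {u : ℝ → ℂ}
    (hx : SqInt T fun τ => (x τ : ℂ)) (hu : SqInt T u) (k : ℤ) :
    HasSum (fun l => coef T (fun τ => (x τ : ℂ)) (k - l) * coef T u l)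
      (coef T (fun τ => (x τ : ℂ) * u τ) k) := by
  have hxk : SqInt T fun τ => (x τ : ℂ) * char T k τ := by
    refine (memLp_congr_norm hx.1 (hx.1.mul (continuous_char k).aestronglyMeasurable) ?_).mp hx
    exact Eventually.of_forall fun τ => by simp [norm_char]
  have h := hasSum_coef_mul hT hxk hu
  rw [coef_eq]
  convert h using 2 with l
  · rw [coef_mul_char, conj_coef_ofReal, neg_sub]
  · congr 1
    ext τ
    rw [map_mul, Complex.conj_ofReal, conj_char]; ring

/-- Identifies the column-wise action of the Toeplitz matrix with multiplication by an $L^2$ symbol,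
through the convolution formula in each component. -/
theorem toSeq_mulVec_apply (hT : 0 < T) {M : ℝ → Matrix (Fin n) (Fin m) ℝ}
    (hM : Function.Periodic M T) (hM2 : MemLpPeriod T 2 M) (t : ℝ) {u : ℝ → Fin m → ℂ}
    (hu : Continuous u) (hus : Summable fun j => ‖toSeq T u j‖) :
    act (toeplitz T M t) (toSeq T u) = toSeq T fun τ => (cx (M τ)).mulVec (u τ) := by
  have hu2 := vecSqInt_of_continuous (T := T) hu
  ext i
  refine (act_apply (colS_toeplitz hT hM hM2 t).1 hus i).unique ?_
  rw [toSeq_apply hT (VecMemLp.mulVec_continuous_sqInt hM2 hu)]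
  have h1 : coef T (fun τ => (cx (M τ)).mulVec (u τ) i.2) i.1
      = ∑ b, coef T (fun τ => (M τ i.2 b : ℂ) * u τ b) i.1 := by
    simp only [Matrix.mulVec, dotProduct, cx_apply]
    refine coef_sum hT _ (fun b _ => ?_) _
    exact MemLp.integrable_mul (p := 2) (q := 2) (MemLp.complex_ofReal (hM2.entry i.2 b)) (hu2 b)
  have hsum := (act_apply (colS_toeplitz hT hM hM2 t).1 hus i).summable
  have h2 : HasSum (fun j : Fin m × ℤ => toeplitz T M t i (j.2, j.1) * toSeq T u (j.2, j.1))
      (∑' j, toeplitz T M t i j * toSeq T u j) :=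
    (Equiv.prodComm (Fin m) ℤ).hasSum_iff (f := fun j => toeplitz T M t i j * toSeq T u j) |>.mpr
      hsum.hasSum
  have h3 := h2.prod_fiberwise (g := fun b => coef T (fun τ => (M τ i.2 b : ℂ) * u τ b) i.1)
    fun b => by
      have := hasSum_coef_ofReal_mul hT (x := fun τ => M τ i.2 b) (u := fun τ => u τ b)
        (MemLp.complex_ofReal (hM2.entry i.2 b)) (hu2 b) i.1
      simpa only [toeplitz_apply hM, toSeq_apply hT hu2] using this
  rw [h1, ← h3.unique (hasSum_fintype _)]
  exact hsum.hasSum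

theorem IsH1.act_toeplitz (hT : 0 < T) {M : ℝ → Matrix (Fin n) (Fin m) ℝ}
    (hM : Function.Periodic M T) (hM2 : MemLpPeriod T 2 M) (t : ℝ) {u du : ℝ → Fin m → ℂ}
    (hu : IsH1 T u du) :
    act (toeplitz T M t) (toSeq T u) = toSeq T fun τ => (cx (M τ)).mulVec (u τ) :=
  toSeq_mulVec_apply hT hM hM2 t hu.continuous (hu.summable hT)

/-- The Riccati form of a matrix satisfying the harmonic Riccati equation columnwise. -/
theorem harmonic_form (hT : 0 < T) {X : BlockMatrix n n} (hX : HasBoundedColumns X)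
    {A : ℝ → Matrix (Fin n) (Fin n) ℝ} (hA : Function.Periodic A T) (hA2 : MemLpPeriod T 2 A)
    (t : ℝ) {LG LQ : SeqSpace n →L[ℂ] SeqSpace n}
    (h : ∀ i j, ⟪colS X i, colS (toeplitz T A t) j - freq T j • bas j⟫_ℂ
      + ⟪colS (toeplitz T A t) i - freq T i • bas i, colS X j⟫_ℂ
      - ⟪colS X i, LG (colS X j)⟫_ℂ + ⟪bas i, LQ (bas j)⟫_ℂ = 0)
    {u du v dv : ℝ → Fin n → ℂ} (hu : IsH1 T u du) (hv : IsH1 T v dv) :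
    ⟪act X (toSeq T u), toSeq T (fun τ => (cx (A τ)).mulVec (v τ) - dv τ)⟫_ℂ
      + ⟪toSeq T (fun τ => (cx (A τ)).mulVec (u τ) - du τ), act X (toSeq T v)⟫_ℂ
      - ⟪act X (toSeq T u), LG (act X (toSeq T v))⟫_ℂ
      + ⟪toSeq T u, LQ (toSeq T v)⟫_ℂ = 0 := by
  have hAc := (colS_toeplitz hT hA hA2 t).1
  have hN : ∀ {u du : ℝ → Fin n → ℂ}, IsH1 T u du →
      HasSum (fun i => toSeq T u i • (colS (toeplitz T A t) i - freq T i • bas i))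
        (toSeq T fun τ => (cx (A τ)).mulVec (u τ) - du τ) := by
    intro u du hu
    rw [toSeq_sub hT (VecMemLp.mulVec_continuous_sqInt hA2 hu.continuous) hu.deriv_sqInt,
      ← hu.act_toeplitz hT hA hA2 t]
    refine ((hasSum_act hAc (hu.summable hT)).sub (hasSum_bas (toSeq T du))).congr_fun fun i => ?_
    rw [smul_sub, smul_smul, hu.toSeq_deriv hT, mul_comm]
  refine sesquilinear_extend h (hasSum_act hX (hu.summable hT)) (hN hu) (hasSum_bas _)
    (hasSum_act hX (hv.summable hT)) (hN hv) ?_ ?_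
  · refine (LG.hasSum (hasSum_act hX (hv.summable hT))).congr_fun fun i => ?_
    rw [map_smul]
  · refine (LQ.hasSum (hasSum_bas (toSeq T v))).congr_fun fun i => ?_
    rw [map_smul]

/-- Integration by parts for the form of a symmetric absolutely continuous matrix function. -/
theorem inner_add_inner_eq_integral (hT : 0 < T) {A Z dZ : ℝ → Matrix (Fin n) (Fin n) ℝ}
    (hA2 : MemLpPeriod T 2 A) (hZ : IsMatrixPrimitive Z dZ) (hZp : Function.Periodic Z T)
    (hZs : ∀ τ, (Z τ).transpose = Z τ) {u du v dv : ℝ → Fin n → ℂ} (hu : IsH1 T u du)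
    (hv : IsH1 T v dv) :
    ⟪toSeq T (fun τ => (cx (Z τ)).mulVec (u τ)),
        toSeq T (fun τ => (cx (A τ)).mulVec (v τ) - dv τ)⟫_ℂ
      + ⟪toSeq T (fun τ => (cx (A τ)).mulVec (u τ) - du τ),
        toSeq T (fun τ => (cx (Z τ)).mulVec (v τ))⟫_ℂ
      = (1 / (T : ℂ)) * ∫ τ in (0 : ℝ)..T, star (u τ) ⬝ᵥ
        (cx (dZ τ + (A τ).transpose * Z τ + Z τ * A τ)).mulVec (v τ) := by
  have hZ2 : MemLpPeriod T ⊤ Z := memLpPeriod_of_continuous hZ.continuous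
  have hAu := (VecMemLp.mulVec_continuous_sqInt hA2 hu.continuous).sub hu.deriv_sqInt
  have hAv := (VecMemLp.mulVec_continuous_sqInt hA2 hv.continuous).sub hv.deriv_sqInt
  have hZu := VecMemLp.mulVec_sqInt hZ2 hu.sqInt
  have hZv := VecMemLp.mulVec_sqInt hZ2 hv.sqInt
  rw [inner_toSeq hT hZu hAv, inner_toSeq hT hAu hZv, ← mul_add]
  congr 1
  have hint : ∀ {f g : ℝ → Fin n → ℂ}, VecSqInt T f → VecSqInt T g →
      IntervalIntegrable (fun τ => star (f τ) ⬝ᵥ g τ) volume 0 T := fun hf hg => by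
    rw [intervalIntegrable_iff_integrableOn_Ioc_of_le hT.le]
    exact integrable_finsetSum _ fun a _ => integrable_conj_mul (hf a) (hg a)
  -- The scalar $u^*Zv$ is periodic, so its derivative has zero integral. Adding this zero cancels
  -- the terms in `du` and `dv` and produces the one in `dZ`.
  have hw : IsPrimitive (fun τ => star (u τ) ⬝ᵥ (cx (Z τ)).mulVec (v τ))
      (fun τ => star (du τ) ⬝ᵥ (cx (Z τ)).mulVec (v τ) + star (u τ) ⬝ᵥ
        ((cx (dZ τ)).mulVec (v τ) + (cx (Z τ)).mulVec (dv τ))) := by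
    have h1 : IsPrimitive (fun τ => ∑ a, conj (u τ a) * ∑ b, (Z τ a b : ℂ) * v τ b)
        (fun τ => ∑ a, (conj (du τ a) * (∑ b, (Z τ a b : ℂ) * v τ b) + conj (u τ a) *
          ∑ b, ((dZ τ a b : ℂ) * v τ b + (Z τ a b : ℂ) * dv τ b))) :=
      IsPrimitive.sum _ fun a => ((hu.prim a).clm Complex.conjCLE.toContinuousLinearMap).mul
        (IsPrimitive.sum _ fun b => ((hZ a b).clm Complex.ofRealCLM).mul (hv.prim b))
    refine h1.congr_ae (Eventually.of_forall fun τ => ?_)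
    simp only [Finset.sum_add_distrib]
    rw [dotProduct_add]
    simp only [dotProduct, Matrix.mulVec, Pi.star_apply, Complex.star_def, cx_apply, mul_add,
      Finset.sum_add_distrib]
  have hw0 : ∫ τ in (0 : ℝ)..T, (star (du τ) ⬝ᵥ (cx (Z τ)).mulVec (v τ) + star (u τ) ⬝ᵥ
        ((cx (dZ τ)).mulVec (v τ) + (cx (Z τ)).mulVec (dv τ))) = 0 := by
    rw [← hw.sub_eq 0 T]
    have h1 := hu.periodic 0
    have h2 := hv.periodic 0
    have h3 := hZp 0
    rw [zero_add] at h1 h2 h3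
    rw [h1, h2, h3, sub_self]
  rw [← intervalIntegral.integral_add (hint hZu hAv) (hint hAu hZv), ← add_zero
    (∫ τ in (0 : ℝ)..T, (star ((cx (Z τ)).mulVec (u τ)) ⬝ᵥ ((cx (A τ)).mulVec (v τ) - dv τ)
      + star ((cx (A τ)).mulVec (u τ) - du τ) ⬝ᵥ (cx (Z τ)).mulVec (v τ))), ← hw0,
    ← intervalIntegral.integral_add ((hint hZu hAv).add (hint hAu hZv))
      (hw.intervalIntegrable 0 T)]
  congr 1
  ext τ
  simp only [cx_add, Matrix.add_mulVec, cx_mul_mulVec, dotProduct_add, star_sub, sub_dotProduct,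
    dotProduct_sub, star_cx_mulVec_dotProduct, hZs τ]
  ring

end Sobolev

end HarmonicRiccati

end

noncomputable section

set_option linter.unusedSectionVars false

namespace HarmonicRiccati

open MeasureTheory Set Filter Topology

open scoped ComplexConjugate InnerProductSpace

/-! ### A sign lemma for Lyapunov inequalities along a stable periodic flow -/

section Lyapunov

variable {T : ℝ} {n : ℕ}

/-- `f` is continuously differentiable and `M f(t + T) = f(t)`. -/
structure IsTwisted (T : ℝ) (M : Matrix (Fin n) (Fin n) ℝ) (f f' : ℝ → Fin n → ℂ) : Prop where
  deriv : ∀ t, HasDerivAt f (f' t) t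
  cont : Continuous f'
  twist : ∀ t, (cx M).mulVec (f (t + T)) = f t

namespace IsTwisted

variable {M : Matrix (Fin n) (Fin n) ℝ} {f f' g g' : ℝ → Fin n → ℂ}

theorem continuous (hf : IsTwisted T M f f') : Continuous f :=
  continuous_iff_continuousAt.mpr fun t => (hf.deriv t).continuousAt

theorem twist_deriv (hf : IsTwisted T M f f') (t : ℝ) : (cx M).mulVec (f' (t + T)) = f' t := by
  have h1 : HasDerivAt (fun t => (cx M).mulVec (f (t + T))) ((cx M).mulVec (f' (t + T))) t :=
    (((Matrix.mulVecLin (cx M)).restrictScalars ℝ).toContinuousLinearMap.hasFDerivAt).comp_hasDerivAt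
      t ((hf.deriv (t + T)).comp_add_const t T)
  rw [funext hf.twist] at h1
  exact h1.unique (hf.deriv t)

theorem shift (hf : IsTwisted T M f f') (τ : ℝ) :
    IsTwisted T M (fun t => f (t - τ)) (fun t => f' (t - τ)) := by
  refine ⟨fun t => (hf.deriv (t - τ)).comp_sub_const t τ, by have := hf.cont; fun_prop,
    fun t => ?_⟩
  rw [← hf.twist (t - τ)]
  congr 2; ring

theorem add (hf : IsTwisted T M f f') (hg : IsTwisted T M g g') :
    IsTwisted T M (fun t => f t + g t) (fun t => f' t + g' t) :=
  ⟨fun t => (hf.deriv t).add (hg.deriv t), hf.cont.add hg.cont, fun t => by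
    rw [Matrix.mulVec_add, hf.twist, hg.twist]⟩

theorem smul (hf : IsTwisted T M f f') (c : ℂ) :
    IsTwisted T M (fun t => c • f t) (fun t => c • f' t) :=
  ⟨fun t => (hf.deriv t).const_smul c, hf.cont.const_smul c, fun t => by
    rw [Matrix.mulVec_smul, hf.twist]⟩

theorem sub (hf : IsTwisted T M f f') (hg : IsTwisted T M g g') :
    IsTwisted T M (fun t => f t - g t) (fun t => f' t - g' t) :=
  ⟨fun t => (hf.deriv t).sub (hg.deriv t), hf.cont.sub hg.cont, fun t => by
    rw [Matrix.mulVec_sub, hf.twist, hg.twist]⟩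

theorem apply_sub_nat_mul (hM : ∀ t, (cx M).mulVec (f (t + T)) = f t) (j : ℕ) (t : ℝ) :
    f (t - j * T) = (cx (M ^ j)).mulVec (f t) := by
  induction j generalizing t with
  | zero => simp [cx_one]
  | succ j ih =>
    rw [pow_succ, cx_mul_mulVec, ← sub_add_cancel t T, hM (t - T), ← ih (t - T)]
    congr 1; push_cast; ring

end IsTwisted

variable {F Φ Ψ : ℝ → Matrix (Fin n) (Fin n) ℝ} {f f' : ℝ → Fin n → ℂ}

/-- The twist of `f` compensates the monodromy factor in `Φ (t + T)`, which makes the product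
periodic. -/
theorem IsFundamental.isH1 (hΦ : IsFundamental F Φ Ψ) (hF : Function.Periodic F T)
    (hF2 : MemLpPeriod T 2 F) (hf : IsTwisted T (Φ T) f f') :
    IsH1 T (fun t => (cx (Φ t)).mulVec (f t))
      (fun t => (cx (F t * Φ t)).mulVec (f t) + (cx (Φ t)).mulVec (f' t)) := by
  have hΦc := hΦ.prim.continuous
  refine ⟨fun a => ?_, fun t => ?_, ?_⟩
  · have hfp : ∀ b, IsPrimitive (fun t => f t b) (fun t => f' t b) := fun b =>
      IsPrimitive.of_hasDerivAt (fun t => hasDerivAt_pi.mp (hf.deriv t) b)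
        ((continuous_apply b).comp hf.cont)
    have h1 := IsPrimitive.sum Finset.univ fun b =>
      ((hΦ.prim a b).clm Complex.ofRealCLM).mul (hfp b)
    refine h1.congr_ae (Eventually.of_forall fun t => ?_)
    simp [Matrix.mulVec, dotProduct, cx_apply, Finset.sum_add_distrib]
  · rw [hΦ.add_period hF, cx_mul_mulVec, hf.twist]
  · exact (VecMemLp.mulVec_continuous_sqInt (MemLpPeriod.mul (r := 2) hF2
      (memLpPeriod_of_continuous (p := ⊤) hΦc)) hf.continuous).add
      (VecMemLp.mulVec_continuous_sqInt (memLpPeriod_of_continuous hΦc) hf.cont)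

theorem norm_cx_mulVec_apply_le (N : Matrix (Fin n) (Fin n) ℝ) {z : Fin n → ℂ} {ε : ℝ}
    (hε : 0 ≤ ε) (hz : ‖z‖ ≤ ε) (a : Fin n) :
    ‖(cx N).mulVec z a‖ ≤ ε * ∑ a, ∑ b, |N a b| := by
  have h1 : ‖(cx N).mulVec z a‖ ≤ ∑ b, |N a b| * ε := by
    rw [Matrix.mulVec, dotProduct]
    refine (norm_sum_le _ _).trans (Finset.sum_le_sum fun b _ => ?_)
    rw [norm_mul, cx_apply, Complex.norm_real, Real.norm_eq_abs]
    exact mul_le_mul_of_nonneg_left ((norm_le_pi_norm _ b).trans hz) (abs_nonneg _)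
  refine h1.trans ?_
  rw [← Finset.sum_mul, mul_comm]
  exact mul_le_mul_of_nonneg_left (Finset.single_le_sum (f := fun a => ∑ b, |N a b|)
    (fun a _ => Finset.sum_nonneg fun b _ => abs_nonneg _) (Finset.mem_univ a)) hε

theorem exists_norm_toSeq_mulVec_le (hT : 0 < T) {N : ℝ → Matrix (Fin n) (Fin n) ℝ}
    (hN : MemLpPeriod T 2 N) : ∃ C, 0 ≤ C ∧ ∀ g : ℝ → Fin n → ℂ, Continuous g → ∀ ε, 0 ≤ ε →
      (∀ t ∈ Icc 0 T, ‖g t‖ ≤ ε) → ‖toSeq T (fun t => (cx (N t)).mulVec (g t))‖ ≤ C * ε := by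
  refine ⟨Real.sqrt ((1 / T) * (n * ∫ τ in (0 : ℝ)..T, (∑ a, ∑ b, |N τ a b|) ^ 2)),
    Real.sqrt_nonneg _, fun g hg ε hε h => ?_⟩
  rw [mul_comm]
  refine norm_toSeq_le hT (VecMemLp.mulVec_continuous_sqInt hN hg) hε ?_ fun τ hτ a => ?_
  · exact memLp_finsetSum _ fun a _ => memLp_finsetSum _ fun b _ => (hN.entry a b).abs
  · exact norm_cx_mulVec_apply_le _ hε (h τ (Ioc_subset_Icc_self hτ)) a

/-- As `K` may be unbounded, controlling its image requires the derivative of the argument as well,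
hence sup bounds on both `f` and `f'`. -/
theorem IsFundamental.exists_norm_le (hT : 0 < T) (hΦ : IsFundamental F Φ Ψ)
    (hF : Function.Periodic F T) (hF2 : MemLpPeriod T 2 F) {K : BlockMatrix n n}
    (hK : HasBoundedColumns K) : ∃ C, 0 ≤ C ∧ ∀ f f' : ℝ → Fin n → ℂ, IsTwisted T (Φ T) f f' →
      ∀ ε, 0 ≤ ε → (∀ t ∈ Icc 0 T, ‖f t‖ ≤ ε) → (∀ t ∈ Icc 0 T, ‖f' t‖ ≤ ε) →
      ‖toSeq T (fun t => (cx (Φ t)).mulVec (f t))‖ ≤ C * ε ∧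
      ‖act K (toSeq T (fun t => (cx (Φ t)).mulVec (f t)))‖ ≤ C * ε := by
  have hΦc := hΦ.prim.continuous
  have hFΦ : MemLpPeriod T 2 fun t => F t * Φ t := MemLpPeriod.mul (r := 2) hF2
      (memLpPeriod_of_continuous (p := ⊤) hΦc)
  have hΦ2 : MemLpPeriod T 2 Φ := memLpPeriod_of_continuous hΦc
  obtain ⟨C, hC0, hC⟩ := exists_norm_toSeq_mulVec_le hT hΦ2
  obtain ⟨D, hD0, hD⟩ := exists_norm_toSeq_mulVec_le hT hFΦ
  obtain ⟨E, hE0, hE⟩ := hK.exists_act_le hT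
  refine ⟨C + E * (C + (D + C)), by positivity, fun f f' hf ε hε h h' => ?_⟩
  have h1 := hC f hf.continuous ε hε h
  have h2 := hC f' hf.cont ε hε h'
  have h3 := hD f hf.continuous ε hε h
  have h4 := hE _ _ (hΦ.isH1 hF hF2 hf)
  rw [toSeq_add hT (VecMemLp.mulVec_continuous_sqInt hFΦ hf.continuous)
    (VecMemLp.mulVec_continuous_sqInt hΦ2 hf.cont)] at h4
  have h5 := norm_add_le (toSeq T fun t => (cx (F t * Φ t)).mulVec (f t))
    (toSeq T fun t => (cx (Φ t)).mulVec (f' t))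
  constructor
  · refine h1.trans ?_
    gcongr
    exact le_add_of_nonneg_right (by positivity)
  · refine h4.trans ?_
    calc _ ≤ E * (C * ε + (D * ε + C * ε)) := by gcongr; exact h5.trans (add_le_add h3 h2)
      _ ≤ _ := by nlinarith [mul_nonneg hC0 hε]

theorem eventually_norm_shift_sub_lt {g : ℝ → Fin n → ℂ} (hg : Continuous g) (τ : ℝ) {ε : ℝ}
    (hε : 0 < ε) : ∀ᶠ s in 𝓝 τ, ∀ t ∈ Icc 0 T, ‖g (t - s) - g (t - τ)‖ < ε := by
  refine isCompact_Icc.eventually_forall_of_forall_eventually fun t _ => ?_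
  have hc : ContinuousAt (fun z : ℝ × ℝ => ‖g (z.2 - z.1) - g (z.2 - τ)‖) (τ, t) := by fun_prop
  exact hc.eventually_lt_const (by simpa using hε)

/-- The mean value inequality applied to $r\mapsto f(t-r)+rf'(t-\tau)$, whose derivative is small
uniformly in $t\in[0,T]$ by compactness. -/
theorem eventually_norm_quotient_lt (hd : ∀ t, HasDerivAt f (f' t) t) (hc : Continuous f')
    (τ : ℝ) {ε : ℝ} (hε : 0 < ε) :
    ∀ᶠ s in 𝓝 τ, ∀ t ∈ Icc 0 T, ‖f (t - s) - f (t - τ) + (s - τ) • f' (t - τ)‖ ≤ ε * |s - τ| := by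
  obtain ⟨δ, hδ, h⟩ := Metric.eventually_nhds_iff_ball.mp
    (eventually_norm_shift_sub_lt (T := T) hc τ hε)
  filter_upwards [Metric.ball_mem_nhds τ hδ] with s hs t ht
  have := (convex_ball τ δ).norm_image_sub_le_of_norm_hasDerivWithin_le
    (f := fun r => f (t - r) + r • f' (t - τ)) (f' := fun r => -f' (t - r) + f' (t - τ))
    (C := ε) (x := τ) (y := s) (fun r _ => ?_) (fun r hr => ?_) (Metric.mem_ball_self hδ) hs
  · rw [Real.norm_eq_abs] at this
    refine le_trans (le_of_eq ?_) this
    congr 1; module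
  · have h1 := (hd (t - r)).comp_const_sub t r
    have h2 := (hasDerivAt_id r).smul_const (f' (t - τ))
    rw [one_smul] at h2
    exact (h1.add h2).hasDerivWithinAt
  · rw [neg_add_eq_sub, norm_sub_rev]
    exact (h r hr t ht).le

/-- Only `U` is differentiable. Symmetry rewrites the increment of the form as $\mathrm{Re}\langle
U_s-U_\tau,V_s+V_\tau\rangle$, so continuity of `V` is enough. In the application $V=KU$ with `K`
possibly unbounded, and `V` need not be differentiable. -/
theorem hasDerivAt_form {H : Type*} [NormedAddCommGroup H] [InnerProductSpace ℂ H]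
    [NormedSpace ℝ H] [IsScalarTower ℝ ℂ H] {U V : ℝ → H}
    {W : H} {τ : ℝ} (hU : HasDerivAt U W τ) (hV : ContinuousAt V τ)
    (hsym : ∀ s, ⟪V s, U τ⟫_ℂ = ⟪U s, V τ⟫_ℂ) :
    HasDerivAt (fun s => (⟪U s, V s⟫_ℂ).re) (2 * (⟪V τ, W⟫_ℂ).re) τ := by
  rw [hasDerivAt_iff_tendsto_slope] at hU ⊢
  have h1 : Tendsto (fun s => (⟪slope U τ s, V s + V τ⟫_ℂ).re) (𝓝[≠] τ)
      (𝓝 (⟪W, V τ + V τ⟫_ℂ).re) :=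
    (Complex.continuous_re.tendsto _).comp
      (hU.inner ((hV.mono_left nhdsWithin_le_nhds).add tendsto_const_nhds))
  have h2 : (⟪W, V τ + V τ⟫_ℂ).re = 2 * (⟪V τ, W⟫_ℂ).re := by
    rw [inner_add_right, Complex.add_re, ← inner_conj_symm, Complex.conj_re]; ring
  rw [h2] at h1
  refine h1.congr fun s => ?_
  have h3 : (⟪U τ, V s⟫_ℂ).re = (⟪U s, V τ⟫_ℂ).re := by
    rw [← hsym, ← inner_conj_symm, Complex.conj_re]
  have h4 : slope U τ s = (((s - τ)⁻¹ : ℝ) : ℂ) • (U s - U τ) := by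
    rw [slope_def_module, ← IsScalarTower.algebraMap_smul ℂ]
    rfl
  rw [h4, inner_smul_left, Complex.conj_ofReal, Complex.re_ofReal_mul, slope_def_module,
    smul_eq_mul]
  congr 1
  simp only [inner_add_right, inner_sub_left, Complex.add_re, Complex.sub_re]
  linarith

/-- Translating the twisted factor realizes the flow generated by $F-d/dt$. The form grows along
this flow, while stability of the monodromy forces it to zero at large times. -/
theorem re_inner_act_nonpos_of_flow (hT : 0 < T) (hΦ : IsFundamental F Φ Ψ)
    (hF : Function.Periodic F T) (hF2 : MemLpPeriod T 2 F)
    (hM : Tendsto (fun j : ℕ => Φ T ^ j) atTop (𝓝 0)) {K : BlockMatrix n n}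
    (hK : HasBoundedColumns K) (hKH : K.IsHermitian)
    (hpos : ∀ u du : ℝ → Fin n → ℂ, IsH1 T u du → 0 ≤ (⟪act K (toSeq T u),
      toSeq T (fun t => (cx (F t)).mulVec (u t) - du t)⟫_ℂ).re)
    (hf : IsTwisted T (Φ T) f f') :
    (⟪toSeq T (fun t => (cx (Φ t)).mulVec (f t)),
      act K (toSeq T (fun t => (cx (Φ t)).mulVec (f t)))⟫_ℂ).re ≤ 0 := by
  have hΦc := hΦ.prim.continuous
  have hΦ2 : MemLpPeriod T 2 Φ := memLpPeriod_of_continuous hΦc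
  have hsq : ∀ {g : ℝ → Fin n → ℂ}, Continuous g →
      VecSqInt T fun t => (cx (Φ t)).mulVec (g t) := fun hg =>
    VecMemLp.mulVec_continuous_sqInt hΦ2 hg
  obtain ⟨C, hC0, hC⟩ := hΦ.exists_norm_le hT hF hF2 hK
  obtain ⟨D, hD0, hD⟩ := exists_norm_toSeq_mulVec_le hT hΦ2
  set U : ℝ → SeqSpace n := fun τ => toSeq T fun t => (cx (Φ t)).mulVec (f (t - τ)) with hUdef
  set V : ℝ → SeqSpace n := fun τ => act K (U τ) with hVdef
  set W : ℝ → SeqSpace n := fun τ => toSeq T fun t => (cx (Φ t)).mulVec (f' (t - τ)) with hWdef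
  have hH1 : ∀ τ, IsH1 T _ _ := fun τ => hΦ.isH1 hF hF2 (hf.shift τ)
  have hUs : ∀ τ, Summable fun i => ‖U τ i‖ := fun τ => (hH1 τ).summable hT
  have hsubU : ∀ s τ, U s - U τ
      = toSeq T fun t => (cx (Φ t)).mulVec (f (t - s) - f (t - τ)) := fun s τ => by
    simp only [Matrix.mulVec_sub]
    rw [toSeq_sub hT (hsq (hf.shift s).continuous) (hsq (hf.shift τ).continuous)]
  have hV : ∀ τ, ContinuousAt V τ := by
    intro τ
    rw [Metric.continuousAt_iff']
    intro ε hε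
    have hε' : 0 < ε / (C + 1) := by positivity
    filter_upwards [eventually_norm_shift_sub_lt (T := T) hf.continuous τ hε',
      eventually_norm_shift_sub_lt (T := T) hf.cont τ hε'] with s h1 h2
    rw [dist_eq_norm, hVdef]
    beta_reduce
    rw [← act_sub hK (hUs s) (hUs τ), hsubU]
    refine ((hC _ _ ((hf.shift s).sub (hf.shift τ)) _ hε'.le (fun t ht => (h1 t ht).le)
      fun t ht => (h2 t ht).le).2).trans_lt ?_
    rw [mul_div_assoc', div_lt_iff₀ (by positivity)]
    nlinarith
  have hU : ∀ τ, HasDerivAt U (-W τ) τ := by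
    intro τ
    rw [hasDerivAt_iff_isLittleO, Asymptotics.isLittleO_iff]
    intro ε hε
    have hε' : 0 < ε / (D + 1) := by positivity
    filter_upwards [eventually_norm_quotient_lt (T := T) hf.deriv hf.cont τ hε'] with s hs
    have h1 : U s - U τ - (s - τ) • -W τ = toSeq T fun t => (cx (Φ t)).mulVec
        (f (t - s) - f (t - τ) + (s - τ) • f' (t - τ)) := by
      have e1 : ∀ t, (cx (Φ t)).mulVec (f (t - s) - f (t - τ) + (s - τ) • f' (t - τ))
          = (cx (Φ t)).mulVec (f (t - s) - f (t - τ))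
            + ((s - τ : ℝ) : ℂ) • (cx (Φ t)).mulVec (f' (t - τ)) := fun t => by
        rw [Matrix.mulVec_add, Matrix.mulVec_smul, Complex.coe_smul]
      simp only [e1]
      rw [toSeq_add hT (hsq ((hf.shift s).sub (hf.shift τ)).continuous)
        ((hsq (hf.shift τ).cont).smul _), ← hsubU, toSeq_smul hT _ (hsq (hf.shift τ).cont),
        smul_neg, sub_neg_eq_add]
      rfl
    rw [h1]
    refine (hD _ (by have := hf.continuous; have := hf.cont; fun_prop) _
      (by positivity) (fun t ht => hs t ht)).trans ?_
    rw [Real.norm_eq_abs, ← mul_assoc]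
    gcongr
    rw [mul_div_assoc', div_le_iff₀ (by positivity)]
    nlinarith
  have hder : ∀ τ, HasDerivAt (fun s => (⟪U s, V s⟫_ℂ).re) (2 * (⟪V τ, -W τ⟫_ℂ).re) τ := fun τ =>
    hasDerivAt_form (hU τ) (hV τ) fun s => inner_act_comm hK hKH (hUs s) (hUs τ)
  -- On $u=\Phi f(\cdot-\tau)$ the operator $F-d/dt$ leaves only $-\Phi f'(\cdot-\tau)$, which is
  -- the derivative of the curve in `τ`; the derivative of the form is therefore the quantity
  -- assumed nonnegative.
  have hmono : Monotone fun s => (⟪U s, V s⟫_ℂ).re := by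
    refine monotone_of_hasDerivAt_nonneg hder fun τ => ?_
    have h1 := hpos _ _ (hH1 τ)
    have h2 : (toSeq T fun t => (cx (F t)).mulVec ((cx (Φ t)).mulVec (f (t - τ)))
        - ((cx (F t * Φ t)).mulVec (f (t - τ)) + (cx (Φ t)).mulVec (f' (t - τ)))) = -W τ := by
      rw [hWdef]
      beta_reduce
      rw [← toSeq_neg hT (hsq (hf.shift τ).cont)]
      congr 1; ext1 t
      rw [cx_mul_mulVec]; abel
    rw [h2] at h1
    positivity
  have hUn : ∀ j : ℕ, U (j * T) = toSeq T fun t => (cx (Φ t)).mulVec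
      ((cx (Φ T ^ j)).mulVec (f t)) := fun j => by
    simp only [hUdef, IsTwisted.apply_sub_nat_mul hf.twist]
  obtain ⟨B, hB⟩ := (isCompact_Icc (a := 0) (b := T)).exists_bound_of_continuousOn
    hf.continuous.continuousOn
  obtain ⟨B', hB'⟩ := (isCompact_Icc (a := 0) (b := T)).exists_bound_of_continuousOn
    hf.cont.continuousOn
  have hB0 : 0 ≤ B := (norm_nonneg _).trans (hB 0 (left_mem_Icc.mpr hT.le))
  set r : ℕ → ℝ := fun j => (∑ a, ∑ b, |(Φ T ^ j) a b|) * max B B' with hr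
  have hr0 : Tendsto r atTop (𝓝 0) := by
    have h1 : Tendsto (fun j => ∑ a, ∑ b, |(Φ T ^ j) a b|) atTop (𝓝 0) := by
      have h2 : Continuous fun N : Matrix (Fin n) (Fin n) ℝ => ∑ a, ∑ b, |N a b| := by fun_prop
      have := (h2.tendsto 0).comp hM
      simpa [Function.comp_def] using this
    simpa [hr] using h1.mul_const (max B B')
  have hrb : ∀ j (z : Fin n → ℂ), ‖z‖ ≤ max B B' → ‖(cx (Φ T ^ j)).mulVec z‖ ≤ r j := by
    intro j z hz
    refine (pi_norm_le_iff_of_nonneg (by positivity)).mpr fun a => ?_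
    rw [hr]
    beta_reduce
    rw [mul_comm]
    exact norm_cx_mulVec_apply_le _ (hB0.trans (le_max_left _ _)) hz a
  -- A translation by `j` periods multiplies both `f` and `f'` by the `j`-th power of the monodromy
  -- matrix, so the $C^1$ size of the factor over a period is at most `r j`.
  have hbound : ∀ j : ℕ, (⟪U 0, V 0⟫_ℂ).re ≤ (C * r j) * (C * r j) := by
    intro j
    have hrj : 0 ≤ r j := by positivity
    have h1 := hmono (show (0 : ℝ) ≤ j * T by positivity)
    have h2 := hC _ _ (hf.shift (j * T)) (r j) hrj
      (fun t ht => by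
        rw [IsTwisted.apply_sub_nat_mul hf.twist]
        exact hrb j _ ((hB t ht).trans (le_max_left _ _)))
      (fun t ht => by
        rw [IsTwisted.apply_sub_nat_mul hf.twist_deriv]
        exact hrb j _ ((hB' t ht).trans (le_max_right _ _)))
    calc _ ≤ (⟪U (j * T), V (j * T)⟫_ℂ).re := h1
      _ ≤ ‖⟪U (j * T), V (j * T)⟫_ℂ‖ := Complex.re_le_norm _
      _ ≤ ‖U (j * T)‖ * ‖V (j * T)‖ := norm_inner_le_norm _ _
      _ ≤ _ := mul_le_mul h2.1 h2.2 (norm_nonneg _) (by positivity)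
  have hlim : Tendsto (fun j => (C * r j) * (C * r j)) atTop (𝓝 0) := by
    have := (hr0.const_mul C).mul (hr0.const_mul C)
    simpa using this
  have := ge_of_tendsto' hlim hbound
  simpa [hUdef, hVdef] using this

end Lyapunov

end HarmonicRiccati

end

noncomputable section

set_option linter.unusedSectionVars false

namespace HarmonicRiccati

open MeasureTheory Set Filter Topology

open scoped ComplexConjugate InnerProductSpace

/-! ### Density of the twisted functions -/

section Density

variable {T : ℝ} {n : ℕ}

/-- The extension `t ↦ φ(t - νT) M⁻ᵛ e_b`, `ν = ⌊t / T⌋`, of a function on `(0, T)`. -/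
def twistExt (T : ℝ) (M : Matrix (Fin n) (Fin n) ℝ) (b : Fin n) (φ : ℝ → ℝ) (t : ℝ) : Fin n → ℂ :=
  φ (t - ⌊t / T⌋ * T) • (cx (M ^ (-⌊t / T⌋))).mulVec (Pi.single b 1)

theorem sub_floor_mul_mem (hT : 0 < T) (t : ℝ) : t - ⌊t / T⌋ * T ∈ Ico 0 T := by
  have h1 := (le_div_iff₀ hT).mp (Int.floor_le (t / T))
  have h2 := (div_lt_iff₀ hT).mp (Int.lt_floor_add_one (t / T))
  constructor <;> nlinarith

/-- Near a multiple of `T` the floor jumps. Since `φ` vanishes off the open period, adding the piece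
of the preceding period gives one expression valid on a whole neighbourhood, so regularity need not
be checked across the jump. -/
theorem twistExt_eventuallyEq (hT : 0 < T) (M : Matrix (Fin n) (Fin n) ℝ) (b : Fin n) {φ : ℝ → ℝ}
    (h0 : ∀ t, t ∉ Ioo 0 T → φ t = 0) (t : ℝ) :
    twistExt T M b φ =ᶠ[𝓝 t] fun s =>
      φ (s - ⌊t / T⌋ * T) • (cx (M ^ (-⌊t / T⌋))).mulVec (Pi.single b 1)
      + φ (s - (⌊t / T⌋ - 1 : ℤ) * T) • (cx (M ^ (-(⌊t / T⌋ - 1)))).mulVec (Pi.single b 1) := by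
  obtain ⟨h1, h2⟩ := sub_floor_mul_mem hT t
  set k := ⌊t / T⌋ with hk
  filter_upwards [Ioo_mem_nhds (show (k - 1 : ℝ) * T < t by nlinarith)
    (show t < (k + 1 : ℝ) * T by nlinarith)] with s hs
  rw [twistExt]
  rcases le_or_gt ((k : ℝ) * T) s with h | h
  · have hf : ⌊s / T⌋ = k := by
      rw [Int.floor_eq_iff, le_div_iff₀ hT, div_lt_iff₀ hT]
      exact ⟨h, hs.2⟩
    rw [hf, h0 (s - (k - 1 : ℤ) * T), zero_smul, add_zero]
    rintro ⟨-, h4⟩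
    push_cast at h4
    nlinarith
  · have hf : ⌊s / T⌋ = k - 1 := by
      rw [Int.floor_eq_iff, le_div_iff₀ hT, div_lt_iff₀ hT]
      push_cast
      exact ⟨hs.1.le, by linarith⟩
    rw [hf, h0 (s - k * T), zero_smul, zero_add]
    rintro ⟨h4, -⟩
    linarith

theorem continuous_twistExt (hT : 0 < T) (M : Matrix (Fin n) (Fin n) ℝ) (b : Fin n) {φ : ℝ → ℝ}
    (h0 : ∀ t, t ∉ Ioo 0 T → φ t = 0) (hφ : Continuous φ) : Continuous (twistExt T M b φ) := by
  refine continuous_iff_continuousAt.mpr fun t => ?_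
  refine ContinuousAt.congr_of_eventuallyEq ?_ (twistExt_eventuallyEq hT M b h0 t)
  fun_prop

theorem isTwisted_twistExt (hT : 0 < T) {M : Matrix (Fin n) (Fin n) ℝ} (hM : IsUnit M.det)
    (b : Fin n) {φ φ' : ℝ → ℝ} (h0 : ∀ t, t ∉ Ioo 0 T → φ t = 0)
    (h0' : ∀ t, t ∉ Ioo 0 T → φ' t = 0) (hd : ∀ t, HasDerivAt φ (φ' t) t) (hc : Continuous φ') :
    IsTwisted T M (twistExt T M b φ) (twistExt T M b φ') := by
  refine ⟨fun t => ?_, continuous_twistExt hT M b h0' hc, fun t => ?_⟩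
  · refine HasDerivAt.congr_of_eventuallyEq ?_ (twistExt_eventuallyEq hT M b h0 t)
    rw [(twistExt_eventuallyEq hT M b h0' t).self_of_nhds]
    exact (((hd _).comp_sub_const t _).smul_const _).add (((hd _).comp_sub_const t _).smul_const _)
  · have hf : ⌊(t + T) / T⌋ = ⌊t / T⌋ + 1 := by
      rw [add_div, div_self hT.ne', Int.floor_add_one]
    rw [twistExt, twistExt, hf, Matrix.mulVec_smul, ← cx_mul_mulVec]
    have e1 : M * M ^ (-(⌊t / T⌋ + 1)) = M ^ (-⌊t / T⌋) := by
      rw [← Matrix.zpow_one_add hM]; congr 1; ring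
    rw [e1]
    congr 2
    push_cast; ring

variable {F Φ Ψ : ℝ → Matrix (Fin n) (Fin n) ℝ}

theorem toSeq_zero (hT : 0 < T) : toSeq T (fun _ => (0 : Fin n → ℂ)) = 0 := by
  have := toSeq_smul (u := fun _ : ℝ => (0 : Fin n → ℂ)) hT 0
    (vecSqInt_of_continuous continuous_const)
  simpa using this

theorem IsFundamental.isUnit_det (hΦ : IsFundamental F Φ Ψ) (t : ℝ) : IsUnit (Φ t).det :=
  Matrix.isUnit_det_of_right_inverse (hΦ.mul_inv t)

/-- Any test function on one open period times a basis vector extends to a twisted function.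
Orthogonality to all of these gives $\Phi^{\mathsf T}g=0$ almost everywhere, and `Φ` is invertible.
-/
theorem IsFundamental.ae_eq_zero_of_orthogonal (hT : 0 < T) (hΦ : IsFundamental F Φ Ψ)
    {g : ℝ → Fin n → ℂ} (hg : VecSqInt T g)
    (h : ∀ f f' : ℝ → Fin n → ℂ, IsTwisted T (Φ T) f f' →
      ⟪toSeq T (fun t => (cx (Φ t)).mulVec (f t)), toSeq T g⟫_ℂ = 0) : toSeq T g = 0 := by
  have hΦc := hΦ.prim.continuous
  have hΦ2 : MemLpPeriod T ⊤ fun t => (Φ t).transpose :=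
    memLpPeriod_of_continuous hΦc.matrix_transpose
  have hΦ2' : MemLpPeriod T 2 Φ := memLpPeriod_of_continuous hΦc
  have hg' := VecMemLp.mulVec_sqInt hΦ2 hg
  have key : ∀ b, ∀ᵐ t, t ∈ Ioo 0 T → (cx (Φ t).transpose).mulVec (g t) b = 0 := by
    intro b
    -- The fundamental lemma of the calculus of variations, applied to one component of
    -- $\Phi^{\mathsf T}g$.
    refine isOpen_Ioo.ae_eq_zero_of_integral_contDiff_smul_eq_zero ?_ fun φ hφ hφc hφs => ?_
    · exact ((hg'.integrableOn b).mono_set Ioo_subset_Ioc_self).locallyIntegrableOn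
    have h0 : ∀ t, t ∉ Ioo 0 T → φ t = 0 := fun t ht =>
      image_eq_zero_of_notMem_tsupport fun h => ht (hφs h)
    have h0' : ∀ t, t ∉ Ioo 0 T → deriv φ t = 0 := fun t ht =>
      image_eq_zero_of_notMem_tsupport fun h => ht (hφs (tsupport_deriv_subset h))
    have hd : ∀ t, HasDerivAt φ (deriv φ t) t := fun t =>
      (hφ.differentiable (by norm_num) t).hasDerivAt
    have hdc : Continuous (deriv φ) := hφ.continuous_deriv (by norm_num)
    have htw := isTwisted_twistExt hT (hΦ.isUnit_det T) b h0 h0' hd hdc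
    have h1 := h _ _ htw
    rw [inner_toSeq hT (VecMemLp.mulVec_continuous_sqInt hΦ2' htw.continuous) hg, mul_eq_zero,
      or_iff_right (by simp [hT.ne'])] at h1
    rw [← h1, intervalIntegral.integral_of_le hT.le, integral_Ioc_eq_integral_Ioo,
      ← setIntegral_eq_integral_of_forall_compl_eq_zero (s := Ioo 0 T)
        fun t ht => by rw [h0 t ht, zero_smul]]
    refine setIntegral_congr_fun measurableSet_Ioo fun t ht => ?_
    have hf : ⌊t / T⌋ = 0 := by
      rw [Int.floor_eq_iff, le_div_iff₀ hT, div_lt_iff₀ hT]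
      simpa using ⟨ht.1.le, ht.2⟩
    rw [twistExt, hf, star_cx_mulVec_dotProduct]
    have e1 : star (Pi.single b 1 : Fin n → ℂ) = Pi.single b 1 := by
      ext a; by_cases h : a = b <;> simp [h]
    rw [neg_zero, zpow_zero, cx_one, Matrix.one_mulVec, star_smul, e1, smul_dotProduct,
      single_one_dotProduct]
    simp
  refine (toSeq_congr_ae hT ?_).trans (toSeq_zero hT)
  · have h2 := (ae_all_iff.mpr key)
    rw [← restrict_Ioo_eq_restrict_Ioc, EventuallyEq, ae_restrict_iff' measurableSet_Ioo]
    filter_upwards [h2] with t ht htm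
    have h3 : (cx (Φ t).transpose).mulVec (g t) = 0 := funext fun b => ht b htm
    have h4 := congrArg (fun z => (cx (Ψ t).transpose).mulVec z) h3
    beta_reduce at h4
    rwa [← cx_mul_mulVec, ← Matrix.transpose_mul, hΦ.mul_inv, Matrix.transpose_one, cx_one,
      Matrix.one_mulVec, Matrix.mulVec_zero] at h4

/-- Along a stable periodic linear system, the form of a Hermitian matrix satisfying a Lyapunov
inequality is nonpositive on a dense subspace that does not depend on the matrix. -/
theorem exists_dense_nonpos (hT : 0 < T) (hΦ : IsFundamental F Φ Ψ)
    (hF : Function.Periodic F T) (hF2 : MemLpPeriod T 2 F)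
    (hM : Tendsto (fun j : ℕ => Φ T ^ j) atTop (𝓝 0)) :
    ∃ S : Submodule ℂ (SeqSpace n), Dense (S : Set (SeqSpace n)) ∧
      (∀ x ∈ S, ∃ u du : ℝ → Fin n → ℂ, IsH1 T u du ∧ toSeq T u = x) ∧
      ∀ K : BlockMatrix n n, HasBoundedColumns K → K.IsHermitian →
        (∀ u du : ℝ → Fin n → ℂ, IsH1 T u du → 0 ≤ (⟪act K (toSeq T u),
          toSeq T (fun t => (cx (F t)).mulVec (u t) - du t)⟫_ℂ).re) →
        ∀ x ∈ S, (⟪x, act K x⟫_ℂ).re ≤ 0 := by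
  have hsq : ∀ {g : ℝ → Fin n → ℂ}, Continuous g →
      VecSqInt T fun t => (cx (Φ t)).mulVec (g t) := fun hg =>
    VecMemLp.mulVec_continuous_sqInt (memLpPeriod_of_continuous hΦ.prim.continuous) hg
  let S : Submodule ℂ (SeqSpace n) :=
    { carrier := {x | ∃ f f' : ℝ → Fin n → ℂ, IsTwisted T (Φ T) f f' ∧
        toSeq T (fun t => (cx (Φ t)).mulVec (f t)) = x}
      add_mem' := by
        rintro _ _ ⟨f, f', hf, rfl⟩ ⟨g, g', hg, rfl⟩
        refine ⟨_, _, hf.add hg, ?_⟩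
        simp only [Matrix.mulVec_add]
        exact toSeq_add hT (hsq hf.continuous) (hsq hg.continuous)
      zero_mem' := by
        refine ⟨fun _ => 0, fun _ => 0, ⟨fun t => hasDerivAt_const t _, continuous_const,
          fun t => Matrix.mulVec_zero _⟩, ?_⟩
        simp only [Matrix.mulVec_zero]
        exact toSeq_zero hT
      smul_mem' := by
        rintro c _ ⟨f, f', hf, rfl⟩
        refine ⟨_, _, hf.smul c, ?_⟩
        simp only [Matrix.mulVec_smul]
        exact toSeq_smul hT c (hsq hf.continuous) }
  refine ⟨S, ?_, ?_, ?_⟩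
  · rw [Submodule.dense_iff_topologicalClosure_eq_top, Submodule.topologicalClosure_eq_top_iff,
      Submodule.eq_bot_iff]
    intro w hw
    obtain ⟨g, hg, rfl⟩ := exists_toSeq_eq hT w
    exact hΦ.ae_eq_zero_of_orthogonal hT hg fun f f' hf =>
      (Submodule.mem_orthogonal _ _).mp hw _ ⟨f, f', hf, rfl⟩
  · rintro _ ⟨f, f', hf, rfl⟩
    exact ⟨_, _, hΦ.isH1 hF hF2 hf, rfl⟩
  · rintro K hK hKH hpos _ ⟨f, f', hf, rfl⟩
    exact re_inner_act_nonpos_of_flow hT hΦ hF hF2 hM hK hKH hpos hf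

end Density

end HarmonicRiccati

end

noncomputable section

set_option linter.unusedSectionVars false

namespace HarmonicRiccati

open MeasureTheory Set Filter Topology

open scoped ComplexConjugate InnerProductSpace

/-! ### Auxiliary results on operators, matrices and scalar equations -/

/-! ### Bounded extension of nonnegative symmetric forms -/

section Hilbert

variable {H : Type*} [NormedAddCommGroup H] [InnerProductSpace ℂ H]

/-- Expand the form at `x - y`, which is nonnegative, and bound the two diagonal terms. -/
theorem re_inner_le_of_form_bounds {S : Submodule ℂ H} {f : S →ₗ[ℂ] H}
    (hsym : ∀ x y : S, ⟪f x, (y : H)⟫_ℂ = ⟪(x : H), f y⟫_ℂ) {p : ℝ}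
    (h0 : ∀ x : S, 0 ≤ (⟪(x : H), f x⟫_ℂ).re) (hp : ∀ x : S, (⟪(x : H), f x⟫_ℂ).re ≤ p * ‖(x : H)‖ ^ 2)
    (x y : S) : (⟪(y : H), f x⟫_ℂ).re ≤ p / 2 * (‖(x : H)‖ ^ 2 + ‖(y : H)‖ ^ 2) := by
  have h1 := h0 (x - y)
  have h2 : (⟪(x : H), f y⟫_ℂ).re = (⟪(y : H), f x⟫_ℂ).re := by
    rw [← hsym, ← inner_conj_symm, Complex.conj_re]
  rw [map_sub, AddSubgroupClass.coe_sub, inner_sub_left, inner_sub_right, inner_sub_right] at h1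
  simp only [Complex.sub_re] at h1
  linarith [hp x, hp y]

/-- The form bounds $0\le f\le p$ on a dense subspace already force $\|fx\|\le p\|x\|$, so `f`
extends by continuity and the symmetry passes to the limit. -/
theorem exists_symmetric_extension [CompleteSpace H] {S : Submodule ℂ H}
    (hS : Dense (S : Set H)) (f : S →ₗ[ℂ] H)
    (hsym : ∀ x y : S, ⟪f x, (y : H)⟫_ℂ = ⟪(x : H), f y⟫_ℂ) {p : ℝ} (hp0 : 0 < p)
    (h0 : ∀ x : S, 0 ≤ (⟪(x : H), f x⟫_ℂ).re)
    (hp : ∀ x : S, (⟪(x : H), f x⟫_ℂ).re ≤ p * ‖(x : H)‖ ^ 2) :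
    ∃ L : H →L[ℂ] H, (∀ x : S, L x = f x) ∧ ∀ x y, ⟪L x, y⟫_ℂ = ⟪x, L y⟫_ℂ := by
  have hb : ∀ x : S, ‖f x‖ ≤ p * ‖x‖ := by
    intro x
    have h1 : ∀ y : H, (⟪y, f x⟫_ℂ).re ≤ p / 2 * (‖(x : H)‖ ^ 2 + ‖y‖ ^ 2) := by
      refine fun y => hS.induction (P := fun y => (⟪y, f x⟫_ℂ).re
        ≤ p / 2 * (‖(x : H)‖ ^ 2 + ‖y‖ ^ 2)) (fun y hy =>
          re_inner_le_of_form_bounds hsym h0 hp x ⟨y, hy⟩) ?_ y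
      exact isClosed_le (by fun_prop) (by fun_prop)
    -- The vector $p^{-1}fx$ need not lie in the subspace, which is why the inequality was first
    -- extended in `y` by density; this choice lets half of $\|fx\|^2$ be absorbed.
    have h2 := h1 (((p⁻¹ : ℝ) : ℂ) • f x)
    rw [inner_smul_left, Complex.conj_ofReal, Complex.re_ofReal_mul, norm_smul,
      Complex.norm_real, Real.norm_eq_abs, abs_of_pos (by positivity),
      inner_self_eq_norm_sq_to_K] at h2
    have h3 : ((((‖f x‖ : ℝ) : ℂ)) ^ 2).re = ‖f x‖ ^ 2 := by
      rw [← Complex.ofReal_pow, Complex.ofReal_re]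
    change p⁻¹ * (((‖f x‖ : ℝ) : ℂ) ^ 2).re ≤ _ at h2
    rw [h3] at h2
    refine le_of_sq_le_sq ?_ (by positivity)
    rw [mul_pow] at h2 ⊢
    have h4 : p * (p⁻¹ * ‖f x‖ ^ 2) ≤ p * (p / 2 * (‖(x : H)‖ ^ 2 + p⁻¹ ^ 2 * ‖f x‖ ^ 2)) := by
      gcongr
    have h5 : p * (p / 2 * (‖(x : H)‖ ^ 2 + p⁻¹ ^ 2 * ‖f x‖ ^ 2))
        = p ^ 2 / 2 * ‖(x : H)‖ ^ 2 + ‖f x‖ ^ 2 / 2 := by field_simp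
    rw [h5, ← mul_assoc, mul_inv_cancel₀ hp0.ne', one_mul] at h4
    change ‖f x‖ ^ 2 ≤ p ^ 2 * ‖(x : H)‖ ^ 2
    linarith
  have hdr : DenseRange S.subtypeL := by
    rw [DenseRange]; simpa using hS
  let g : S →L[ℂ] H := f.mkContinuous p hb
  have hL : ∀ x : S, g.extend S.subtypeL (x : H) = f x := fun x =>
    ContinuousLinearMap.extend_eq g hdr isUniformEmbedding_subtype_val.isUniformInducing x
  refine ⟨g.extend S.subtypeL, hL, fun x y => ?_⟩
  refine hS.induction (P := fun x => ⟪g.extend S.subtypeL x, y⟫_ℂ = ⟪x, g.extend S.subtypeL y⟫_ℂ)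
    (fun x hx => ?_) (isClosed_eq (by fun_prop) (by fun_prop)) x
  refine hS.induction (P := fun y => ⟪g.extend S.subtypeL x, y⟫_ℂ = ⟪x, g.extend S.subtypeL y⟫_ℂ)
    (fun y hy => ?_) (isClosed_eq (by fun_prop) (by fun_prop)) y
  have e1 := hL ⟨x, hx⟩
  have e2 := hL ⟨y, hy⟩
  dsimp only at e1 e2
  rw [e1, e2]
  exact hsym ⟨x, hx⟩ ⟨y, hy⟩

/-- A nonnegative symmetric bounded operator satisfies `‖Dx‖² ≤ C ⟨x, Dx⟩`. -/
theorem exists_norm_sq_le_form (D : H →L[ℂ] H) (hsym : ∀ x y, ⟪D x, y⟫_ℂ = ⟪x, D y⟫_ℂ)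
    (h0 : ∀ x, 0 ≤ (⟪x, D x⟫_ℂ).re) : ∀ x, ‖D x‖ ^ 2 ≤ (‖D‖ + 1) * (⟪x, D x⟫_ℂ).re := by
  intro x
  set c := ‖D‖ + 1 with hc
  have hcp : 0 < c := by positivity
  -- Nonnegativity at this point gives $2c^{-1}\|Dx\|^2\le\langle x,Dx\rangle+c^{-2}\langle
  -- Dx,D^2x\rangle$, and the last term is at most $c^{-1}\|Dx\|^2$. The added $1$ in `c` avoids
  -- dividing by zero.
  have h1 := h0 (x - ((c⁻¹ : ℝ) : ℂ) • D x)
  have h2 : (⟪x, D (D x)⟫_ℂ).re = ‖D x‖ ^ 2 := by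
    rw [← hsym, inner_self_eq_norm_sq_to_K]
    change (((‖D x‖ : ℝ) : ℂ) ^ 2).re = _
    rw [← Complex.ofReal_pow, Complex.ofReal_re]
  have h3 : (⟪D x, D x⟫_ℂ).re = ‖D x‖ ^ 2 := by rw [hsym, h2]
  have h4 : (⟪D x, D (D x)⟫_ℂ).re ≤ c * ‖D x‖ ^ 2 := by
    calc _ ≤ ‖⟪D x, D (D x)⟫_ℂ‖ := Complex.re_le_norm _
      _ ≤ ‖D x‖ * (‖D‖ * ‖D x‖) := (norm_inner_le_norm _ _).trans (by gcongr; exact D.le_opNorm _)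
      _ ≤ _ := by nlinarith [sq_nonneg ‖D x‖]
  rw [map_sub, map_smul, inner_sub_left, inner_sub_right, inner_sub_right, inner_smul_left,
    inner_smul_left, inner_smul_right, inner_smul_right, Complex.conj_ofReal] at h1
  simp only [Complex.sub_re, Complex.re_ofReal_mul] at h1
  rw [h2, h3] at h1
  have h5 : c⁻¹ * (c⁻¹ * (⟪D x, D (D x)⟫_ℂ).re) ≤ c⁻¹ * (c⁻¹ * (c * ‖D x‖ ^ 2)) := by gcongr
  rw [← mul_assoc (c⁻¹) c, inv_mul_cancel₀ hcp.ne', one_mul] at h5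
  have h6 : c⁻¹ * ‖D x‖ ^ 2 ≤ (⟪x, D x⟫_ℂ).re := by linarith
  rwa [inv_mul_le_iff₀ hcp] at h6

end Hilbert

/-! ### Quantitative positivity and powers of finite matrices -/

section Matrices

variable {n : ℕ}

theorem dotProduct_mulVec_comm {E : Matrix (Fin n) (Fin n) ℝ} (hE : E.transpose = E)
    (x y : Fin n → ℝ) : x ⬝ᵥ E.mulVec y = y ⬝ᵥ E.mulVec x := by
  rw [Matrix.dotProduct_mulVec, ← Matrix.mulVec_transpose, hE, dotProduct_comm]

theorem PosDef.transpose_eq {E : Matrix (Fin n) (Fin n) ℝ} (hE : E.PosDef) : E.transpose = E := by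
  have := hE.isHermitian
  rwa [Matrix.IsHermitian, Matrix.conjTranspose_eq_transpose_of_trivial] at this

theorem PosDef.dotProduct_mulVec_nonneg {E : Matrix (Fin n) (Fin n) ℝ} (hE : E.PosSemidef)
    (x : Fin n → ℝ) : 0 ≤ x ⬝ᵥ E.mulVec x := by
  simpa using hE.dotProduct_mulVec_nonneg x

/-- Cauchy–Schwarz for the inner product defined by `E` gives $x_a^2\le(E^{-1})_{aa}\,x^{\mathsf
T}Ex$; summing over the coordinates produces the trace. -/
theorem PosDef.dotProduct_self_le {E : Matrix (Fin n) (Fin n) ℝ} (hE : E.PosDef)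
    (x : Fin n → ℝ) : x ⬝ᵥ x ≤ (E⁻¹).trace * (x ⬝ᵥ E.mulVec x) := by
  rw [Matrix.trace, Finset.sum_mul, dotProduct]
  refine Finset.sum_le_sum fun a _ => ?_
  have hu : IsUnit E.det := (Matrix.isUnit_iff_isUnit_det _).mp hE.isUnit
  -- The form is evaluated at $x-sE^{-1}e_a$; nonnegativity for all `s` makes the discriminant
  -- nonpositive.
  have hq : ∀ s : ℝ, 0 ≤ (E⁻¹) a a * (s * s) + (-2 * x a) * s + x ⬝ᵥ E.mulVec x := by
    intro s
    set w := (E⁻¹).mulVec (Pi.single a 1 : Fin n → ℝ) with hw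
    have h1 := PosDef.dotProduct_mulVec_nonneg hE.posSemidef (x - s • w)
    have h2 : E.mulVec w = Pi.single a 1 := by
      rw [hw, Matrix.mulVec_mulVec, Matrix.mul_nonsing_inv _ hu, Matrix.one_mulVec]
    have h3 : w ⬝ᵥ E.mulVec x = x a := by
      rw [dotProduct_mulVec_comm (PosDef.transpose_eq hE), h2]; simp
    have h4 : w a = (E⁻¹) a a := by rw [hw]; simp
    rw [Matrix.mulVec_sub, Matrix.mulVec_smul, h2] at h1
    simp only [sub_dotProduct, dotProduct_sub, smul_dotProduct, dotProduct_smul, h3,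
      dotProduct_single_one, Pi.sub_apply, Pi.smul_apply, h4, smul_eq_mul] at h1
    linarith
  have := discrim_le_zero hq
  rw [discrim] at this
  simp only [Matrix.diag_apply]
  nlinarith

theorem dotProduct_mulVec_le (E : Matrix (Fin n) (Fin n) ℝ) (x : Fin n → ℝ) :
    |x ⬝ᵥ E.mulVec x| ≤ (∑ a, ∑ b, |E a b|) * (x ⬝ᵥ x) := by
  have hle : ∀ a, |x a| ^ 2 ≤ x ⬝ᵥ x := fun a => by
    rw [sq_abs, sq]
    exact Finset.single_le_sum (f := fun a => x a * x a) (fun a _ => mul_self_nonneg _)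
      (Finset.mem_univ a)
  generalize x ⬝ᵥ x = q at hle ⊢
  simp only [dotProduct, Matrix.mulVec, Finset.mul_sum, Finset.sum_mul]
  refine (Finset.abs_sum_le_sum_abs _ _).trans (Finset.sum_le_sum fun a _ => ?_)
  refine (Finset.abs_sum_le_sum_abs _ _).trans (Finset.sum_le_sum fun b _ => ?_)
  rw [abs_mul, abs_mul]
  have h1 : |x a| * |x b| ≤ q := by
    nlinarith [hle a, hle b, sq_nonneg (|x a| - |x b|)]
  nlinarith [abs_nonneg (E a b)]

/-- Since $P\le C(P-M^{\mathsf T}PM)$, each application of `M` shrinks the `P`-norm squared by the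
fixed factor $1-C^{-1}$. -/
theorem tendsto_pow_of_posDef_sub {P M : Matrix (Fin n) (Fin n) ℝ} (hP : P.PosDef)
    (hM : (P - M.transpose * P * M).PosDef) : Tendsto (fun j : ℕ => M ^ j) atTop (𝓝 0) := by
  set E := P - M.transpose * P * M with hE
  -- The product of the upper bound for `P` and the inverse of the lower bound for `E`; the added
  -- $1$ makes the contraction factor nonnegative.
  set C := (∑ a, ∑ b, |P a b|) * (E⁻¹).trace + 1 with hC
  have htr : 0 ≤ (E⁻¹).trace := hM.posSemidef.inv.trace_nonneg
  have hC1 : 1 ≤ C := by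
    rw [hC]
    have : 0 ≤ ∑ a, ∑ b, |P a b| := by positivity
    nlinarith [mul_nonneg this htr]
  have hPE : ∀ x : Fin n → ℝ, x ⬝ᵥ P.mulVec x ≤ C * (x ⬝ᵥ E.mulVec x) := by
    intro x
    have h1 := (le_abs_self _).trans (dotProduct_mulVec_le P x)
    have h2 := PosDef.dotProduct_self_le hM x
    have h3 := PosDef.dotProduct_mulVec_nonneg hM.posSemidef x
    have h4 : 0 ≤ ∑ a, ∑ b, |P a b| := by positivity
    rw [hC]
    nlinarith [mul_le_mul_of_nonneg_left h2 h4]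
  have hstep : ∀ x : Fin n → ℝ, (M.mulVec x) ⬝ᵥ P.mulVec (M.mulVec x)
      ≤ (1 - C⁻¹) * (x ⬝ᵥ P.mulVec x) := by
    intro x
    have h1 : x ⬝ᵥ E.mulVec x = x ⬝ᵥ P.mulVec x - (M.mulVec x) ⬝ᵥ P.mulVec (M.mulVec x) := by
      rw [hE, Matrix.sub_mulVec, dotProduct_sub, ← Matrix.mulVec_mulVec, ← Matrix.mulVec_mulVec,
        Matrix.dotProduct_mulVec x M.transpose, Matrix.vecMul_transpose]
    have h2 := hPE x
    rw [h1, ← inv_mul_le_iff₀ (by linarith)] at h2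
    linarith
  have hρ : 0 ≤ 1 - C⁻¹ := by
    rw [sub_nonneg]; exact inv_le_one_of_one_le₀ hC1
  have hpow : ∀ (j : ℕ) (x : Fin n → ℝ), ((M ^ j).mulVec x) ⬝ᵥ P.mulVec ((M ^ j).mulVec x)
      ≤ (1 - C⁻¹) ^ j * (x ⬝ᵥ P.mulVec x) := by
    intro j x
    induction j with
    | zero => simp
    | succ j ih =>
      rw [pow_succ', ← Matrix.mulVec_mulVec, pow_succ', mul_assoc]
      exact (hstep _).trans (mul_le_mul_of_nonneg_left ih hρ)
  have htrP : 0 ≤ (P⁻¹).trace := hP.posSemidef.inv.trace_nonneg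
  refine tendsto_pi_nhds.mpr fun a => tendsto_pi_nhds.mpr fun b => ?_
  have hsq : Tendsto (fun j : ℕ => ((M ^ j) a b) ^ 2) atTop (𝓝 0) := by
    set x : Fin n → ℝ := Pi.single b 1
    refine squeeze_zero (g := fun j => (P⁻¹).trace * ((1 - C⁻¹) ^ j * (x ⬝ᵥ P.mulVec x)))
      (fun j => sq_nonneg _) (fun j => ?_) ?_
    · have h1 : (M ^ j).mulVec x a = (M ^ j) a b := by simp [x]
      have h2 : ((M ^ j).mulVec x a) ^ 2 ≤ (M ^ j).mulVec x ⬝ᵥ (M ^ j).mulVec x := by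
        rw [sq]
        exact Finset.single_le_sum (f := fun a => (M ^ j).mulVec x a * (M ^ j).mulVec x a)
          (fun a _ => mul_self_nonneg _) (Finset.mem_univ a)
      rw [← h1]
      exact h2.trans ((PosDef.dotProduct_self_le hP _).trans
        (mul_le_mul_of_nonneg_left (hpow j x) htrP))
    · have := ((tendsto_pow_atTop_nhds_zero_of_lt_one hρ
        (sub_lt_self _ (by positivity))).mul_const (x ⬝ᵥ P.mulVec x)).const_mul (P⁻¹).trace
      simpa using this
  have := hsq.sqrt
  simp only [Real.sqrt_sq_eq_abs, Real.sqrt_zero] at this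
  exact (tendsto_zero_iff_abs_tendsto_zero _).mpr this

/-- The sum of all absolute entries dominates each row sum, so by induction every entry of the
`j`-th power is at most the `j`-th power of that sum. -/
theorem tendsto_pow_of_sum_lt {M : Matrix (Fin n) (Fin n) ℝ} (hM : ∑ a, ∑ b, |M a b| < 1) :
    Tendsto (fun j : ℕ => M ^ j) atTop (𝓝 0) := by
  set r := ∑ a, ∑ b, |M a b| with hr
  have hle : ∀ a, ∑ b, |M a b| ≤ r := fun a =>
    Finset.single_le_sum (f := fun a => ∑ b, |M a b|)
      (fun a _ => Finset.sum_nonneg fun b _ => abs_nonneg _) (Finset.mem_univ a)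
  have hr0 : 0 ≤ r := by positivity
  have hpow : ∀ (j : ℕ) (a b : Fin n), |(M ^ j) a b| ≤ r ^ j := by
    intro j
    induction j with
    | zero =>
      intro a b
      rw [pow_zero, pow_zero, Matrix.one_apply]
      split_ifs <;> simp
    | succ j ih =>
      intro a b
      rw [pow_succ', Matrix.mul_apply, pow_succ']
      calc _ ≤ ∑ c, |M a c| * r ^ j := (Finset.abs_sum_le_sum_abs _ _).trans
            (Finset.sum_le_sum fun c _ => by
              rw [abs_mul]; exact mul_le_mul_of_nonneg_left (ih c b) (abs_nonneg _))
        _ ≤ _ := by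
          rw [← Finset.sum_mul]
          exact mul_le_mul_of_nonneg_right (hle a) (by positivity)
  refine tendsto_pi_nhds.mpr fun a => tendsto_pi_nhds.mpr fun b => ?_
  exact squeeze_zero_norm (fun j => hpow j a b) (tendsto_pow_atTop_nhds_zero_of_lt_one hr0 hM)

/-- A continuous lower bound for the smallest eigenvalue of a positive definite matrix. -/
def lowerBd (Q : Matrix (Fin n) (Fin n) ℝ) : ℝ := |Q.det| / (1 + |Q.adjugate.trace|)

/-- The absolute values and the added $1$ keep the denominator positive on all matrices. Continuity
everywhere is what makes the composition with a bounded measurable function essentially bounded. -/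
theorem continuous_lowerBd : Continuous (lowerBd (n := n)) := by
  unfold lowerBd
  refine Continuous.div ?_ ?_ fun Q => by positivity
  · exact (continuous_id.matrix_det).abs
  · exact continuous_const.add (continuous_id.matrix_adjugate.matrix_trace.abs)

theorem lowerBd_nonneg (Q : Matrix (Fin n) (Fin n) ℝ) : 0 ≤ lowerBd Q := by
  unfold lowerBd; positivity

theorem PosDef.lowerBd_pos {Q : Matrix (Fin n) (Fin n) ℝ} (hQ : Q.PosDef) : 0 < lowerBd Q := by
  have := hQ.det_pos
  unfold lowerBd
  have : 0 < |Q.det| := abs_pos.mpr this.ne'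
  positivity

/-- For a positive definite matrix the bound is slightly below the inverse of the trace of $Q^{-1}$,
so `PosDef.dotProduct_self_le` applies. -/
theorem PosDef.lowerBd_mul_le {Q : Matrix (Fin n) (Fin n) ℝ} (hQ : Q.PosDef) (x : Fin n → ℝ) :
    lowerBd Q * (x ⬝ᵥ x) ≤ x ⬝ᵥ Q.mulVec x := by
  have h1 := PosDef.dotProduct_self_le hQ x
  have hd := hQ.det_pos
  have htr : 0 ≤ (Q⁻¹).trace := hQ.posSemidef.inv.trace_nonneg
  have h2 : (Q⁻¹).trace = Q.det⁻¹ * Q.adjugate.trace := by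
    rw [Matrix.inv_def, Matrix.trace_smul, Ring.inverse_eq_inv', smul_eq_mul]
  have h3 : Q.adjugate.trace = Q.det * (Q⁻¹).trace := by
    rw [h2, mul_inv_cancel_left₀ hd.ne']
  have h4 : 0 ≤ Q.adjugate.trace := by rw [h3]; positivity
  have h5 := PosDef.dotProduct_mulVec_nonneg hQ.posSemidef x
  rw [lowerBd, abs_of_pos hd, abs_of_nonneg h4, div_mul_eq_mul_div, div_le_iff₀ (by positivity)]
  calc _ ≤ Q.det * ((Q⁻¹).trace * (x ⬝ᵥ Q.mulVec x)) := by gcongr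
    _ = (x ⬝ᵥ Q.mulVec x) * Q.adjugate.trace := by rw [h3]; ring
    _ ≤ _ := by nlinarith

end Matrices

/-! ### Periodic solutions of a scalar linear equation -/

section Scalar

variable {T : ℝ}

/-- The difference $\zeta(t+T)-\zeta(t)$ solves the homogeneous equation and vanishes at $0$; the
integrating factor shows that it vanishes identically. -/
theorem IsPrimitive.periodic_of_linear {a l ζ : ℝ → ℝ} (ha : ∀ s t, IntervalIntegrable a volume s t)
    (hap : Function.Periodic a T) (hlp : Function.Periodic l T)
    (hζ : IsPrimitive ζ fun t => a t * ζ t - l t) (h0 : ζ T = ζ 0) : Function.Periodic ζ T := by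
  have hα := IsPrimitive.integral_of_intervalIntegrable ha 0
  have h1 := (hα.neg.rexp).mul ((hζ.comp_add_const T).sub hζ)
  have h2 : ∀ t, Real.exp (-(0 + ∫ τ in (0 : ℝ)..t, a τ)) * (ζ (t + T) - ζ t) = 0 := by
    intro t
    have := h1.eq_of_ae_eq_zero (Eventually.of_forall fun t => by
      rw [hap t, hlp t]; ring) t 0
    rw [this, zero_add T, h0, sub_self, mul_zero]
  intro t
  have := (mul_eq_zero.mp (h2 t)).resolve_left (Real.exp_ne_zero _)
  linarith

/-- Variation of constants. The homogeneous solution expands over a period and the source is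
subtracted, so exactly one initial value closes up and it gives a positive solution. -/
theorem exists_periodic_scalar (hT : 0 < T) {a l : ℝ → ℝ}
    (ha : ∀ s t, IntervalIntegrable a volume s t) (hl : ∀ s t, IntervalIntegrable l volume s t)
    (hap : Function.Periodic a T) (hlp : Function.Periodic l T) (ha0 : ∀ t, 0 ≤ a t)
    (hl0 : ∀ t, 0 ≤ l t) (haT : 0 < ∫ τ in (0 : ℝ)..T, a τ) (hlT : 0 < ∫ τ in (0 : ℝ)..T, l τ) :
    ∃ ζ : ℝ → ℝ, (IsPrimitive ζ fun t => a t * ζ t - l t) ∧ Function.Periodic ζ T ∧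
      ∃ c, 0 < c ∧ ∀ t, c ≤ ζ t := by
  set α : ℝ → ℝ := fun t => ∫ τ in (0 : ℝ)..t, a τ with hαd
  have hα : IsPrimitive α a := by
    simpa [hαd] using IsPrimitive.integral_of_intervalIntegrable ha 0
  have hα0 : α 0 = 0 := by simp [hαd]
  have hαm : ∀ s t, s ≤ t → α s ≤ α t := fun s t hst => by
    rw [← sub_nonneg, hα.sub_eq s t]
    exact intervalIntegral.integral_nonneg hst fun τ _ => ha0 τ
  set g : ℝ → ℝ := fun t => Real.exp (-α t) * l t with hg
  have hgi : ∀ s t, IntervalIntegrable g volume s t := fun s t =>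
    (hl s t).continuousOn_mul (by have := hα.continuous; fun_prop)
  have hg0 : ∀ t, 0 ≤ g t := fun t => mul_nonneg (Real.exp_nonneg _) (hl0 t)
  set j : ℝ := ∫ τ in (0 : ℝ)..T, g τ with hj
  have hj0 : 0 < j := by
    have h1 : Real.exp (-α T) * ∫ τ in (0 : ℝ)..T, l τ ≤ j := by
      rw [← intervalIntegral.integral_const_mul]
      refine intervalIntegral.integral_mono_on hT.le ((hl 0 T).const_mul _) (hgi 0 T) fun t ht => ?_
      refine mul_le_mul_of_nonneg_right (Real.exp_le_exp.mpr ?_) (hl0 t)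
      linarith [hαm t T ht.2]
    exact lt_of_lt_of_le (by positivity) h1
  have hE : 0 < Real.exp (α T) - 1 := by
    rw [sub_pos]; exact Real.one_lt_exp_iff.mpr haT
  -- The initial value solving $e^{\alpha(T)}(c-j)=c$. Then $c-j>0$ is a lower bound on the whole
  -- period, since the integral of `g` never exceeds `j` there and $e^\alpha\ge1$.
  set c : ℝ := Real.exp (α T) * j / (Real.exp (α T) - 1) with hc
  have hcj : c - j = j / (Real.exp (α T) - 1) := by rw [hc]; field_simp; ring
  set ζ : ℝ → ℝ := fun t => Real.exp (α t) * (c - ∫ τ in (0 : ℝ)..t, g τ) with hζd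
  have hζ : IsPrimitive ζ fun t => a t * ζ t - l t := by
    have h1 : IsPrimitive (fun t => ∫ τ in (0 : ℝ)..t, g τ) g := by
      simpa using IsPrimitive.integral_of_intervalIntegrable hgi 0
    refine (hα.rexp.mul ((IsPrimitive.const c).sub h1)).congr_ae (Eventually.of_forall fun t => ?_)
    have h2 : Real.exp (α t) * Real.exp (-α t) = 1 := by rw [← Real.exp_add]; simp
    simp only [hζd, hg]
    linear_combination (-l t) * h2
  have hper : Function.Periodic ζ T := by
    refine hζ.periodic_of_linear ha hap hlp ?_
    simp only [hζd, hα0, intervalIntegral.integral_same, Real.exp_zero, one_mul, sub_zero, ← hj]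
    rw [hcj, hc]; ring
  refine ⟨ζ, hζ, hper, j / (Real.exp (α T) - 1), by positivity, fun t => ?_⟩
  obtain ⟨s, hs, hst⟩ := hper.exists_mem_Ico₀ hT t
  rw [hst, ← hcj]
  have h1 : ∫ τ in (0 : ℝ)..s, g τ ≤ j := by
    rw [hj, ← intervalIntegral.integral_add_adjacent_intervals (hgi 0 s) (hgi s T)]
    have := intervalIntegral.integral_nonneg (μ := volume) hs.2.le fun τ _ => hg0 τ
    linarith
  have h2 : 1 ≤ Real.exp (α s) := by
    have := hαm 0 s hs.1
    rw [hα0] at this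
    exact Real.one_le_exp this
  have h3 : 0 < c - j := by rw [hcj]; positivity
  simp only [hζd]
  nlinarith

end Scalar

end HarmonicRiccati

end

noncomputable section

set_option linter.unusedSectionVars false

namespace HarmonicRiccati

open MeasureTheory Set Filter Topology

open scoped ComplexConjugate InnerProductSpace

/-! ### The periodic Riccati equation and its form -/

section Riccati

variable {T : ℝ} {n : ℕ} {A G Q S : ℝ → Matrix (Fin n) (Fin n) ℝ}

theorem integral_pos_of_ae_pos {f : ℝ → ℝ} {s t : ℝ} (hst : s < t)
    (hi : IntervalIntegrable f volume s t) (h : ∀ᵐ τ, 0 < f τ) : 0 < ∫ τ in s..t, f τ := by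
  rw [intervalIntegral.integral_of_le hst.le, integral_pos_iff_support_of_nonneg_ae
    (ae_restrict_of_ae (h.mono fun τ hτ => hτ.le)) hi.1]
  have h1 : (volume.restrict (Ioc s t)) (Function.support f)
      = (volume.restrict (Ioc s t)) univ := by
    refine measure_congr (ae_restrict_of_ae (h.mono fun τ hτ => ?_))
    exact propext ⟨fun _ => trivial, fun _ => hτ.ne'⟩
  rw [h1, Measure.restrict_apply_univ, Real.volume_Ioc]
  simpa using hst

/-- No integrability is required, because the integral of a non-integrable function is $0$ by
convention. -/
theorem re_integral_nonneg (hT : 0 < T) {f : ℝ → ℂ} (h : ∀ᵐ τ, 0 ≤ (f τ).re) :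
    0 ≤ ((1 / (T : ℂ)) * ∫ τ in (0 : ℝ)..T, f τ).re := by
  have e : (1 / (T : ℂ)) = ((1 / T : ℝ) : ℂ) := by push_cast; rfl
  rw [e, Complex.re_ofReal_mul]
  refine mul_nonneg (by positivity) ?_
  by_cases hi : IntervalIntegrable f volume 0 T
  · have := Complex.reCLM.intervalIntegral_comp_comm hi
    simp only [Complex.reCLM_apply] at this
    rw [← this]
    exact intervalIntegral.integral_nonneg_of_ae hT.le h
  · rw [intervalIntegral.integral_undef hi]; simp

theorem re_star_dotProduct_nonneg_of_real {W : Matrix (Fin n) (Fin n) ℝ}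
    (h : ∀ x : Fin n → ℝ, 0 ≤ x ⬝ᵥ W.mulVec x) (z : Fin n → ℂ) :
    0 ≤ (star z ⬝ᵥ (cx W).mulVec z).re := by
  rw [re_star_dotProduct_cx_mulVec]
  exact add_nonneg (h _) (h _)

/-- Parseval moves the pairing to the time domain, where a real symmetric matrix passes across it.
-/
theorem mulOp_symm (hT : 0 < T) {M : ℝ → Matrix (Fin n) (Fin n) ℝ} (hM : MemLpPeriod T ⊤ M)
    (hs : ∀ᵐ τ, (M τ).transpose = M τ) (x y : SeqSpace n) :
    ⟪mulOp T M x, y⟫_ℂ = ⟪x, mulOp T M y⟫_ℂ := by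
  obtain ⟨u, hu, rfl⟩ := exists_toSeq_eq hT x
  obtain ⟨v, hv, rfl⟩ := exists_toSeq_eq hT y
  rw [inner_mulOp hT hM hu hv, mulOp_toSeq hT hM hu,
    inner_toSeq hT (VecMemLp.mulVec_sqInt hM hu) hv]
  congr 1
  refine intervalIntegral.integral_congr_ae (hs.mono fun τ hτ _ => ?_)
  rw [star_cx_mulVec_dotProduct, hτ]

theorem re_inner_mulOp_nonneg (hT : 0 < T) {M : ℝ → Matrix (Fin n) (Fin n) ℝ}
    (hM : MemLpPeriod T ⊤ M) (hp : ∀ᵐ τ, ∀ x : Fin n → ℝ, 0 ≤ x ⬝ᵥ (M τ).mulVec x)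
    (x : SeqSpace n) : 0 ≤ (⟪x, mulOp T M x⟫_ℂ).re := by
  obtain ⟨u, hu, rfl⟩ := exists_toSeq_eq hT x
  rw [inner_mulOp hT hM hu hu]
  exact re_integral_nonneg hT (hp.mono fun τ hτ => re_star_dotProduct_nonneg_of_real hτ _)

theorem PosSemidef.transpose_eq {E : Matrix (Fin n) (Fin n) ℝ} (hE : E.PosSemidef) :
    E.transpose = E := by
  have := hE.isHermitian
  rwa [Matrix.IsHermitian, Matrix.conjTranspose_eq_transpose_of_trivial] at this

/-- The standing assumptions on the coefficients of `S' + AᵀS + SA - SGS + Q = 0`. -/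
structure RiccatiData (T : ℝ) (A G Q : ℝ → Matrix (Fin n) (Fin n) ℝ) : Prop where
  pos : 0 < T
  perA : Function.Periodic A T
  memA : MemLpPeriod T 2 A
  perG : Function.Periodic G T
  memG : MemLpPeriod T ⊤ G
  posG : ∀ᵐ t, (G t).PosSemidef
  perQ : Function.Periodic Q T
  memQ : MemLpPeriod T ⊤ Q
  posQ : ∀ᵐ t, (Q t).PosDef

/-- `S` is a symmetric periodic solution of `S' + AᵀS + SA - SGS + Q = 0`. -/
structure IsRiccatiPrimitive (T : ℝ) (A G Q S : ℝ → Matrix (Fin n) (Fin n) ℝ) : Prop where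
  prim : IsMatrixPrimitive S fun t =>
    -((A t).transpose * S t + S t * A t - S t * G t * S t + Q t)
  periodic : Function.Periodic S T
  symm : ∀ t, (S t).transpose = S t

theorem IsMatrixPrimitive.quadForm {X dX : ℝ → Matrix (Fin n) (Fin n) ℝ}
    (hX : IsMatrixPrimitive X dX) (y : Fin n → ℝ) :
    IsPrimitive (fun t => y ⬝ᵥ (X t).mulVec y) (fun t => y ⬝ᵥ (dX t).mulVec y) := by
  have h1 := IsPrimitive.sum Finset.univ fun a => (IsPrimitive.const (y a)).mul
    (IsPrimitive.sum Finset.univ fun b => (hX a b).mul (IsPrimitive.const (y b)))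
  refine h1.congr_ae (Eventually.of_forall fun t => ?_)
  simp [Matrix.mulVec, dotProduct]

theorem dotProduct_transpose_mul_mul (X Y : Matrix (Fin n) (Fin n) ℝ) (y : Fin n → ℝ) :
    y ⬝ᵥ (X.transpose * Y * X).mulVec y = X.mulVec y ⬝ᵥ Y.mulVec (X.mulVec y) := by
  rw [← Matrix.mulVec_mulVec, ← Matrix.mulVec_mulVec, Matrix.dotProduct_mulVec y,
    Matrix.vecMul_transpose]

theorem RiccatiData.posDef_add (h : RiccatiData T A G Q) (hS : ∀ t, (S t).transpose = S t) :
    ∀ᵐ t, (Q t + S t * G t * S t).PosDef := by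
  filter_upwards [h.posG, h.posQ] with t hg hq
  refine hq.add_posSemidef ?_
  have := hg.conjTranspose_mul_mul_same (S t)
  rwa [Matrix.conjTranspose_eq_transpose_of_trivial, hS] at this

/-- The value of a solution decreases along the closed loop system. -/
theorem IsRiccatiPrimitive.decreasing (h : RiccatiData T A G Q) (hS : IsRiccatiPrimitive T A G Q S)
    {Φ Ψ : ℝ → Matrix (Fin n) (Fin n) ℝ} (hΦ : IsFundamental (fun t => A t - G t * S t) Φ Ψ)
    {s t : ℝ} (hst : s < t) {y : Fin n → ℝ} (hy : y ≠ 0) :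
    (Φ t).mulVec y ⬝ᵥ (S t).mulVec ((Φ t).mulVec y)
      < (Φ s).mulVec y ⬝ᵥ (S s).mulVec ((Φ s).mulVec y) := by
  -- Substituting both equations, the terms with `A` cancel and $-SGS$ remains from the closed loop,
  -- which gives a strictly negative derivative.
  have h1 : IsMatrixPrimitive (fun t => (Φ t).transpose * S t * Φ t)
      (fun t => -((Φ t).transpose * (Q t + S t * G t * S t) * Φ t)) := by
    refine ((hΦ.prim.transpose.mul hS.prim).mul hΦ.prim).congr_ae ?_
    filter_upwards [h.posG] with t hg
    simp only [Matrix.transpose_mul, Matrix.transpose_sub, hS.symm, PosSemidef.transpose_eq hg]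
    noncomm_ring
  have h2 := (h1.quadForm y).neg
  have h3 := h2.sub_eq s t
  have hint := h2.intervalIntegrable s t
  have hpos : ∀ᵐ τ, 0 < -(y ⬝ᵥ (-((Φ τ).transpose * (Q τ + S τ * G τ * S τ) * Φ τ)).mulVec y) := by
    filter_upwards [h.posDef_add hS.symm] with τ hτ
    rw [Matrix.neg_mulVec, dotProduct_neg, neg_neg, dotProduct_transpose_mul_mul]
    have hne : (Φ τ).mulVec y ≠ 0 := fun h0 => hy <| by
      have := congrArg (Ψ τ).mulVec h0
      rwa [Matrix.mulVec_mulVec, hΦ.inv_mul, Matrix.one_mulVec, Matrix.mulVec_zero] at this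
    simpa using hτ.dotProduct_mulVec_pos hne
  have h4 := integral_pos_of_ae_pos hst hint hpos
  rw [← h3] at h4
  simp only [dotProduct_transpose_mul_mul] at h4
  linarith

theorem RiccatiData.memLp_closedLoop (h : RiccatiData T A G Q) (hS : Continuous S) :
    MemLpPeriod T 2 fun t => A t - G t * S t :=
  h.memA.sub ((h.memG.mul (r := ⊤) (memLpPeriod_of_continuous (p := ⊤) hS)).mono le_top)

theorem RiccatiData.exists_isFundamental (h : RiccatiData T A G Q) (hS : Continuous S)
    (hSp : Function.Periodic S T) : ∃ Φ Ψ, IsFundamental (fun t => A t - G t * S t) Φ Ψ :=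
  HarmonicRiccati.exists_isFundamental ((h.memLp_closedLoop hS).entrywiseIntegrable h.pos
    (by norm_num) fun t => by simp only [h.perA t, h.perG t, hSp t])

/-- A positive semidefinite periodic solution is positive definite. -/
theorem IsRiccatiPrimitive.posDef (h : RiccatiData T A G Q) (hS : IsRiccatiPrimitive T A G Q S)
    (h0 : ∀ t x, 0 ≤ x ⬝ᵥ (S t).mulVec x) (t : ℝ) : (S t).PosDef := by
  obtain ⟨Φ, Ψ, hΦ⟩ := h.exists_isFundamental hS.prim.continuous hS.periodic
  refine Matrix.PosDef.of_dotProduct_mulVec_pos ?_ fun x hx => ?_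
  · rw [Matrix.IsHermitian, Matrix.conjTranspose_eq_transpose_of_trivial, hS.symm]
  · have hx2 : (Φ t).mulVec ((Ψ t).mulVec x) = x := by
      rw [Matrix.mulVec_mulVec, hΦ.mul_inv, Matrix.one_mulVec]
    have hy : (Ψ t).mulVec x ≠ 0 := fun h0 => hx (by rw [← hx2, h0, Matrix.mulVec_zero])
    -- The value at `x` at time `t` strictly exceeds a later value, which is already known to be
    -- nonnegative.
    have h1 := hS.decreasing h hΦ (show t < t + T by linarith [h.pos]) hy
    rw [hx2] at h1
    simpa using (h0 _ _).trans_lt h1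

/-- The closed loop system of a positive definite periodic solution is stable. -/
theorem IsRiccatiPrimitive.tendsto_pow (h : RiccatiData T A G Q)
    (hS : IsRiccatiPrimitive T A G Q S) (hpos : ∀ t, (S t).PosDef)
    {Φ Ψ : ℝ → Matrix (Fin n) (Fin n) ℝ} (hΦ : IsFundamental (fun t => A t - G t * S t) Φ Ψ) :
    Tendsto (fun j : ℕ => Φ T ^ j) atTop (𝓝 0) := by
  -- Over one full period `S` returns to its initial value, so the strict decrease is a discrete
  -- Lyapunov inequality for the monodromy matrix.
  refine tendsto_pow_of_posDef_sub (hpos 0) ?_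
  refine Matrix.PosDef.of_dotProduct_mulVec_pos ?_ fun x hx => ?_
  · rw [Matrix.IsHermitian, Matrix.conjTranspose_eq_transpose_of_trivial]
    simp only [Matrix.transpose_sub, Matrix.transpose_mul, Matrix.transpose_transpose, hS.symm,
      Matrix.mul_assoc]
  · have h1 := hS.decreasing h hΦ h.pos hx
    have h2 := hS.periodic 0
    rw [zero_add] at h2
    rw [hΦ.zero, Matrix.one_mulVec, h2] at h1
    rw [star_trivial, Matrix.sub_mulVec, dotProduct_sub, dotProduct_transpose_mul_mul]
    linarith

/-- The Riccati form of a periodic solution. -/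
theorem IsRiccatiPrimitive.form (h : RiccatiData T A G Q) (hS : IsRiccatiPrimitive T A G Q S)
    {u du v dv : ℝ → Fin n → ℂ} (hu : IsH1 T u du) (hv : IsH1 T v dv) :
    ⟪mulOp T S (toSeq T u), toSeq T (fun τ => (cx (A τ)).mulVec (v τ) - dv τ)⟫_ℂ
      + ⟪toSeq T (fun τ => (cx (A τ)).mulVec (u τ) - du τ), mulOp T S (toSeq T v)⟫_ℂ
      - ⟪mulOp T S (toSeq T u), mulOp T G (mulOp T S (toSeq T v))⟫_ℂ
      + ⟪toSeq T u, mulOp T Q (toSeq T v)⟫_ℂ = 0 := by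
  have hT := h.pos
  have hSm : MemLpPeriod T ⊤ S := memLpPeriod_of_continuous hS.prim.continuous
  have hSGm : MemLpPeriod T ⊤ fun t => S t * G t := hSm.mul (r := ⊤) h.memG
  have hSGSm : MemLpPeriod T ⊤ fun t => S t * G t * S t := hSGm.mul (r := ⊤) hSm
  have h1 := inner_add_inner_eq_integral hT h.memA hS.prim hS.periodic hS.symm hu hv
  have h2 : ⟪mulOp T S (toSeq T u), mulOp T G (mulOp T S (toSeq T v))⟫_ℂ
      = ⟪toSeq T u, mulOp T (fun t => S t * G t * S t) (toSeq T v)⟫_ℂ := by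
    rw [mulOp_symm hT hSm (Eventually.of_forall hS.symm), mulOp_mulOp hT hSm h.memG,
      mulOp_mulOp hT hSGm hSm]
  rw [h2, mulOp_toSeq hT hSm hu.sqInt, mulOp_toSeq hT hSm hv.sqInt, h1,
    inner_mulOp hT hSGSm hu.sqInt hv.sqInt, inner_mulOp hT h.memQ hu.sqInt hv.sqInt,
    ← mul_sub, ← mul_add]
  have hint : ∀ {M : ℝ → Matrix (Fin n) (Fin n) ℝ}, MemLpPeriod T ⊤ M →
      IntervalIntegrable (fun τ => star (u τ) ⬝ᵥ (cx (M τ)).mulVec (v τ)) volume 0 T := fun hM => by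
    rw [intervalIntegrable_iff_integrableOn_Ioc_of_le hT.le]
    exact integrable_finsetSum _ fun a _ => integrable_conj_mul (hu.sqInt a)
      (VecMemLp.mulVec_sqInt hM hv.sqInt a)
  -- The differential equation reduces the integrand to $SGS-Q$, exactly what the remaining two
  -- terms cancel.
  have e1 : ∀ τ, -((A τ).transpose * S τ + S τ * A τ - S τ * G τ * S τ + Q τ)
      + (A τ).transpose * S τ + S τ * A τ = S τ * G τ * S τ - Q τ := fun τ => by abel
  simp only [e1]
  rw [← intervalIntegral.integral_sub (hint (hSGSm.sub h.memQ)) (hint hSGSm),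
    ← intervalIntegral.integral_add ((hint (hSGSm.sub h.memQ)).sub (hint hSGSm)) (hint h.memQ)]
  refine mul_eq_zero_of_right _ ((intervalIntegral.integral_congr fun τ _ => ?_).trans
    intervalIntegral.integral_zero)
  rw [cx_sub, Matrix.sub_mulVec, dotProduct_sub]; ring

end Riccati

end HarmonicRiccati

end

noncomputable section

set_option linter.unusedSectionVars false

namespace HarmonicRiccati

open MeasureTheory Set Filter Topology

open scoped ComplexConjugate InnerProductSpace

/-! ### Comparison of a harmonic solution with a periodic solution -/

section Comparison

variable {T : ℝ} {n : ℕ} {A G Q S : ℝ → Matrix (Fin n) (Fin n) ℝ}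

theorem re_inner_comm {H : Type*} [NormedAddCommGroup H] [InnerProductSpace ℂ H] (x y : H) :
    (⟪x, y⟫_ℂ).re = (⟪y, x⟫_ℂ).re := by rw [← inner_conj_symm, Complex.conj_re]

/-- The algebra common to both comparisons, with `y = Y u`, `p = S u`, `a = A u - u'`, `L = G` and
`q` the form of `Q`. The case $\theta=1$, $c=0$, $z=0$ bounds `Y` from above; general $\theta$ and
`c`, with $z=\zeta u$, give the strict improvement from below. -/
theorem riccati_form_identity {H : Type*} [NormedAddCommGroup H] [InnerProductSpace ℂ H]
    {L : H →L[ℂ] H} (hL : ∀ x y, ⟪L x, y⟫_ℂ = ⟪x, L y⟫_ℂ) {u z a y p : H} {q : ℝ}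
    (hy : 2 * (⟪y, a⟫_ℂ).re = (⟪y, L y⟫_ℂ).re - q) (hp : 2 * (⟪p, a⟫_ℂ).re = (⟪p, L p⟫_ℂ).re - q)
    (θ c : ℝ) :
    2 * (⟪(z + (θ : ℂ) • p) - y, a - (θ : ℂ) • L p - (c : ℂ) • u⟫_ℂ).re
      = (2 * (⟪z, a - (θ : ℂ) • L p - (c : ℂ) • u⟫_ℂ).re + (1 - θ) * q)
        + θ * (1 - θ) * (⟪p, L p⟫_ℂ).re
        + (2 * c * (⟪u, y - (θ : ℂ) • p⟫_ℂ).re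
          - (⟪y - (θ : ℂ) • p, L (y - (θ : ℂ) • p)⟫_ℂ).re) := by
  have h1 : (⟪p, L y⟫_ℂ).re = (⟪y, L p⟫_ℂ).re := by rw [← hL, re_inner_comm]
  simp only [map_sub, map_smul, inner_sub_left, inner_sub_right, inner_add_left, inner_smul_left,
    inner_smul_right, Complex.conj_ofReal, Complex.add_re, Complex.sub_re, Complex.re_ofReal_mul]
  rw [h1, re_inner_comm u y, re_inner_comm u p]
  linear_combination θ * hp - hy

theorem mulOp_add (hT : 0 < T) {M N : ℝ → Matrix (Fin n) (Fin n) ℝ} (hM : MemLpPeriod T ⊤ M)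
    (hN : MemLpPeriod T ⊤ N) (x : SeqSpace n) :
    mulOp T (fun τ => M τ + N τ) x = mulOp T M x + mulOp T N x := by
  obtain ⟨u, hu, rfl⟩ := exists_toSeq_eq hT x
  rw [mulOp_toSeq hT hM hu, mulOp_toSeq hT hN hu, mulOp_toSeq hT (hM.add hN) hu,
    ← toSeq_add hT (VecMemLp.mulVec_sqInt hM hu) (VecMemLp.mulVec_sqInt hN hu)]
  simp only [cx_add, Matrix.add_mulVec]

theorem mulOp_smul (hT : 0 < T) {M : ℝ → Matrix (Fin n) (Fin n) ℝ} (hM : MemLpPeriod T ⊤ M)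
    (c : ℝ) (x : SeqSpace n) : mulOp T (fun τ => c • M τ) x = (c : ℂ) • mulOp T M x := by
  obtain ⟨u, hu, rfl⟩ := exists_toSeq_eq hT x
  rw [mulOp_toSeq hT hM hu, mulOp_toSeq hT (hM.smul c) hu,
    ← toSeq_smul hT _ (VecMemLp.mulVec_sqInt hM hu)]
  simp only [cx_smul, Matrix.smul_mulVec]

theorem toeplitz_isHermitian {M : ℝ → Matrix (Fin n) (Fin n) ℝ} (hM : Function.Periodic M T)
    (hs : ∀ τ, (M τ).transpose = M τ) (t : ℝ) : (toeplitz T M t).IsHermitian := by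
  rw [Matrix.IsHermitian, toeplitz_conjTranspose hM]
  simp only [hs]

/-- If `f` is not integrable its integral is $0$ by convention, and nonnegativity of `g` alone
suffices. -/
theorem re_integral_add_nonneg (hT : 0 < T) {f g : ℝ → ℂ} (hg : IntervalIntegrable g volume 0 T)
    (hg0 : ∀ᵐ τ, 0 ≤ (g τ).re) (h : ∀ᵐ τ, 0 ≤ (f τ + g τ).re) :
    0 ≤ ((1 / (T : ℂ)) * ∫ τ in (0 : ℝ)..T, f τ).re
      + ((1 / (T : ℂ)) * ∫ τ in (0 : ℝ)..T, g τ).re := by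
  by_cases hf : IntervalIntegrable f volume 0 T
  · rw [← Complex.add_re, ← mul_add, ← intervalIntegral.integral_add hf hg]
    exact re_integral_nonneg hT h
  · rw [intervalIntegral.integral_undef hf, mul_zero, Complex.zero_re, zero_add]
    exact re_integral_nonneg hT hg0

/-- What the comparison argument uses of a solution of the harmonic Riccati equation. -/
structure IsHarmonicForm (T : ℝ) (A G Q : ℝ → Matrix (Fin n) (Fin n) ℝ) (Y : BlockMatrix n n) :
    Prop where
  columns : HasBoundedColumns Y
  hermitian : Y.IsHermitian
  nonneg : ∀ x : SeqSpace n, (Summable fun j => ‖x j‖) → 0 ≤ (⟪x, act Y x⟫_ℂ).re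
  form : ∀ u du : ℝ → Fin n → ℂ, IsH1 T u du →
    2 * (⟪act Y (toSeq T u), toSeq T (fun τ => (cx (A τ)).mulVec (u τ) - du τ)⟫_ℂ).re
      = (⟪act Y (toSeq T u), mulOp T G (act Y (toSeq T u))⟫_ℂ).re
        - (⟪toSeq T u, mulOp T Q (toSeq T u)⟫_ℂ).re

theorem two_mul_re_of_form {x g q : ℂ} (h : x + conj x - g + q = 0) :
    2 * x.re = g.re - q.re := by
  have := congrArg Complex.re h
  simp only [Complex.add_re, Complex.sub_re, Complex.conj_re, Complex.zero_re] at this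
  linarith

theorem IsRiccatiPrimitive.re_form (h : RiccatiData T A G Q) (hS : IsRiccatiPrimitive T A G Q S)
    {u du : ℝ → Fin n → ℂ} (hu : IsH1 T u du) :
    2 * (⟪mulOp T S (toSeq T u), toSeq T (fun τ => (cx (A τ)).mulVec (u τ) - du τ)⟫_ℂ).re
      = (⟪mulOp T S (toSeq T u), mulOp T G (mulOp T S (toSeq T u))⟫_ℂ).re
        - (⟪toSeq T u, mulOp T Q (toSeq T u)⟫_ℂ).re := by
  refine two_mul_re_of_form ?_
  rw [inner_conj_symm]
  exact hS.form h hu hu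

theorem toSeq_closedLoop (h : RiccatiData T A G Q) (hS : Continuous S) {u du : ℝ → Fin n → ℂ}
    (hu : IsH1 T u du) (θ c : ℝ) :
    toSeq T (fun τ => (cx (A τ - θ • (G τ * S τ) - c • (1 : Matrix (Fin n) (Fin n) ℝ))).mulVec (u τ)
      - du τ) = toSeq T (fun τ => (cx (A τ)).mulVec (u τ) - du τ)
        - (θ : ℂ) • mulOp T G (mulOp T S (toSeq T u)) - (c : ℂ) • toSeq T u := by
  have hT := h.pos
  have hSm : MemLpPeriod T ⊤ S := memLpPeriod_of_continuous hS
  have hGS : MemLpPeriod T ⊤ fun t => G t * S t := h.memG.mul (r := ⊤) hSm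
  have h1 := (VecMemLp.mulVec_continuous_sqInt h.memA hu.continuous).sub hu.deriv_sqInt
  have h2 := (VecMemLp.mulVec_sqInt hGS hu.sqInt).smul (θ : ℂ)
  have h3 := hu.sqInt.smul (c : ℂ)
  rw [mulOp_mulOp hT h.memG hSm, mulOp_toSeq hT hGS hu.sqInt,
    ← toSeq_smul hT _ (VecMemLp.mulVec_sqInt hGS hu.sqInt), ← toSeq_smul hT _ hu.sqInt,
    ← toSeq_sub hT h1 h2, ← toSeq_sub hT (h1.sub h2) h3]
  congr 1
  ext1 τ
  simp only [cx_sub, cx_smul, cx_one, Matrix.sub_mulVec, Matrix.smul_mulVec, Matrix.one_mulVec]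
  abel

theorem act_add {X : BlockMatrix n n} (hX : HasBoundedColumns X) {x y : SeqSpace n}
    (hx : Summable fun j => ‖x j‖) (hy : Summable fun j => ‖y j‖) :
    act X (x + y) = act X x + act X y := by
  have h := (hasSum_act hX hx).add (hasSum_act hX hy)
  refine (h.unique ?_).symm
  have h2 : Summable fun j => ‖(x + y) j‖ := by
    refine Summable.of_nonneg_of_le (fun j => norm_nonneg _) (fun j => ?_) (hx.add hy)
    rw [lp.coeFn_add]
    exact norm_add_le _ _
  refine (hasSum_act hX h2).congr_fun fun j => ?_
  rw [lp.coeFn_add, Pi.add_apply, add_smul]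

theorem act_smul (X : BlockMatrix n n) (c : ℂ) (x : SeqSpace n) :
    act X (c • x) = c • act X x := by
  rw [act, act, ← tsum_const_smul'']
  refine tsum_congr fun j => ?_
  rw [lp.coeFn_smul, Pi.smul_apply, smul_smul, smul_eq_mul]

/-- A harmonic solution is bounded, and dominated by every positive definite periodic solution. -/
theorem IsHarmonicForm.exists_operator (h : RiccatiData T A G Q)
    (hS : IsRiccatiPrimitive T A G Q S) (hpos : ∀ t, (S t).PosDef) {Y : BlockMatrix n n}
    (hY : IsHarmonicForm T A G Q Y) :
    ∃ L : SeqSpace n →L[ℂ] SeqSpace n, (∀ x y, ⟪L x, y⟫_ℂ = ⟪x, L y⟫_ℂ) ∧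
      (∀ u du : ℝ → Fin n → ℂ, IsH1 T u du → act Y (toSeq T u) = L (toSeq T u)) ∧
      (∀ x, 0 ≤ (⟪x, L x⟫_ℂ).re) ∧ ∀ x, (⟪x, L x⟫_ℂ).re ≤ (⟪x, mulOp T S x⟫_ℂ).re := by
  have hT := h.pos
  have hSc := hS.prim.continuous
  have hSm : MemLpPeriod T ⊤ S := memLpPeriod_of_continuous hSc
  have hSm2 : MemLpPeriod T 2 S := memLpPeriod_of_continuous hSc
  obtain ⟨Φ, Ψ, hΦ⟩ := h.exists_isFundamental hSc hS.periodic
  obtain ⟨V, hVd, hV1, hV⟩ := exists_dense_nonpos hT hΦ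
    (fun t => by simp only [h.perA t, h.perG t, hS.periodic t]) (h.memLp_closedLoop hSc)
    (hS.tendsto_pow h hpos hΦ)
  have hsum : ∀ x ∈ V, Summable fun j => ‖x j‖ := fun x hx => by
    obtain ⟨u, du, hu, rfl⟩ := hV1 x hx
    exact hu.summable hT
  have hact : ∀ {u du : ℝ → Fin n → ℂ}, IsH1 T u du →
      act (toeplitz T S 0) (toSeq T u) = mulOp T S (toSeq T u) := fun hu => by
    rw [hu.act_toeplitz hT hS.periodic hSm2, mulOp_toSeq hT hSm hu.sqInt]
  have hGsym := mulOp_symm hT h.memG (h.posG.mono fun t ht => PosSemidef.transpose_eq ht)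
  have hGnn := re_inner_mulOp_nonneg hT h.memG
    (h.posG.mono fun t ht x => PosDef.dotProduct_mulVec_nonneg ht x)
  -- The flow argument for the closed loop of `S`, with `K` the difference of `Y` and the Toeplitz
  -- matrix of `S`.
  have hle : ∀ x ∈ V, (⟪x, act Y x⟫_ℂ).re ≤ (⟪x, mulOp T S x⟫_ℂ).re := by
    intro x hx
    have hcols := (colS_toeplitz hT hS.periodic hSm2 0).1
    have h1 := hV (Y - toeplitz T S 0) (hY.columns.sub hcols).1
      (hY.hermitian.sub (toeplitz_isHermitian hS.periodic hS.symm 0)) (fun u du hu => ?_) x hx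
    · obtain ⟨u, du, hu, rfl⟩ := hV1 x hx
      rw [act_sub_matrix hY.columns hcols (hu.summable hT), hact hu, inner_sub_right,
        Complex.sub_re] at h1
      linarith
    · rw [act_sub_matrix hY.columns hcols (hu.summable hT), hact hu]
      have h2 := toSeq_closedLoop h hSc hu 1 0
      simp only [one_smul, zero_smul, sub_zero, Complex.ofReal_one, Complex.ofReal_zero] at h2
      rw [h2]
      -- At $\theta=1$ and $c=0$ the only surviving term is the form of `G` at the difference, which
      -- is nonnegative.
      have h3 := riccati_form_identity (u := toSeq T u) (z := 0) hGsym (hY.form u du hu)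
        (hS.re_form h hu) 1 0
      simp only [one_smul, zero_smul, sub_zero, Complex.ofReal_one, Complex.ofReal_zero, zero_add,
        sub_self, zero_mul, mul_zero, inner_zero_left, Complex.zero_re, zero_sub] at h3
      have h4 := hGnn (act Y (toSeq T u) - mulOp T S (toSeq T u))
      rw [← neg_sub (mulOp T S (toSeq T u)), inner_neg_left, Complex.neg_re]
      linarith
  -- The form of `Y` lies between $0$ and that of the bounded operator of `S`, and this yields
  -- boundedness.
  obtain ⟨L, hL, hLs⟩ := exists_symmetric_extension hVd
    (f := { toFun := fun x => act Y x
            map_add' := fun x y => act_add hY.columns (hsum _ x.2) (hsum _ y.2)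
            map_smul' := fun c x => act_smul Y c x })
    (fun x y => inner_act_comm hY.columns hY.hermitian (hsum _ x.2) (hsum _ y.2))
    (p := ‖mulOp T S‖ + 1) (by positivity) (fun x => hY.nonneg _ (hsum _ x.2)) (fun x => by
      refine (hle x x.2).trans ((Complex.re_le_norm _).trans ((norm_inner_le_norm _ _).trans ?_))
      have := (mulOp T S).le_opNorm (x : SeqSpace n)
      nlinarith [norm_nonneg (x : SeqSpace n), sq_nonneg ‖(x : SeqSpace n)‖])
  have hL' : ∀ x ∈ V, L x = act Y x := fun x hx => hL ⟨x, hx⟩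
  refine ⟨L, hLs, fun u du hu => ?_, fun x => ?_, fun x => ?_⟩
  -- A general periodic function with square integrable derivative need not belong to `V`; testing
  -- against the dense `V` and using the symmetry of `Y` identifies its image all the same.
  · refine ext_inner_left ℂ fun x => ?_
    refine hVd.induction (P := fun x => ⟪x, act Y (toSeq T u)⟫_ℂ = ⟪x, L (toSeq T u)⟫_ℂ)
      (fun x hx => ?_) (isClosed_eq (by fun_prop) (by fun_prop)) x
    rw [← hLs, hL' x hx, inner_act_comm hY.columns hY.hermitian (hsum x hx) (hu.summable hT)]
  · refine hVd.induction (P := fun x => 0 ≤ (⟪x, L x⟫_ℂ).re)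
      (fun x hx => ?_) (isClosed_le continuous_const
        (Complex.continuous_re.comp (continuous_id.inner L.continuous))) x
    rw [hL' x hx]
    exact hY.nonneg x (hsum x hx)
  · refine hVd.induction (P := fun x => (⟪x, L x⟫_ℂ).re ≤ (⟪x, mulOp T S x⟫_ℂ).re)
      (fun x hx => ?_) (isClosed_le (Complex.continuous_re.comp (continuous_id.inner L.continuous))
        (Complex.continuous_re.comp (continuous_id.inner (mulOp T S).continuous))) x
    rw [hL' x hx]
    exact hle x hx

end Comparison

end HarmonicRiccati

end

noncomputable section

set_option linter.unusedSectionVars false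

namespace HarmonicRiccati

open MeasureTheory Set Filter Topology

open scoped ComplexConjugate InnerProductSpace

/-! ### Uniqueness of the harmonic solution -/

section Uniqueness

variable {T : ℝ} {n : ℕ} {A G Q S : ℝ → Matrix (Fin n) (Fin n) ℝ}

theorem isMatrixPrimitive_smul_one {ζ dζ : ℝ → ℝ} (hζ : IsPrimitive ζ dζ) :
    IsMatrixPrimitive (fun t => ζ t • (1 : Matrix (Fin n) (Fin n) ℝ))
      (fun t => dζ t • (1 : Matrix (Fin n) (Fin n) ℝ)) := fun a b => by
  refine (hζ.mul (IsPrimitive.const ((1 : Matrix (Fin n) (Fin n) ℝ) a b))).congr_ae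
    (Eventually.of_forall fun t => ?_)
  simp

/-- The monodromy matrix is multiplied by $e^{-cT}$, so once $cT\ge\log(1+s)$ its absolute entries
sum to at most $s/(1+s)<1$. -/
theorem exists_scaled_isFundamental {N : ℝ → Matrix (Fin n) (Fin n) ℝ}
    (hT : 0 < T) (hN : EntrywiseIntegrable N) (κ : ℝ) : ∃ c, κ ≤ c ∧ ∃ Φ Ψ,
      IsFundamental (fun t => N t - c • (1 : Matrix (Fin n) (Fin n) ℝ)) Φ Ψ ∧
      Tendsto (fun j : ℕ => Φ T ^ j) atTop (𝓝 0) := by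
  obtain ⟨Φ, Ψ, hΦ⟩ := exists_isFundamental hN
  set s := ∑ a, ∑ b, |Φ T a b| with hs
  have hs0 : 0 ≤ s := Finset.sum_nonneg fun a _ => Finset.sum_nonneg fun b _ => abs_nonneg _
  refine ⟨max κ (Real.log (1 + s) / T), le_max_left _ _, _, _, hΦ.sub_smul_one _, ?_⟩
  set c := max κ (Real.log (1 + s) / T) with hc
  refine tendsto_pow_of_sum_lt ?_
  have h1 : ∑ a, ∑ b, |(Real.exp (-(c * T)) • Φ T) a b| = Real.exp (-(c * T)) * s := by
    simp only [hs, Finset.mul_sum, Matrix.smul_apply, smul_eq_mul, abs_mul,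
      abs_of_pos (Real.exp_pos _)]
  have h2 : Real.log (1 + s) ≤ c * T := by
    rw [← div_le_iff₀ hT]; exact le_max_right _ _
  have h3 : Real.exp (-(c * T)) ≤ (1 + s)⁻¹ := by
    rw [Real.exp_neg]
    refine inv_anti₀ (by positivity) ?_
    rwa [← Real.log_le_iff_le_exp (by positivity)]
  rw [h1]
  calc _ ≤ (1 + s)⁻¹ * s := by gcongr
    _ < 1 := by rw [inv_mul_lt_iff₀ (by positivity)]; linarith

theorem intervalIntegrable_of_memLp_top (hT : 0 < T) {l : ℝ → ℝ}
    (hl : MemLp l ⊤ (volume.restrict (Ioc 0 T))) (hp : Function.Periodic l T) (s t : ℝ) :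
    IntervalIntegrable l volume s t := by
  have h1 : MemLpPeriod T ⊤ fun τ => (Matrix.of fun _ _ => l τ : Matrix (Fin 1) (Fin 1) ℝ) :=
    memLpPeriod_iff.mpr fun _ _ => hl
  exact h1.entrywiseIntegrable hT le_top (fun t => by simp only [hp t]) 0 0 s t

/-- The pointwise inequality behind the strict comparison. -/
theorem scalar_lyapunov_nonneg {N Q₀ : Matrix (Fin n) (Fin n) ℝ} {ζ c l : ℝ} (hζ : 0 ≤ ζ)
    (hQ : ∀ x : Fin n → ℝ, l * (x ⬝ᵥ x) ≤ x ⬝ᵥ Q₀.mulVec x) (x : Fin n → ℝ) :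
    0 ≤ x ⬝ᵥ ((((2 * (∑ a, ∑ b, |N a b|) + 2 * c) * ζ - l) • (1 : Matrix (Fin n) (Fin n) ℝ)
        + (N - c • (1 : Matrix (Fin n) (Fin n) ℝ)).transpose * (ζ • (1 : Matrix (Fin n) (Fin n) ℝ))
        + (ζ • (1 : Matrix (Fin n) (Fin n) ℝ)) * (N - c • (1 : Matrix (Fin n) (Fin n) ℝ)))
        + Q₀).mulVec x := by
  have h1 := (abs_le.mp (dotProduct_mulVec_le N x)).1
  have h2 : x ⬝ᵥ N.transpose.mulVec x = x ⬝ᵥ N.mulVec x := by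
    rw [Matrix.mulVec_transpose, Matrix.dotProduct_mulVec, dotProduct_comm]
  have h3 := hQ x
  simp only [Matrix.transpose_sub, Matrix.transpose_smul, Matrix.transpose_one, Matrix.mul_smul,
    Matrix.smul_mul, mul_one, one_mul, Matrix.add_mulVec, Matrix.smul_mulVec, Matrix.sub_mulVec,
    Matrix.one_mulVec, dotProduct_add, dotProduct_sub, dotProduct_smul, smul_eq_mul, h2]
  nlinarith [mul_le_mul_of_nonneg_left h1 hζ]

/-- The gap $(1-\theta)Q$ left in the Riccati inequality for $\theta S$ makes room for a positive
periodic scalar `ζ` with $\zeta+\theta S\le L$; as `S` is bounded, part of `ζ` dominates $\delta S$.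
-/
theorem IsHarmonicForm.exists_gt (h : RiccatiData T A G Q)
    (hS : IsRiccatiPrimitive T A G Q S) {Y : BlockMatrix n n} (hY : IsHarmonicForm T A G Q Y)
    {L : SeqSpace n →L[ℂ] SeqSpace n} (hLs : ∀ x y, ⟪L x, y⟫_ℂ = ⟪x, L y⟫_ℂ)
    (hL : ∀ u du : ℝ → Fin n → ℂ, IsH1 T u du → act Y (toSeq T u) = L (toSeq T u))
    {θ : ℝ} (hθ0 : 0 ≤ θ) (hθ1 : θ < 1)
    (hθ : ∀ x, θ * (⟪x, mulOp T S x⟫_ℂ).re ≤ (⟪x, L x⟫_ℂ).re) :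
    ∃ δ, 0 < δ ∧ ∀ x, (θ + δ) * (⟪x, mulOp T S x⟫_ℂ).re ≤ (⟪x, L x⟫_ℂ).re := by
  have hT := h.pos
  have hSc := hS.prim.continuous
  have hSm : MemLpPeriod T ⊤ S := memLpPeriod_of_continuous hSc
  have hSsym := mulOp_symm hT hSm (Eventually.of_forall hS.symm)
  have hGsym := mulOp_symm hT h.memG (h.posG.mono fun t ht => PosSemidef.transpose_eq ht)
  have hGnn := re_inner_mulOp_nonneg hT h.memG
    (h.posG.mono fun t ht x => PosDef.dotProduct_mulVec_nonneg ht x)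
  -- the nonnegative operator `D = L - θ S`
  set D : SeqSpace n →L[ℂ] SeqSpace n := L - (θ : ℂ) • mulOp T S with hD
  have hDa : ∀ x, D x = L x - (θ : ℂ) • mulOp T S x := fun x => rfl
  have hDs : ∀ x y, ⟪D x, y⟫_ℂ = ⟪x, D y⟫_ℂ := fun x y => by
    rw [hDa, hDa, inner_sub_left, inner_sub_right, inner_smul_left, inner_smul_right, hLs, hSsym,
      Complex.conj_ofReal]
  have hDn : ∀ x, 0 ≤ (⟪x, D x⟫_ℂ).re := fun x => by
    rw [hDa, inner_sub_right, inner_smul_right, Complex.sub_re, Complex.re_ofReal_mul]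
    linarith [hθ x]
  have hDq := exists_norm_sq_le_form D hDs hDn
  -- the closed loop matrix
  set N : ℝ → Matrix (Fin n) (Fin n) ℝ := fun t => A t - θ • (G t * S t) with hN
  have hNm : MemLpPeriod T 2 N :=
    h.memA.sub (((h.memG.mul (r := ⊤) hSm).mono le_top).smul θ)
  have hNp : Function.Periodic N T := fun t => by
    simp only [hN, h.perA t, h.perG t, hS.periodic t]
  have hNe := hNm.entrywiseIntegrable hT (by norm_num) hNp
  -- The lower bound on `c` ensures $2c\ge\|G\|(\|D\|+1)$, so that $2c\langle u,Du\rangle$ absorbs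
  -- $\langle Du,GDu\rangle$. The added $1$ makes `c` positive.
  obtain ⟨c, hc, Φ, Ψ, hΦ, hpow⟩ := exists_scaled_isFundamental hT hNe
    (‖mulOp T G‖ * (‖D‖ + 1) / 2 + 1)
  have hc0 : 0 < c := lt_of_lt_of_le (by positivity) hc
  set F : ℝ → Matrix (Fin n) (Fin n) ℝ :=
    fun t => N t - c • (1 : Matrix (Fin n) (Fin n) ℝ) with hF
  have hFm : MemLpPeriod T 2 F := hNm.sub (memLpPeriod_of_continuous continuous_const)
  have hFp : Function.Periodic F T := fun t => by simp only [hF, hNp t]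
  -- the periodic scalar function
  set a : ℝ → ℝ := fun t => 2 * (∑ i, ∑ j, |N t i j|) + 2 * c with ha
  set l : ℝ → ℝ := fun t => (1 - θ) * lowerBd (Q t) with hl
  have hai : ∀ s t, IntervalIntegrable a volume s t := fun s t => by
    refine IntervalIntegrable.add (IntervalIntegrable.const_mul ?_ 2) intervalIntegrable_const
    exact ⟨integrable_finsetSum _ fun i _ => integrable_finsetSum _ fun j _ =>
        (hNe i j s t).1.abs,
      integrable_finsetSum _ fun i _ => integrable_finsetSum _ fun j _ => (hNe i j s t).2.abs⟩
  have hap : Function.Periodic a T := fun t => by simp only [ha, hNp t]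
  have hlp : Function.Periodic l T := fun t => by simp only [hl, h.perQ t]
  have hli : ∀ s t, IntervalIntegrable l volume s t := fun s t =>
    intervalIntegrable_of_memLp_top hT
      ((memLp_top_comp h.memQ continuous_lowerBd).const_mul (1 - θ)) hlp s t
  have hapos : ∀ t, 0 < a t := fun t => by
    have : 0 ≤ ∑ i, ∑ j, |N t i j| :=
      Finset.sum_nonneg fun i _ => Finset.sum_nonneg fun j _ => abs_nonneg _
    simp only [ha]; positivity
  have h1θ : 0 < 1 - θ := by linarith
  -- The equation $\zeta'=a\zeta-l$ is chosen so that `a` compensates the damping and the worst case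
  -- of the closed loop matrix, while `l` is paid for by $(1-\theta)Q$.
  obtain ⟨ζ, hζ, hζp, c₀, hc₀, hζc⟩ := exists_periodic_scalar hT hai hli hap hlp
    (fun t => (hapos t).le) (fun t => mul_nonneg h1θ.le (lowerBd_nonneg _))
    (integral_pos_of_ae_pos hT (hai 0 T) (Eventually.of_forall hapos))
    (integral_pos_of_ae_pos hT (hli 0 T)
      (h.posQ.mono fun t ht => mul_pos h1θ (PosDef.lowerBd_pos ht)))
  have hζ1 := isMatrixPrimitive_smul_one (n := n) hζ
  have hζm : MemLpPeriod T ⊤ fun t => ζ t • (1 : Matrix (Fin n) (Fin n) ℝ) :=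
    memLpPeriod_of_continuous hζ1.continuous
  have hζs : ∀ t, (ζ t • (1 : Matrix (Fin n) (Fin n) ℝ)).transpose
      = ζ t • (1 : Matrix (Fin n) (Fin n) ℝ) := fun t => by
    rw [Matrix.transpose_smul, Matrix.transpose_one]
  set Z : ℝ → Matrix (Fin n) (Fin n) ℝ :=
    fun t => ζ t • (1 : Matrix (Fin n) (Fin n) ℝ) + θ • S t with hZ
  have hZc : Continuous Z := hζ1.continuous.add (hSc.const_smul θ)
  have hZp : Function.Periodic Z T := fun t => by simp only [hZ, hζp t, hS.periodic t]
  have hZs : ∀ t, (Z t).transpose = Z t := fun t => by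
    simp only [hZ, Matrix.transpose_add, hζs, Matrix.transpose_smul, hS.symm]
  have hZm : MemLpPeriod T ⊤ Z := memLpPeriod_of_continuous hZc
  have hZm2 : MemLpPeriod T 2 Z := memLpPeriod_of_continuous hZc
  have hZop : ∀ x, mulOp T Z x
      = mulOp T (fun t => ζ t • (1 : Matrix (Fin n) (Fin n) ℝ)) x + (θ : ℂ) • mulOp T S x :=
    fun x => by rw [← mulOp_smul hT hSm, ← mulOp_add hT hζm (hSm.smul θ)]
  have hact : ∀ {u du : ℝ → Fin n → ℂ}, IsH1 T u du →
      act (toeplitz T Z 0 - Y) (toSeq T u) = mulOp T Z (toSeq T u) - L (toSeq T u) := fun hu => by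
    rw [act_sub_matrix (colS_toeplitz hT hZp hZm2 0).1 hY.columns (hu.summable hT),
      hu.act_toeplitz hT hZp hZm2, mulOp_toSeq hT hZm hu.sqInt, hL _ _ hu]
  obtain ⟨V, hVd, hV1, hV⟩ := exists_dense_nonpos hT hΦ hFp hFm hpow
  have hlyap : ∀ u du : ℝ → Fin n → ℂ, IsH1 T u du → 0 ≤ (⟪act (toeplitz T Z 0 - Y) (toSeq T u),
      toSeq T (fun t => (cx (F t)).mulVec (u t) - du t)⟫_ℂ).re := by
    intro u du hu
    have hfu := hY.form u du hu
    rw [hL _ _ hu] at hfu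
    have hid := riccati_form_identity (u := toSeq T u)
      (z := mulOp T (fun t => ζ t • (1 : Matrix (Fin n) (Fin n) ℝ)) (toSeq T u))
      hGsym hfu (hS.re_form h hu) θ c
    rw [← hZop, ← toSeq_closedLoop h hSc hu θ c, ← hDa] at hid
    -- The contribution of `ζ`, completed by the surplus of `Q`, is the integral of a form that is
    -- nonnegative at almost every time.
    have hb1 : 0 ≤ 2 * (⟪mulOp T (fun t => ζ t • (1 : Matrix (Fin n) (Fin n) ℝ)) (toSeq T u),
        toSeq T (fun t => (cx (F t)).mulVec (u t) - du t)⟫_ℂ).re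
        + (1 - θ) * (⟪toSeq T u, mulOp T Q (toSeq T u)⟫_ℂ).re := by
      have e1 := inner_add_inner_eq_integral hT hFm hζ1 (fun t => by simp only [hζp t]) hζs hu hu
      rw [← mulOp_toSeq hT hζm hu.sqInt] at e1
      have e2 := congrArg Complex.re e1
      rw [Complex.add_re, re_inner_comm (toSeq T fun τ => (cx (F τ)).mulVec (u τ) - du τ),
        ← two_mul] at e2
      have e3 : (1 - θ) * (⟪toSeq T u, mulOp T Q (toSeq T u)⟫_ℂ).re
          = (⟪toSeq T u, mulOp T (fun τ => (1 - θ) • Q τ) (toSeq T u)⟫_ℂ).re := by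
        rw [mulOp_smul hT h.memQ, inner_smul_right, Complex.re_ofReal_mul]
      have hQm := h.memQ.smul (1 - θ)
      rw [e2, e3, inner_mulOp hT hQm hu.sqInt hu.sqInt]
      refine re_integral_add_nonneg hT ?_ ?_ ?_
      · rw [intervalIntegrable_iff_integrableOn_Ioc_of_le hT.le]
        exact integrable_finsetSum _ fun i _ => integrable_conj_mul (hu.sqInt i)
          (VecMemLp.mulVec_sqInt hQm hu.sqInt i)
      · filter_upwards [h.posQ] with t ht
        refine re_star_dotProduct_nonneg_of_real (fun x => ?_) _
        rw [Matrix.smul_mulVec, dotProduct_smul]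
        exact mul_nonneg h1θ.le (PosDef.dotProduct_mulVec_nonneg ht.posSemidef x)
      · filter_upwards [h.posQ] with t ht
        rw [← dotProduct_add, ← Matrix.add_mulVec, ← cx_add]
        refine re_star_dotProduct_nonneg_of_real (fun x => ?_) _
        refine scalar_lyapunov_nonneg (hc₀.le.trans (hζc t)) (fun x => ?_) x
        rw [Matrix.smul_mulVec, dotProduct_smul, smul_eq_mul, hl, mul_assoc]
        exact mul_le_mul_of_nonneg_left (PosDef.lowerBd_mul_le ht x) h1θ.le
    have hb2 : 0 ≤ θ * (1 - θ)
        * (⟪mulOp T S (toSeq T u), mulOp T G (mulOp T S (toSeq T u))⟫_ℂ).re :=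
      mul_nonneg (mul_nonneg hθ0 h1θ.le) (hGnn _)
    -- Here $\|Du\|^2\le(\|D\|+1)\langle u,Du\rangle$ matters: it makes the quadratic term linear in
    -- the form of `D`.
    have hb3 : (⟪D (toSeq T u), mulOp T G (D (toSeq T u))⟫_ℂ).re
        ≤ 2 * c * (⟪toSeq T u, D (toSeq T u)⟫_ℂ).re := by
      calc _ ≤ ‖⟪D (toSeq T u), mulOp T G (D (toSeq T u))⟫_ℂ‖ := Complex.re_le_norm _
        _ ≤ ‖D (toSeq T u)‖ * (‖mulOp T G‖ * ‖D (toSeq T u)‖) :=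
          (norm_inner_le_norm _ _).trans (by gcongr; exact (mulOp T G).le_opNorm _)
        _ = ‖mulOp T G‖ * ‖D (toSeq T u)‖ ^ 2 := by ring
        _ ≤ ‖mulOp T G‖ * ((‖D‖ + 1) * (⟪toSeq T u, D (toSeq T u)⟫_ℂ).re) := by
          gcongr; exact hDq _
        _ ≤ _ := by
          rw [← mul_assoc]
          exact mul_le_mul_of_nonneg_right (by linarith) (hDn _)
    rw [hact hu]
    linarith
  have hKn : ∀ x, (⟪x, mulOp T Z x - L x⟫_ℂ).re ≤ 0 := by
    intro x
    refine hVd.induction (P := fun x => (⟪x, mulOp T Z x - L x⟫_ℂ).re ≤ 0) (fun x hx => ?_)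
      (isClosed_le (Complex.continuous_re.comp (continuous_id.inner
        ((mulOp T Z).continuous.sub L.continuous))) continuous_const) x
    have h1 := hV (toeplitz T Z 0 - Y) ((colS_toeplitz hT hZp hZm2 0).1.sub hY.columns).1
      ((toeplitz_isHermitian hZp hZs 0).sub hY.hermitian) hlyap x hx
    obtain ⟨u, du, hu, rfl⟩ := hV1 x hx
    rwa [hact hu] at h1
  obtain ⟨p, hp⟩ : ∃ p, ∀ t, ∑ i, ∑ j, |S t i j| ≤ p := by
    have hcont : Continuous fun t => ∑ i, ∑ j, |S t i j| := by fun_prop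
    obtain ⟨p, hp⟩ := (isCompact_Icc (a := 0) (b := T)).exists_bound_of_continuousOn
      hcont.continuousOn
    refine ⟨p, fun t => ?_⟩
    obtain ⟨s, hs, hst⟩ := hS.periodic.exists_mem_Ico₀ hT t
    rw [hst]
    exact (le_abs_self _).trans (hp s (Ico_subset_Icc_self hs))
  have hp0 : 0 ≤ p := le_trans
    (Finset.sum_nonneg fun i _ => Finset.sum_nonneg fun j _ => abs_nonneg _) (hp 0)
  -- With this choice $\delta S\le c_0\le\zeta$ pointwise, as `p` bounds the form of `S`; the added
  -- $1$ avoids division by zero.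
  set δ := c₀ / (p + 1) with hδ
  have hδ0 : 0 < δ := by positivity
  refine ⟨δ, hδ0, fun x => ?_⟩
  have h1 := hKn x
  rw [hZop, inner_sub_right, inner_add_right, inner_smul_right, Complex.sub_re, Complex.add_re,
    Complex.re_ofReal_mul] at h1
  have h2 := re_inner_mulOp_nonneg hT (hζm.add (hSm.smul (-δ))) (Eventually.of_forall fun t x => by
    rw [Matrix.add_mulVec, Matrix.smul_mulVec, Matrix.smul_mulVec, Matrix.one_mulVec,
      dotProduct_add, dotProduct_smul, dotProduct_smul, smul_eq_mul, smul_eq_mul]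
    have h3 := (le_abs_self _).trans (dotProduct_mulVec_le (S t) x)
    have h4 : 0 ≤ x ⬝ᵥ x := Finset.sum_nonneg fun i _ => mul_self_nonneg _
    have h5 : x ⬝ᵥ (S t).mulVec x ≤ (p + 1) * (x ⬝ᵥ x) :=
      h3.trans (mul_le_mul_of_nonneg_right ((hp t).trans (by linarith)) h4)
    have h6 : δ * (x ⬝ᵥ (S t).mulVec x) ≤ δ * ((p + 1) * (x ⬝ᵥ x)) :=
      mul_le_mul_of_nonneg_left h5 hδ0.le
    have h7 : δ * ((p + 1) * (x ⬝ᵥ x)) = c₀ * (x ⬝ᵥ x) := by rw [hδ]; field_simp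
    have h8 := mul_le_mul_of_nonneg_right (hζc t) h4
    linarith) x
  rw [mulOp_add hT hζm (hSm.smul (-δ)), mulOp_smul hT hSm, inner_add_right, inner_smul_right,
    Complex.add_re, Complex.re_ofReal_mul] at h2
  linarith

/-- A harmonic solution is the Toeplitz matrix of every positive definite periodic solution. -/
theorem IsHarmonicForm.eq_toeplitz (h : RiccatiData T A G Q)
    (hS : IsRiccatiPrimitive T A G Q S) (hpos : ∀ t, (S t).PosDef) {Y : BlockMatrix n n}
    (hY : IsHarmonicForm T A G Q Y) (t : ℝ) : Y = toeplitz T S t := by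
  have hT := h.pos
  have hSm : MemLpPeriod T ⊤ S := memLpPeriod_of_continuous hS.prim.continuous
  obtain ⟨L, hLs, hL, hL0, hLS⟩ := hY.exists_operator h hS hpos
  have hSsym := mulOp_symm hT hSm (Eventually.of_forall hS.symm)
  have hSn := re_inner_mulOp_nonneg hT hSm (Eventually.of_forall fun t x =>
    PosDef.dotProduct_mulVec_nonneg (hpos t).posSemidef x)
  -- Connectedness of $[0,1]$: the admissible parameters form a closed set containing $0$ that
  -- extends to the right of each of its points below $1$. The step `δ` need not be uniform.
  have hge : Icc (0 : ℝ) 1 ⊆ {θ | ∀ x, θ * (⟪x, mulOp T S x⟫_ℂ).re ≤ (⟪x, L x⟫_ℂ).re} := by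
    refine IsClosed.Icc_subset_of_forall_exists_gt ?_ (fun x => by simpa using hL0 x) ?_
    · refine IsClosed.inter ?_ isClosed_Icc
      simp only [ofPred_forall]
      exact isClosed_iInter fun x => isClosed_le (by fun_prop) continuous_const
    · rintro θ ⟨hθ, hθ0, hθ1⟩ y hy
      obtain ⟨δ, hδ, hδ'⟩ := hY.exists_gt h hS hLs hL hθ0 hθ1 hθ
      refine ⟨min y (θ + δ), fun x => ?_, lt_min hy (by linarith), min_le_left _ _⟩
      exact (mul_le_mul_of_nonneg_right (min_le_right _ _) (hSn x)).trans (hδ' x)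
  have hone := hge (right_mem_Icc.mpr zero_le_one)
  -- A symmetric operator with vanishing quadratic form is zero.
  have hLeq : L = mulOp T S := by
    rw [← sub_eq_zero]
    have h1 : ((L - mulOp T S : SeqSpace n →L[ℂ] SeqSpace n) : SeqSpace n →ₗ[ℂ] SeqSpace n) = 0 := by
      rw [← inner_map_self_eq_zero]
      intro x
      have e1 : ⟪L x - mulOp T S x, x⟫_ℂ = ⟪x, L x - mulOp T S x⟫_ℂ := by
        rw [inner_sub_left, inner_sub_right, hLs, hSsym]
      have e2 : (⟪L x - mulOp T S x, x⟫_ℂ).im = 0 := by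
        have e3 := congrArg Complex.im e1
        rw [← inner_conj_symm x, Complex.conj_im] at e3
        linarith
      change ⟪L x - mulOp T S x, x⟫_ℂ = 0
      refine Complex.ext ?_ e2
      have e4 := hone x
      have e5 := hLS x
      rw [e1, inner_sub_right, Complex.sub_re, Complex.zero_re]
      linarith
    ext1 x
    exact LinearMap.congr_fun h1 x
  rw [← opMatrix_mulOp hT hS.periodic hSm t, ← hLeq]
  ext i j
  -- Exponentials correspond to the canonical basis, so the operator recovers every column of `Y`.
  have h2 := hL _ _ (isH1_expv (T := T) j)
  rw [toSeq_expv hT, act_bas hY.columns] at h2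
  rw [opMatrix_apply, ← h2, colS_apply hY.columns.colMem]

end Uniqueness

end HarmonicRiccati

end

noncomputable section

set_option linter.unusedSectionVars false

namespace HarmonicRiccati

open MeasureTheory Set Filter Topology

open scoped ComplexConjugate InnerProductSpace

/-! ### Toeplitz matrices and their symbols -/

section Symbols

variable {T : ℝ} {n m : ℕ}

/-- The line is a countable union of translates of one period, and translations preserve null sets.
-/
theorem ae_of_ae_restrict_Ioc (hT : 0 < T) {p : ℝ → Prop} (hp : ∀ t, p (t + T) ↔ p t)
    (h : ∀ᵐ t ∂(volume.restrict (Ioc 0 T)), p t) : ∀ᵐ t, p t := by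
  rw [ae_restrict_iff' measurableSet_Ioc] at h
  have hper : Function.Periodic p T := fun t => propext (hp t)
  have h1 : ∀ k : ℤ, ∀ᵐ t : ℝ, t - k • T ∈ Ioc 0 T → p (t - k • T) := fun k =>
    (measurePreserving_sub_right volume (k • T)).quasiMeasurePreserving.ae h
  filter_upwards [ae_all_iff.mpr h1] with t ht
  obtain ⟨k, hk, -⟩ := existsUnique_sub_zsmul_mem_Ioc hT t 0
  rw [zero_add] at hk
  have := ht k hk
  rwa [hper.sub_zsmul_eq k] at this

theorem toeplitz_congr_ae {M N : ℝ → Matrix (Fin n) (Fin m) ℝ} (h : ∀ᵐ τ, M τ = N τ) (t : ℝ) :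
    toeplitz T M t = toeplitz T N t := by
  ext i j
  rw [toeplitz, toeplitz, phasor, phasor]
  congr 1
  exact intervalIntegral.integral_congr_ae (h.mono fun τ hτ _ => by rw [hτ])

theorem ae_eq_of_coef_eq (hT : 0 < T) {x y : ℝ → ℝ} (hx : Function.Periodic x T)
    (hy : Function.Periodic y T) (hx2 : MemLp x 2 (volume.restrict (Ioc 0 T)))
    (hy2 : MemLp y 2 (volume.restrict (Ioc 0 T)))
    (h : ∀ k, coef T (fun τ => (x τ : ℂ)) k = coef T (fun τ => (y τ : ℂ)) k) :
    ∀ᵐ τ, x τ = y τ := by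
  refine ae_of_ae_restrict_Ioc hT (fun t => by rw [hx t, hy t]) ?_
  have hx3 : SqInt T fun τ => (x τ : ℂ) := MemLp.complex_ofReal hx2
  have hy3 : SqInt T fun τ => (-1 : ℂ) * (y τ : ℂ) := (MemLp.complex_ofReal hy2).const_mul _
  have h1 := ae_eq_zero_of_coef hT (hx3.add hy3) fun k => by
    have := coef_add hT (hx3.integrable (by norm_num)) (hy3.integrable (by norm_num)) k
    rw [coef_const_mul, h k, neg_one_mul, add_neg_cancel] at this
    exact this
  filter_upwards [h1] with τ hτ
  have h2 : (x τ : ℂ) + (-1) * (y τ : ℂ) = 0 := hτ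
  have h3 : (x τ : ℂ) = (y τ : ℂ) := by linear_combination h2
  exact_mod_cast h3

/-- The block column of index $0$ lists all Fourier coefficients of the symbol, so Parseval applies
to each entry. -/
theorem ae_eq_of_toeplitz_eq (hT : 0 < T) {M N : ℝ → Matrix (Fin n) (Fin m) ℝ}
    (hM : Function.Periodic M T) (hN : Function.Periodic N T) (hM2 : MemLpPeriod T 2 M)
    (hN2 : MemLpPeriod T 2 N) {t : ℝ} (h : toeplitz T M t = toeplitz T N t) :
    ∀ᵐ τ, M τ = N τ := by
  have h1 : ∀ a b, ∀ᵐ τ, M τ a b = N τ a b := fun a b => by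
    refine ae_eq_of_coef_eq hT (fun τ => by rw [hM τ]) (fun τ => by rw [hN τ]) (hM2.entry a b)
      (hN2.entry a b) fun k => ?_
    have h2 := congrFun (congrFun h (k, a)) (0, b)
    rw [toeplitz_apply hM, toeplitz_apply hN] at h2
    simpa using h2
  filter_upwards [ae_all_iff.mpr fun a => ae_all_iff.mpr (h1 a)] with τ hτ
  ext a b
  exact hτ a b

theorem mulSeq_opMatrix (L : SeqSpace m →L[ℂ] SeqSpace n) (v : SeqSpace m) :
    mulSeq (opMatrix L) v = L v := by
  ext i
  rw [mulSeq, ← (hasSum_apply_seq (L.hasSum (hasSum_bas v)) i).tsum_eq]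
  refine tsum_congr fun j => ?_
  rw [map_smul, lp.coeFn_smul, Pi.smul_apply, opMatrix_apply, smul_eq_mul, mul_comm]

theorem summable_opMatrix_mul (L : SeqSpace m →L[ℂ] SeqSpace n) (v : SeqSpace m)
    (i : ℤ × Fin n) : Summable fun j => opMatrix L i j * v j := by
  refine (hasSum_apply_seq (L.hasSum (hasSum_bas v)) i).summable.congr fun j => ?_
  rw [map_smul, lp.coeFn_smul, Pi.smul_apply, opMatrix_apply, smul_eq_mul, mul_comm]

theorem isHermitianPosDef_opMatrix_iff (L : SeqSpace n →L[ℂ] SeqSpace n) :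
    IsHermitianPosDef (opMatrix L) ↔
      (opMatrix L).IsHermitian ∧ ∀ v, v ≠ 0 → 0 < (⟪v, L v⟫_ℂ).re := by
  have e : ∀ v : SeqSpace n, (∑' i, star (v i) * mulSeq (opMatrix L) v i) = ⟪v, L v⟫_ℂ := fun v => by
    rw [mulSeq_opMatrix, inner_seq_tsum]; rfl
  constructor
  · rintro ⟨h1, h2⟩
    refine ⟨h1, fun v hv => ?_⟩
    have := h2 v hv (summable_opMatrix_mul L v) (by rw [mulSeq_opMatrix]; exact lp.memℓp _)
    rwa [e] at this
  · rintro ⟨h1, h2⟩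
    refine ⟨h1, fun v hv _ _ => ?_⟩
    rw [e]
    exact h2 v hv

theorem re_inner_mulOp_pos (hT : 0 < T) {M : ℝ → Matrix (Fin n) (Fin n) ℝ}
    (hM : MemLpPeriod T ⊤ M) (hp : ∀ᵐ τ, (M τ).PosDef) {v : SeqSpace n} (hv : v ≠ 0) :
    0 < (⟪v, mulOp T M v⟫_ℂ).re := by
  obtain ⟨u, hu, rfl⟩ := exists_toSeq_eq hT v
  refine lt_of_le_of_ne (re_inner_mulOp_nonneg hT hM (hp.mono fun τ hτ x =>
    PosDef.dotProduct_mulVec_nonneg hτ.posSemidef x) _) fun h0 => hv ?_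
  have hint : IntegrableOn (fun τ => star (u τ) ⬝ᵥ (cx (M τ)).mulVec (u τ)) (Ioc 0 T) :=
    integrable_finsetSum _ fun a _ => integrable_conj_mul (hu a) (VecMemLp.mulVec_sqInt hM hu a)
  have e : (1 / (T : ℂ)) = ((1 / T : ℝ) : ℂ) := by push_cast; rfl
  have h1 : ∫ τ in Ioc 0 T, (star (u τ) ⬝ᵥ (cx (M τ)).mulVec (u τ)).re = 0 := by
    rw [inner_mulOp hT hM hu hu, e, Complex.re_ofReal_mul, eq_comm, mul_eq_zero,
      or_iff_right (by positivity), intervalIntegral.integral_of_le hT.le] at h0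
    exact (integral_re (𝕜 := ℂ) hint).trans h0
  rw [integral_eq_zero_iff_of_nonneg_ae (ae_restrict_of_ae (hp.mono fun τ hτ =>
    re_star_dotProduct_cx_nonneg hτ.posSemidef _)) hint.re] at h1
  rw [← toSeq_zero hT]
  refine toSeq_congr_ae hT ?_
  filter_upwards [h1, ae_restrict_of_ae hp] with τ h2 h3
  by_contra h4
  exact (re_star_dotProduct_cx_pos h3 h4).ne' h2

theorem isHermitianPosDef_toeplitz (hT : 0 < T) {M : ℝ → Matrix (Fin n) (Fin n) ℝ}
    (hM : Function.Periodic M T) (hM2 : MemLpPeriod T ⊤ M) (hp : ∀ᵐ τ, (M τ).PosDef) (t : ℝ) :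
    IsHermitianPosDef (toeplitz T M t) := by
  have hH : (toeplitz T M t).IsHermitian := by
    rw [Matrix.IsHermitian, toeplitz_conjTranspose hM]
    exact toeplitz_congr_ae (hp.mono fun τ hτ => PosDef.transpose_eq hτ) t
  rw [← opMatrix_mulOp hT hM hM2 t] at hH ⊢
  exact (isHermitianPosDef_opMatrix_iff _).mpr ⟨hH, fun v hv => re_inner_mulOp_pos hT hM2 hp hv⟩

/-- Parseval evaluates an entry of the product of two Toeplitz matrices even when the symbol of the
product is only integrable. -/
theorem inner_colS_toeplitz (hT : 0 < T) {M N : ℝ → Matrix (Fin n) (Fin n) ℝ}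
    (hM : Function.Periodic M T) (hN : Function.Periodic N T) (hM2 : MemLpPeriod T 2 M)
    (hN2 : MemLpPeriod T 2 N) (t : ℝ) (i j : ℤ × Fin n) :
    ⟪colS (toeplitz T M t) i, colS (toeplitz T N t) j⟫_ℂ
      = coef T (fun τ => (((M τ).transpose * N τ) i.2 j.2 : ℂ)) (i.1 - j.1) := by
  rw [(colS_toeplitz hT hM hM2 t).2, (colS_toeplitz hT hN hN2 t).2, inner_toSeq hT
    (VecMemLp.mulVec_continuous_sqInt hM2 (continuous_expv i))
    (VecMemLp.mulVec_continuous_sqInt hN2 (continuous_expv j)), coef_eq]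
  congr 1
  refine intervalIntegral.integral_congr fun τ _ => ?_
  have e : char T (-(i.1 - j.1)) τ = char T (-i.1) τ * char T j.1 τ := by
    rw [← char_add]; congr 1; ring
  simp only [dotProduct, Pi.star_apply, cx_mulVec_expv, Matrix.mul_apply, Matrix.transpose_apply, e,
    Complex.ofReal_sum, Finset.sum_mul, star_mul', RCLike.star_def, conj_char, Complex.conj_ofReal,
    Complex.ofReal_mul]
  refine Finset.sum_congr rfl fun a _ => ?_
  ring

theorem mulOp_colS_toeplitz (hT : 0 < T) {M N : ℝ → Matrix (Fin n) (Fin n) ℝ}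
    (hM : Function.Periodic M T) (hN : Function.Periodic N T) (hM2 : MemLpPeriod T ⊤ M)
    (hN2 : MemLpPeriod T 2 N) (t : ℝ) (j : ℤ × Fin n) :
    mulOp T M (colS (toeplitz T N t) j) = colS (toeplitz T (fun τ => M τ * N τ) t) j := by
  have hMN : MemLpPeriod T 2 fun τ => M τ * N τ := hM2.mul (r := 2) hN2
  rw [(colS_toeplitz hT hN hN2 t).2,
    (colS_toeplitz hT (fun τ => by simp only [hM τ, hN τ]) hMN t).2,
    mulOp_toSeq hT hM2 (VecMemLp.mulVec_continuous_sqInt hN2 (continuous_expv j))]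
  simp only [cx_mul_mulVec]

/-- A function whose Fourier coefficients are those of a primitive is a primitive. -/
theorem exists_primitive_of_coef (hT : 0 < T) {x d : ℝ → ℝ} (hx : Function.Periodic x T)
    (hx2 : MemLp x 2 (volume.restrict (Ioc 0 T))) (hd : ∀ s t, IntervalIntegrable d volume s t)
    (hdp : Function.Periodic d T)
    (h : ∀ k : ℤ, coef T (fun τ => (d τ : ℂ)) k
      = Complex.I * ((2 * Real.pi / T : ℝ) : ℂ) * (k : ℂ) * coef T (fun τ => (x τ : ℂ)) k) :
    ∃ s : ℝ → ℝ, IsPrimitive s d ∧ Function.Periodic s T ∧ ∀ᵐ t, s t = x t := by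
  have hTc : (T : ℂ) ≠ 0 := by exact_mod_cast hT.ne'
  have hc0 : ∀ f : ℝ → ℝ, coef T (fun τ => (f τ : ℂ)) 0
      = ((1 / T * ∫ τ in (0 : ℝ)..T, f τ : ℝ) : ℂ) := fun f => by
    rw [coef_eq]
    have : ∀ τ, char T (-0) τ = 1 := fun τ => by simp [char]
    simp only [this, mul_one]
    rw [intervalIntegral.integral_ofReal]
    push_cast; rfl
  -- The condition at frequency $0$ says that `d` has zero mean, and so its primitives are periodic.
  have hd0 : ∫ τ in (0 : ℝ)..T, d τ = 0 := by
    have h1 := h 0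
    rw [hc0] at h1
    simp only [Int.cast_zero, mul_zero, zero_mul, Complex.ofReal_eq_zero] at h1
    exact (mul_eq_zero.mp h1).resolve_left (by positivity)
  set g : ℝ → ℝ := fun t => ∫ τ in (0 : ℝ)..t, d τ with hg
  have hgp : IsPrimitive g d := by
    simpa [hg] using IsPrimitive.integral_of_intervalIntegrable hd 0
  -- The constant of integration that matches the coefficient of index $0$; the others follow by
  -- dividing by the nonzero frequency.
  set c : ℝ := 1 / T * ((∫ τ in (0 : ℝ)..T, x τ) - ∫ τ in (0 : ℝ)..T, g τ) with hc
  have hs : IsPrimitive (fun t => c + g t) d :=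
    ((IsPrimitive.const c).add hgp).congr_ae (Eventually.of_forall fun t => by simp)
  have hsp : Function.Periodic (fun t => c + g t) T := by
    intro t
    have h1 := hs.sub_eq t (t + T)
    rw [hdp.intervalIntegral_add_eq t 0, zero_add, hd0] at h1
    linarith
  refine ⟨_, hs, hsp, ae_eq_of_coef_eq hT hsp hx ?_ hx2 fun k => ?_⟩
  · have h1 : MemLpPeriod T 2 fun t => (Matrix.of fun _ _ => c + g t : Matrix (Fin 1) (Fin 1) ℝ) :=
      memLpPeriod_of_continuous (continuous_matrix fun _ _ => hs.continuous)
    exact h1.entry 0 0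
  · by_cases hk : k = 0
    · subst hk
      rw [hc0, hc0]
      congr 2
      rw [intervalIntegral.integral_add intervalIntegrable_const
        (hgp.continuous.intervalIntegrable 0 T), intervalIntegral.integral_const, smul_eq_mul, hc]
      field_simp
      ring
    · have h1 := coef_deriv (T := T) (hs.clm Complex.ofRealCLM) (by
        have := hsp 0
        rw [zero_add] at this
        simp only [this]) k
      have h2 := h k
      simp only [Complex.ofRealCLM_apply] at h1
      rw [h1] at h2
      refine mul_left_cancel₀ ?_ h2
      have hω : (2 * Real.pi / T : ℝ) ≠ 0 := by positivity
      exact mul_ne_zero (mul_ne_zero Complex.I_ne_zero (by exact_mod_cast hω))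
        (by exact_mod_cast hk)

/-- Localization: if the continuous function $f=x^{\mathsf T}Sx$ were negative somewhere, testing
the form on `x` times the negative part of `f` would give a negative value. -/
theorem dotProduct_mulVec_nonneg_of_form (hT : 0 < T) {S : ℝ → Matrix (Fin n) (Fin n) ℝ}
    (hS : Continuous S) (hSp : Function.Periodic S T)
    (h : ∀ v, 0 ≤ (⟪v, mulOp T S v⟫_ℂ).re) (t : ℝ) (x : Fin n → ℝ) :
    0 ≤ x ⬝ᵥ (S t).mulVec x := by
  by_contra! hneg
  obtain ⟨t₀, ht₀, hst⟩ := hSp.exists_mem_Ico₀ hT t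
  rw [hst] at hneg
  set f : ℝ → ℝ := fun τ => x ⬝ᵥ (S τ).mulVec x with hf
  have hfc : Continuous f := by
    simp only [hf, dotProduct, Matrix.mulVec]; fun_prop
  -- The negative part of `f` serves as a continuous cutoff, for which $g^2f=-g^3$ exactly.
  set g : ℝ → ℝ := fun τ => max (-f τ) 0 with hg
  have hgc : Continuous g := hfc.neg.max continuous_const
  have hg0 : ∀ τ, 0 ≤ g τ := fun τ => le_max_right _ _
  have hgf : ∀ τ, g τ ^ 2 * f τ = -(g τ ^ 3) := fun τ => by
    simp only [hg]
    rcases le_total (-f τ) 0 with h1 | h1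
    · rw [max_eq_right h1]; ring
    · rw [max_eq_left h1]; ring
  have hu : Continuous fun τ => (fun a => ((g τ * x a : ℝ) : ℂ)) := by fun_prop
  have h1 := h (toSeq T fun τ a => ((g τ * x a : ℝ) : ℂ))
  have hus := vecSqInt_of_continuous (T := T) hu
  rw [inner_mulOp hT (memLpPeriod_of_continuous hS) hus hus] at h1
  have h2 : ∀ τ, star (fun a => ((g τ * x a : ℝ) : ℂ)) ⬝ᵥ
      (cx (S τ)).mulVec (fun a => ((g τ * x a : ℝ) : ℂ)) = ((-(g τ ^ 3) : ℝ) : ℂ) := fun τ => by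
    rw [← hgf]
    simp only [hf, dotProduct, Matrix.mulVec, cx_apply, Pi.star_apply, RCLike.star_def,
      Complex.conj_ofReal, Finset.mul_sum]
    push_cast
    refine Finset.sum_congr rfl fun a _ => Finset.sum_congr rfl fun b _ => ?_
    ring
  have e : (1 / (T : ℂ)) = ((1 / T : ℝ) : ℂ) := by push_cast; rfl
  simp only [h2] at h1
  rw [intervalIntegral.integral_ofReal, e, ← Complex.ofReal_mul, Complex.ofReal_re,
    intervalIntegral.integral_neg] at h1
  have h3 : 0 < ∫ τ in (0 : ℝ)..T, g τ ^ 3 :=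
    intervalIntegral.integral_pos hT (hgc.pow 3).continuousOn (fun τ _ => pow_nonneg (hg0 τ) 3)
      ⟨t₀, Ico_subset_Icc_self ht₀, pow_pos (lt_max_of_lt_left (by linarith)) 3⟩
  have h4 : 0 < 1 / T * ∫ τ in (0 : ℝ)..T, g τ ^ 3 := by positivity
  linarith

end Symbols

end HarmonicRiccati

end

noncomputable section

set_option linter.unusedSectionVars false

namespace HarmonicRiccati

open MeasureTheory Set Filter Topology

open scoped ComplexConjugate InnerProductSpace

/-! ### Periodic and harmonic solutions -/

section Solutions

variable {T : ℝ} {n m : ℕ} {A Q P S : ℝ → Matrix (Fin n) (Fin n) ℝ}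
  {B : ℝ → Matrix (Fin n) (Fin m) ℝ} {R : ℝ → Matrix (Fin m) (Fin m) ℝ}

/-- The quadratic coefficient `B R⁻¹ Bᵀ` of the Riccati equation. -/
def quadCoef (B : ℝ → Matrix (Fin n) (Fin m) ℝ) (R : ℝ → Matrix (Fin m) (Fin m) ℝ) (t : ℝ) :
    Matrix (Fin n) (Fin n) ℝ := B t * (R t)⁻¹ * (B t).transpose

theorem isPeriodicSolution_iff : IsPeriodicSolution T A B R Q S ↔
    IsRiccatiPrimitive T A (quadCoef B R) Q S ∧ ∀ t, (S t).PosDef := by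
  have e : ∀ t, S t * quadCoef B R t * S t = S t * B t * (R t)⁻¹ * (B t).transpose * S t :=
    fun t => by simp only [quadCoef, Matrix.mul_assoc]
  constructor
  · intro h
    refine ⟨⟨fun a b => ?_, h.periodic, fun t => PosDef.transpose_eq (h.posDef t)⟩, h.posDef⟩
    refine IsPrimitive.of_absolutelyContinuous_real (h.absCont a b) ?_
    filter_upwards [h.equation] with t ht
    rw [e]
    exact ht a b
  · rintro ⟨h, hp⟩
    refine ⟨h.periodic, hp, fun a b => (h.prim a b).absolutelyContinuous, ?_⟩
    filter_upwards [ae_all_iff.mpr fun a => ae_all_iff.mpr fun b => (h.prim a b).hasDerivAt_ae]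
      with t ht a b
    have := ht a b
    rwa [e] at this

theorem riccatiData_quadCoef (hT : 0 < T) (hA : Function.Periodic A T) (hA2 : MemLpPeriod T 2 A)
    (hB : Function.Periodic B T) (hB2 : MemLpPeriod T ⊤ B) (hR : Function.Periodic R T)
    (hRi : MemLpPeriod T ⊤ fun t => (R t)⁻¹) (hRpos : ∀ᵐ t, (R t).PosDef)
    (hQ : Function.Periodic Q T) (hQ2 : MemLpPeriod T ⊤ Q) (hQpos : ∀ᵐ t, (Q t).PosDef) :
    RiccatiData T A (quadCoef B R) Q where
  pos := hT
  perA := hA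
  memA := hA2
  perG t := by simp only [quadCoef, hB t, hR t]
  memG := (hB2.mul (r := ⊤) hRi).mul (r := ⊤) hB2.transpose
  posG := hRpos.mono fun t ht => by
    have := ht.inv.posSemidef.mul_mul_conjTranspose_same (B t)
    rwa [Matrix.conjTranspose_eq_transpose_of_trivial] at this
  perQ := hQ
  memQ := hQ2
  posQ := hQpos

/-- The harmonic Riccati equation in terms of the columns of the unknown. -/
theorem riccati_equation_iff (hT : 0 < T) (hA : Function.Periodic A T) (hA2 : MemLpPeriod T 2 A)
    (hB : Function.Periodic B T) (hB2 : MemLpPeriod T ⊤ B)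
    (hRi : MemLpPeriod T ⊤ fun t => (R t)⁻¹) (hQ : Function.Periodic Q T)
    (hQ2 : MemLpPeriod T ⊤ Q) (t : ℝ) {X : BlockMatrix n n} (hX : X.IsHermitian)
    (hXc : ColMem X) :
    mmul X (toeplitz T A t - harmonicN n T) + mmul (toeplitz T A t - harmonicN n T).conjTranspose X
      - mmul X (mmul (toeplitz T B t) (mmul (opMatrix (mulOp T fun t => (R t)⁻¹))
        (mmul (toeplitz T B t).conjTranspose X))) + toeplitz T Q t = 0 ↔
    ∀ i j, ⟪colS X i, colS (toeplitz T A t) j - freq T j • bas j⟫_ℂ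
      + ⟪colS (toeplitz T A t) i - freq T i • bas i, colS X j⟫_ℂ
      - ⟪colS X i, mulOp T (quadCoef B R) (colS X j)⟫_ℂ + ⟪bas i, mulOp T Q (bas j)⟫_ℂ = 0 := by
  rw [← opMatrix_mulOp hT hQ hQ2 t, harmonic_equation_iff hX hXc
    (colS_toeplitz hT hA hA2 t).1.colMem (mulOp T B) (mulOp T fun t => (R t)⁻¹)
    (mulOp T fun t => (B t).transpose) (mulOp T Q) (opMatrix_mulOp hT hB hB2 t).symm]
  · simp only [mulOp_mulOp hT hRi hB2.transpose,
      mulOp_mulOp hT hB2 (hRi.mul (r := ⊤) hB2.transpose)]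
    simp only [← Matrix.mul_assoc]
    rfl
  · rw [toeplitz_conjTranspose hB, opMatrix_mulOp hT (fun t => by simp only [hB t]) hB2.transpose t]

theorem isHarmonicForm_of_columns (h : RiccatiData T A S Q) (t : ℝ) {X : BlockMatrix n n}
    (hXc : HasBoundedColumns X) (hX : IsHermitianPosDef X)
    (heq : ∀ i j, ⟪colS X i, colS (toeplitz T A t) j - freq T j • bas j⟫_ℂ
      + ⟪colS (toeplitz T A t) i - freq T i • bas i, colS X j⟫_ℂ
      - ⟪colS X i, mulOp T S (colS X j)⟫_ℂ + ⟪bas i, mulOp T Q (bas j)⟫_ℂ = 0) :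
    IsHarmonicForm T A S Q X where
  columns := hXc
  hermitian := hX.1
  nonneg _ hx := hX.re_inner_act_nonneg hXc hx
  form u du hu := by
    refine two_mul_re_of_form ?_
    rw [inner_conj_symm]
    exact harmonic_form h.pos hXc h.perA h.memA t heq hu hu

variable {G : ℝ → Matrix (Fin n) (Fin n) ℝ}

/-- The time-domain form evaluated at pairs of exponentials. -/
theorem IsRiccatiPrimitive.columns (h : RiccatiData T A G Q) (hS : IsRiccatiPrimitive T A G Q S)
    (t : ℝ) (i j : ℤ × Fin n) :
    ⟪colS (toeplitz T S t) i, colS (toeplitz T A t) j - freq T j • bas j⟫_ℂ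
      + ⟪colS (toeplitz T A t) i - freq T i • bas i, colS (toeplitz T S t) j⟫_ℂ
      - ⟪colS (toeplitz T S t) i, mulOp T G (colS (toeplitz T S t) j)⟫_ℂ
      + ⟪bas i, mulOp T Q (bas j)⟫_ℂ = 0 := by
  have hT := h.pos
  have hSc := hS.prim.continuous
  have e1 : ∀ j : ℤ × Fin n, mulOp T S (toSeq T (expv T j)) = colS (toeplitz T S t) j := fun j => by
    rw [(colS_toeplitz hT hS.periodic (memLpPeriod_of_continuous hSc) t).2,
      mulOp_toSeq hT (memLpPeriod_of_continuous hSc) (vecSqInt_of_continuous (continuous_expv j))]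
  have e2 : ∀ j : ℤ × Fin n, toSeq T (fun τ => (cx (A τ)).mulVec (expv T j τ)
      - freq T j • expv T j τ) = colS (toeplitz T A t) j - freq T j • bas j := fun j => by
    have hv := vecSqInt_of_continuous (continuous_expv (T := T) j) (T := T)
    rw [toSeq_sub hT (VecMemLp.mulVec_continuous_sqInt h.memA (continuous_expv j)) (hv.smul _),
      toSeq_smul hT _ hv, toSeq_expv hT, (colS_toeplitz hT h.perA h.memA t).2]
  have h1 := hS.form h (isH1_expv (T := T) i) (isH1_expv (T := T) j)
  rw [e1, e1, e2, e2, toSeq_expv hT, toSeq_expv hT] at h1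
  exact h1

theorem coef_neg_add_sub_add (hT : 0 < T) {f₁ f₂ f₃ f₄ : ℝ → ℂ} (h₁ : IntegrableOn f₁ (Ioc 0 T))
    (h₂ : IntegrableOn f₂ (Ioc 0 T)) (h₃ : IntegrableOn f₃ (Ioc 0 T))
    (h₄ : IntegrableOn f₄ (Ioc 0 T)) (k : ℤ) :
    coef T (fun τ => -(f₁ τ + f₂ τ - f₃ τ + f₄ τ)) k
      = -(coef T f₁ k + coef T f₂ k - coef T f₃ k + coef T f₄ k) := by
  have h₃' : IntegrableOn (fun τ => (-1 : ℂ) * f₃ τ) (Ioc 0 T) := Integrable.const_mul h₃ _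
  have e : (fun τ => -(f₁ τ + f₂ τ - f₃ τ + f₄ τ))
      = fun τ => (-1 : ℂ) * (f₁ τ + f₂ τ + (-1 : ℂ) * f₃ τ + f₄ τ) := by
    ext τ; ring
  rw [e, coef_const_mul, coef_add (u := fun τ => f₁ τ + f₂ τ + (-1 : ℂ) * f₃ τ) hT
    ((h₁.add h₂).add h₃') h₄, coef_add (u := fun τ => f₁ τ + f₂ τ) hT (h₁.add h₂) h₃',
    coef_add hT h₁ h₂, coef_const_mul]
  ring

/-- If the Toeplitz matrix of `P` solves the harmonic Riccati equation, then `P` agrees almost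
everywhere with a periodic solution of the Riccati differential equation. -/
theorem exists_isRiccatiPrimitive (h : RiccatiData T A G Q) (hP : Function.Periodic P T)
    (hP2 : MemLpPeriod T 2 P) {t : ℝ} (hH : IsHermitianPosDef (toeplitz T P t))
    (heq : ∀ i j, ⟪colS (toeplitz T P t) i, colS (toeplitz T A t) j - freq T j • bas j⟫_ℂ
      + ⟪colS (toeplitz T A t) i - freq T i • bas i, colS (toeplitz T P t) j⟫_ℂ
      - ⟪colS (toeplitz T P t) i, mulOp T G (colS (toeplitz T P t) j)⟫_ℂ
      + ⟪bas i, mulOp T Q (bas j)⟫_ℂ = 0) :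
    ∃ S, (∀ᵐ τ, S τ = P τ) ∧ IsRiccatiPrimitive T A G Q S ∧ ∀ t, (S t).PosDef := by
  have hT := h.pos
  have hPsym : ∀ᵐ τ, (P τ).transpose = P τ := by
    refine ae_eq_of_toeplitz_eq hT (fun τ => by simp only [hP τ]) hP hP2.transpose hP2 (t := t) ?_
    rw [← toeplitz_conjTranspose hP]
    exact hH.1
  have hGP : MemLpPeriod T 2 fun τ => G τ * P τ := h.memG.mul (r := 2) hP2
  have hGPp : Function.Periodic (fun τ => G τ * P τ) T := fun τ => by simp only [h.perG τ, hP τ]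
  have hm1 : MemLpPeriod T 1 fun τ => (P τ).transpose * A τ := hP2.transpose.mul (r := 1) h.memA
  have hm2 : MemLpPeriod T 1 fun τ => (A τ).transpose * P τ := h.memA.transpose.mul (r := 1) hP2
  have hm3 : MemLpPeriod T 1 fun τ => (P τ).transpose * (G τ * P τ) :=
    hP2.transpose.mul (r := 1) hGP
  have hm4 : MemLpPeriod T 1 Q := h.memQ.mono le_top
  -- The candidate derivative of `P`, only integrable over a period. The transposes are those
  -- produced by inner products of columns; the symmetry of `P`, known almost everywhere, removes
  -- them at the end.
  set D : ℝ → Matrix (Fin n) (Fin n) ℝ := fun τ => -((P τ).transpose * A τ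
    + (A τ).transpose * P τ - (P τ).transpose * (G τ * P τ) + Q τ) with hD
  have hDm : MemLpPeriod T 1 D := (((hm1.add hm2).sub hm3).add hm4).neg
  have hDp : Function.Periodic D T := fun τ => by
    simp only [hD, h.perA τ, h.perG τ, h.perQ τ, hP τ]
  have hDe := hDm.entrywiseIntegrable hT le_rfl hDp
  have hcoef : ∀ a b (k : ℤ), coef T (fun τ => (D τ a b : ℂ)) k
      = Complex.I * ((2 * Real.pi / T : ℝ) : ℂ) * (k : ℂ) * coef T (fun τ => (P τ a b : ℂ)) k := by
    intro a b k
    -- In block column $0$ one frequency term vanishes, and the equation reads as the coefficient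
    -- relation between `P` and its candidate derivative.
    have h1 := heq (k, a) (0, b)
    have hPc := (colS_toeplitz hT hP hP2 t).1.colMem
    have hi : ∀ {M : ℝ → Matrix (Fin n) (Fin n) ℝ}, MemLpPeriod T 1 M →
        IntegrableOn (fun τ => (M τ a b : ℂ)) (Ioc 0 T) := fun hM =>
      memLp_one_iff_integrable.mp (MemLp.complex_ofReal (hM.entry a b))
    have e0 : toeplitz T P t (k, a) (0, b) = coef T (fun τ => (P τ a b : ℂ)) k := by
      rw [toeplitz_apply hP]; simp
    have e2 : conj (freq T ((k, a) : ℤ × Fin n)) = -freq T ((k, a) : ℤ × Fin n) := by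
      simp only [freq, map_mul, Complex.conj_I, Complex.conj_ofReal, map_intCast]; ring
    have e3 : freq T ((0, b) : ℤ × Fin n) = 0 := by simp [freq]
    have e4 : ⟪(bas (k, a) : SeqSpace n), mulOp T Q (bas (0, b))⟫_ℂ
        = coef T (fun τ => (Q τ a b : ℂ)) k := by
      rw [inner_bas_left, ← opMatrix_apply, opMatrix_mulOp hT h.perQ h.memQ t,
        toeplitz_apply h.perQ]; simp
    rw [inner_sub_left, inner_sub_right, inner_smul_left, inner_smul_right, inner_bas_left,
      mulOp_colS_toeplitz hT h.perG hP h.memG hP2, inner_colS_toeplitz hT hP h.perA hP2 h.memA,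
      inner_colS_toeplitz hT h.perA hP h.memA hP2, inner_colS_toeplitz hT hP hGPp hP2 hGP,
      colS_apply hPc, e0, e2, e3, e4] at h1
    simp only [sub_zero, zero_mul] at h1
    have e5 : coef T (fun τ => (D τ a b : ℂ)) k
        = -(coef T (fun τ => (((P τ).transpose * A τ) a b : ℂ)) k
          + coef T (fun τ => (((A τ).transpose * P τ) a b : ℂ)) k
          - coef T (fun τ => (((P τ).transpose * (G τ * P τ)) a b : ℂ)) k
          + coef T (fun τ => (Q τ a b : ℂ)) k) := by
      rw [← coef_neg_add_sub_add hT (hi hm1) (hi hm2) (hi hm3) (hi hm4)]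
      congr 1
      ext τ
      simp only [hD, Matrix.neg_apply, Matrix.add_apply, Matrix.sub_apply]
      push_cast; ring
    rw [e5]
    simp only [freq] at h1
    linear_combination -h1
  choose S hSprim hSper hSae using fun a b => exists_primitive_of_coef hT
    (fun τ => by rw [hP τ]) (hP2.entry a b) (hDe a b) (fun τ => by rw [hDp τ]) (hcoef a b)
  have hSP : ∀ᵐ τ, (Matrix.of fun a b => S a b τ) = P τ := by
    filter_upwards [ae_all_iff.mpr fun a => ae_all_iff.mpr fun b => hSae a b] with τ hτ
    ext a b
    exact hτ a b
  have hprim : IsMatrixPrimitive (fun τ => Matrix.of fun a b => S a b τ) D := hSprim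
  -- Two continuous functions equal almost everywhere are equal everywhere.
  have hsymm : ∀ τ, (Matrix.of fun a b => S a b τ).transpose = Matrix.of fun a b => S a b τ := by
    have hc := hprim.continuous
    refine fun τ => congrFun ((hc.matrix_transpose.ae_eq_iff_eq volume hc).mp ?_) τ
    filter_upwards [hSP, hPsym] with τ h1 h2
    rw [h1, h2]
  have hR : IsRiccatiPrimitive T A G Q (fun τ => Matrix.of fun a b => S a b τ) := by
    refine ⟨hprim.congr_ae ?_, fun τ => ?_, hsymm⟩
    · filter_upwards [hSP, hPsym] with τ h1 h2
      rw [h1, hD]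
      beta_reduce
      rw [h2, Matrix.mul_assoc, add_comm (P τ * A τ)]
    · ext a b
      exact hSper a b τ
  refine ⟨_, hSP, hR, hR.posDef h ?_⟩
  refine dotProduct_mulVec_nonneg_of_form hT hprim.continuous hR.periodic fun v => ?_
  rw [← toeplitz_congr_ae hSP, ← opMatrix_mulOp hT hR.periodic
    (memLpPeriod_of_continuous hprim.continuous) t, isHermitianPosDef_opMatrix_iff] at hH
  by_cases hv : v = 0
  · simp [hv]
  · exact (hH.2 v hv).le

end Solutions

end HarmonicRiccati

end

/-! ### Equivalence of the periodic and the harmonic Riccati equations -/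

open HarmonicRiccati MeasureTheory in
/-- The operator `𝓡` is the bounded operator on `ℓ²` with matrix `𝒯_T(R)`; it is boundedly
invertible, and `𝓡.symm` is `ℛ⁻¹`. A Toeplitz transform determines its symbol only almost
everywhere, so on the time side `P` is identified with its absolutely continuous version `S`. -/
theorem mainTheorem9 {n m : ℕ} (T : ℝ) (hT : 0 < T)
    (A : ℝ → Matrix (Fin n) (Fin n) ℝ) (B : ℝ → Matrix (Fin n) (Fin m) ℝ)
    (R : ℝ → Matrix (Fin m) (Fin m) ℝ) (Q : ℝ → Matrix (Fin n) (Fin n) ℝ)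
    (hA : Function.Periodic A T) (hA2 : MemLpPeriod T 2 A)
    (hB : Function.Periodic B T) (hB2 : MemLpPeriod T ⊤ B)
    (hR : Function.Periodic R T) (hR2 : MemLpPeriod T ⊤ R) (hRpos : ∀ᵐ t : ℝ, (R t).PosDef)
    (hQ : Function.Periodic Q T) (hQ2 : MemLpPeriod T ⊤ Q) (hQpos : ∀ᵐ t : ℝ, (Q t).PosDef)
    (hdet : ∃ η : ℝ, 0 < η ∧ volume {t : ℝ | |(R t).det| < η} = 0)
    (t : ℝ) :
    IsHermitianPosDef (toeplitz T Q t) ∧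
    ∃ 𝓡 : SeqSpace m ≃L[ℂ] SeqSpace m,
      opMatrix (𝓡 : SeqSpace m →L[ℂ] SeqSpace m) = toeplitz T R t ∧
      ∀ P : ℝ → Matrix (Fin n) (Fin n) ℝ, Function.Periodic P T → MemLpPeriod T 2 P →
        ((∃ S : ℝ → Matrix (Fin n) (Fin n) ℝ, (∀ᵐ τ : ℝ, S τ = P τ) ∧
            IsUniquePeriodicSolution T A B R Q S) ↔
          IsUniqueHarmonicSolution T (toeplitz T A t) (toeplitz T B t)
            (opMatrix (𝓡.symm : SeqSpace m →L[ℂ] SeqSpace m)) (toeplitz T Q t)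
            (toeplitz T P t)) ∧
        (IsUniqueHarmonicSolution T (toeplitz T A t) (toeplitz T B t)
            (opMatrix (𝓡.symm : SeqSpace m →L[ℂ] SeqSpace m)) (toeplitz T Q t)
            (toeplitz T P t) →
          IsBoundedMatrix (toeplitz T P t)) := by
  obtain ⟨η, hη, hdet⟩ := hdet
  have hdet' : ∀ᵐ τ : ℝ, η ≤ |(R τ).det| := by
    rw [ae_iff]
    simpa only [not_le] using hdet
  have hRi : MemLpPeriod T ⊤ fun τ => (R τ)⁻¹ := memLpPeriod_inv hR2 hη hdet'
  have hunit : ∀ᵐ τ : ℝ, IsUnit (R τ).det := hdet'.mono fun τ hτ =>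
    isUnit_iff_ne_zero.mpr fun h0 => by rw [h0, abs_zero] at hτ; linarith
  -- The inverse operator is multiplication by the pointwise inverse, which is essentially bounded
  -- thanks to the lower bound on the determinant.
  have hinv₁ : ∀ v, mulOp T (fun τ => (R τ)⁻¹) (mulOp T R v) = v := fun v => by
    rw [mulOp_mulOp hT hRi hR2]
    exact mulOp_eq_self hT (hRi.mul (r := ⊤) hR2)
      (hunit.mono fun τ hτ => Matrix.nonsing_inv_mul _ hτ) v
  have hinv₂ : ∀ v, mulOp T R (mulOp T (fun τ => (R τ)⁻¹) v) = v := fun v => by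
    rw [mulOp_mulOp hT hR2 hRi]
    exact mulOp_eq_self hT (hR2.mul (r := ⊤) hRi)
      (hunit.mono fun τ hτ => Matrix.mul_nonsing_inv _ hτ) v
  have hdata : RiccatiData T A (quadCoef B R) Q :=
    riccatiData_quadCoef hT hA hA2 hB hB2 hR hRi hRpos hQ hQ2 hQpos
  refine ⟨isHermitianPosDef_toeplitz hT hQ hQ2 hQpos t,
    ContinuousLinearEquiv.equivOfInverse (mulOp T R) (mulOp T fun τ => (R τ)⁻¹) hinv₁ hinv₂,
    opMatrix_mulOp hT hR hR2 t, fun P hP hP2 => ?_⟩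
  set 𝒮 := IsHarmonicSolution T (toeplitz T A t) (toeplitz T B t)
    (opMatrix (mulOp T fun τ => (R τ)⁻¹)) (toeplitz T Q t) with h𝒮
  change ((∃ S : ℝ → Matrix (Fin n) (Fin n) ℝ, (∀ᵐ τ : ℝ, S τ = P τ) ∧
      IsUniquePeriodicSolution T A B R Q S) ↔
        (𝒮 (toeplitz T P t) ∧ ∀ Y, 𝒮 Y → Y = toeplitz T P t)) ∧
      ((𝒮 (toeplitz T P t) ∧ ∀ Y, 𝒮 Y → Y = toeplitz T P t) →
        IsBoundedMatrix (toeplitz T P t))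
  have hform : ∀ Y, 𝒮 Y → IsHarmonicForm T A (quadCoef B R) Q Y := fun Y hY =>
    isHarmonicForm_of_columns hdata t hY.columns hY.posDef
      ((riccati_equation_iff hT hA hA2 hB hB2 hRi hQ hQ2 t hY.posDef.1 hY.columns.colMem).mp
        hY.equation)
  have hsol : ∀ S, IsPeriodicSolution T A B R Q S → 𝒮 (toeplitz T S t) := fun S hS => by
    obtain ⟨hS, hpos⟩ := isPeriodicSolution_iff.mp hS
    have hSc := hS.prim.continuous
    have hcol := (colS_toeplitz hT hS.periodic (memLpPeriod_of_continuous hSc) t).1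
    have hpd := isHermitianPosDef_toeplitz hT hS.periodic (memLpPeriod_of_continuous hSc)
      (Filter.Eventually.of_forall hpos) t
    exact ⟨hcol, hpd, (riccati_equation_iff hT hA hA2 hB hB2 hRi hQ hQ2 t hpd.1 hcol.colMem).mpr
      (hS.columns hdata t)⟩
  have huniq : ∀ S, IsPeriodicSolution T A B R Q S → ∀ Y, 𝒮 Y → Y = toeplitz T S t :=
    fun S hS Y hY => by
      obtain ⟨hS, hpos⟩ := isPeriodicSolution_iff.mp hS
      exact (hform Y hY).eq_toeplitz hdata hS hpos t
  have hexists : 𝒮 (toeplitz T P t) → ∃ S, (∀ᵐ τ : ℝ, S τ = P τ) ∧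
      IsPeriodicSolution T A B R Q S := fun h => by
    obtain ⟨S, hSP, hS, hpos⟩ := exists_isRiccatiPrimitive hdata hP hP2 h.posDef
      ((riccati_equation_iff hT hA hA2 hB hB2 hRi hQ hQ2 t h.posDef.1 h.columns.colMem).mp
        h.equation)
    exact ⟨S, hSP, isPeriodicSolution_iff.mpr ⟨hS, hpos⟩⟩
  refine ⟨⟨?_, ?_⟩, ?_⟩
  · rintro ⟨S, hSP, hS, -⟩
    rw [← toeplitz_congr_ae hSP]
    exact ⟨hsol S hS, huniq S hS⟩
  -- Only solvability on the harmonic side is used. Uniqueness on the time side comes from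
  -- comparison: every other periodic solution yields a harmonic solution with the same Toeplitz
  -- matrix, so the continuous symbols coincide.
  · rintro ⟨h, -⟩
    obtain ⟨S, hSP, hS⟩ := hexists h
    refine ⟨S, hSP, hS, fun S' hS' => ?_⟩
    have h₁ := (isPeriodicSolution_iff.mp hS).1
    have h₂ := (isPeriodicSolution_iff.mp hS').1
    have hc₁ := h₁.prim.continuous
    have hc₂ := h₂.prim.continuous
    exact (hc₂.ae_eq_iff_eq volume hc₁).mp (ae_eq_of_toeplitz_eq hT h₂.periodic h₁.periodic
      (memLpPeriod_of_continuous hc₂) (memLpPeriod_of_continuous hc₁)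
      (huniq S hS _ (hsol S' hS')))
  -- The symbol agrees almost everywhere with a continuous periodic function, whose multiplication
  -- operator is bounded.
  · rintro ⟨h, -⟩
    obtain ⟨S, hSP, hS⟩ := hexists h
    have h₁ := (isPeriodicSolution_iff.mp hS).1
    rw [← toeplitz_congr_ae hSP]
    exact ⟨mulOp T S, opMatrix_mulOp hT h₁.periodic
      (memLpPeriod_of_continuous h₁.prim.continuous) t⟩
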